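/- **Theorem 6.2.** *Setting.* Manifolds, bundles and sections are smooth and finite-dimensional, and $M,N$ are Hausdorff. Let $h:M\to N$ and $\eta:N\to M$ be diffeomorphisms, and let $((F,\nu,N),[\,,]_{F,h},(\rho,\eta))$ be a generalized Lie algebroid: $\rho:F\to TM$ is a vector bundle morphism over $\eta$; $[\,,]_{F,h}$ is a real Lie bracket on $\Gamma(F)$; $[u,fv]_{F,h}=f[u,v]_{F,h}+(\Gamma(Th\circ\rho,h\circ\eta)(u)f)\,v$ for $f\in C^\infty(N)$; and $u\mapsto\Gamma(Th\circ\rho,h\circ\eta)(u)$ is a Lie algebra morphism into the vector fields on $N$. Let $E\to M$ be a vector bundle of rank $r$ which is identified with $F$ by a vector bundle isomorphism $\varphi:E\to F$ over $h$ (for $E=F$, $h=\mathrm{id}$ one may take $\varphi=\mathrm{id}$). Let $\pi:E^*\to M$ be the dual bundle. For $x\in M$ let $\hat\rho_x:F_{h(x)}\to T_xM$ be the anchor $Z^a(\rho_a^i\circ h)\partial_i$ of $h^*F$ (it is $\rho$ if $\eta(h(x))=x$; otherwise the axioms force $\rho$ to be zero on $F_{h(x)}$ and $\hat\rho_x=0$).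 The generalized tangent bundle $L=(\rho,\eta)TE^*\to E^*$ has at $u\in E^*_x$ the fibre $L_u=\{(z,v)\in F_{h(x)}\times T_uE^*:\ T\pi(v)=\hat\rho_x(z)\}$. A section $X=(z,v)$ of $L$ acts on functions on $E^*$ through $v$. The vertical subbundle $VL$ is $\{z=0\}$. Let $(\rho,\eta)\Gamma:L\to VL$ be a $(\rho,\eta)$-connection, i.e. a smooth left splitting of $VL\subset L$, and let $HL$ be its kernel, so that $L=HL\oplus VL$. A vector chart over an open $U\subset M$ is a frame $(s_a)$ of $E|_U$ with dual frame $(s^a)$ and corresponding frame $t_a=\varphi s_a$ of $F|_{h(U)}$. Write $[t_b,t_c]_{F,h}=L^a_{bc}t_a$. Over $\pi^{-1}(U)$ the adapted base of $L$ is $(\tilde\delta_a,\dot\partial^a)$, where $\tilde\delta_a$ is the horizontal section with first component $t_a\circ h\circ\pi$, and $\dot\partial^a$ is the vertical lift of $s^a$. Its dual base is $(d\tilde z^a,\delta\tilde p_a)$. The Lie algebroid bracket of $L$ is $$[(Z_1,v_1),(Z_2,v_2)]=\big((Z_1^aZ_2^b\,L^d_{ab}\circ h\circ\pi+v_1(Z_2^d)-v_2(Z_1^d))\,t_d\circ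 h\circ\pi,\ [v_1,v_2]\big).$$ A distinguished linear $(\rho,\eta)$-connection is a covariant derivative $D$ on $L$, with derivations along sections of $L$, which preserves $HL$ and $VL$. Its components $(H^a_{bc},\hat H^a_{bc},\hat V^{ac}_b,V^{ac}_b)$ in a vector chart are given by $$D_{\tilde\delta_c}\tilde\delta_b=H^a_{bc}\tilde\delta_a,\quad D_{\tilde\delta_c}\dot\partial^a=-\hat H^a_{bc}\dot\partial^b,\quad D_{\dot\partial^c}\tilde\delta_b=-\hat V^{ac}_b\tilde\delta_a,\quad D_{\dot\partial^c}\dot\partial^a=V^{ac}_b\dot\partial^b .$$ $D$ is normal if $\hat H^a_{bc}=H^a_{bc}$ and $\hat V^{ac}_b=V^{ac}_b$ in every vector chart; then $(H^a_{bc},V^{ac}_b)$ are called its components. The torsion of $D$ is $\mathrm{Tor}(X,Y)=D_XY-D_YX-[X,Y]$. Let $$G=\tilde g_{ab}\,d\tilde z^a\otimes d\tilde z^b+g^{ab}\,\delta\tilde p_a\otimes\delta\tilde p_b$$ be a (pseudo)metrical structure on $L$ (smooth, symmetric, nondegenerate at every point of $E^*$) which is determined by its vertical part: $(\tilde g_{ab})=(g^{ab})^{-1}$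 in every vector chart. *Statement.* Let $\mathbb T=\mathbb T^a_{bc}\,\tilde\delta_a\otimes d\tilde z^b\otimes d\tilde z^c$ and $\mathbb S=\mathbb S^{ac}_b\,\dot\partial^b\otimes\delta\tilde p_a\otimes\delta\tilde p_c$ be smooth tensor fields with $\mathbb T^a_{bc}=-\mathbb T^a_{cb}$ and $\mathbb S^{ac}_b=-\mathbb S^{ca}_b$. Put, in every vector chart, $$\begin{aligned}H^a_{bc}&=\tfrac12g^{ae}\big(\tilde\delta_b\tilde g_{ec}+\tilde\delta_c\tilde g_{be}-\tilde\delta_e\tilde g_{bc}-\tilde g_{cd}L^d_{be}\circ h\circ\pi+\tilde g_{bd}L^d_{ec}\circ h\circ\pi-\tilde g_{ed}L^d_{bc}\circ h\circ\pi\big),\\ V^{ac}_b&=\tfrac12\tilde g_{be}\big(\dot\partial^cg^{ea}+\dot\partial^ag^{ec}-\dot\partial^eg^{ac}\big)\end{aligned}\tag{6.5}$$ and $$\begin{aligned}\tilde H^a_{bc}&=H^a_{bc}+\tfrac12g^{ae}\big(\tilde g_{ed}\mathbb T^d_{bc}-\tilde g_{bd}\mathbb T^d_{ec}+\tilde g_{cd}\mathbb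 T^d_{be}\big),\\ \tilde V^{ac}_b&=V^{ac}_b+\tfrac12\tilde g_{be}\big(g^{ed}\mathbb S^{ac}_d-g^{ad}\mathbb S^{ec}_d+g^{cd}\mathbb S^{ae}_d\big).\end{aligned}\tag{6.6}$$ Then there is a normal distinguished linear $(\rho,\eta)$-connection $D$ on $L$ with the components $(\tilde H^a_{bc},\tilde V^{ac}_b)$ in every vector chart. It is metric, $D_XG=0$ for all $X$, so that $L$ becomes a generalized Hamilton $(\rho,\eta)$-space. Its $\mathcal H(\mathcal{HH})$ and $\mathcal V(\mathcal{VV})$ torsions are $\mathbb T$ and $\mathbb S$: the horizontal part of $\mathrm{Tor}(\tilde\delta_c,\tilde\delta_b)$ is $\mathbb T^a_{bc}\tilde\delta_a$, and $\mathrm{Tor}(\dot\partial^c,\dot\partial^a)=\mathbb S^{ac}_b\dot\partial^b$. Moreover $$\mathbb T^a_{bc}=\tilde H^a_{bc}-\tilde H^a_{cb}-L^a_{cb}\circ h\circ\pi,\qquad \mathbb S^{ac}_b=\tilde V^{ac}_b-\tilde V^{ca}_b.\tag{6.7}$$ -/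

import Mathlib

open Bundle Manifold Set
open scoped ContDiff Topology

set_option linter.unusedSectionVars false

noncomputable section

namespace GenHamilton

universe u₁ u₂ u₃ u₄ u₅ u₆ u₇ u₈

/-! ### Generalized Lie algebroids -/

section Algebroid

variable {EM : Type u₁} [NormedAddCommGroup EM] [NormedSpace ℝ EM]
  {M : Type u₂} [TopologicalSpace M] [ChartedSpace EM M] [IsManifold 𝓘(ℝ, EM) ∞ M]
  {EN : Type u₃} [NormedAddCommGroup EN] [NormedSpace ℝ EN]
  {N : Type u₄} [TopologicalSpace N] [ChartedSpace EN N]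
  {VF : Type u₅} [NormedAddCommGroup VF] [NormedSpace ℝ VF]
  {F : N → Type u₆} [∀ y, AddCommGroup (F y)] [∀ y, Module ℝ (F y)]
  [∀ y, TopologicalSpace (F y)] [TopologicalSpace (TotalSpace VF F)]
  [FiberBundle VF F]

/-- The derivation `f ↦ Γ(Th ∘ ρ, h ∘ η)(σ) f` of functions on `N`, for a section `σ` of `F`:
the vector field `Γ(Th ∘ ρ, h ∘ η)(σ)` has at the point `y = h (η w)` the value `Th (ρ (σ w))`. -/
def anchorDeriv (h : M ≃ₘ^∞⟮𝓘(ℝ, EM), 𝓘(ℝ, EN)⟯ N) (η : N ≃ₘ^∞⟮𝓘(ℝ, EN), 𝓘(ℝ, EM)⟯ M)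
    (ρ : ∀ y : N, F y →ₗ[ℝ] TangentSpace 𝓘(ℝ, EM) (η y)) (σ : ∀ y : N, F y) (f : N → ℝ) :
    N → ℝ := fun y ↦
  let w : N := η.symm (h.symm y)
  mfderiv 𝓘(ℝ, EN) 𝓘(ℝ, ℝ) f (h (η w)) (mfderiv 𝓘(ℝ, EM) 𝓘(ℝ, EN) h (η w) (ρ w (σ w)))

variable (EM M EN VF F) [VectorBundle ℝ VF F] in
/-- A generalized Lie algebroid `((F, ν, N), [ , ]_{F,h}, (ρ, η))`. -/
structure GenLieAlgebroid where
  /-- the diffeomorphism `h : M → N` -/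
  h : M ≃ₘ^∞⟮𝓘(ℝ, EM), 𝓘(ℝ, EN)⟯ N
  /-- the diffeomorphism `η : N → M` -/
  η : N ≃ₘ^∞⟮𝓘(ℝ, EN), 𝓘(ℝ, EM)⟯ M
  /-- the vector bundle morphism `ρ : F → TM` over `η` -/
  ρ : ∀ y : N, F y →ₗ[ℝ] TangentSpace 𝓘(ℝ, EM) (η y)
  ρ_smooth : ContMDiff (𝓘(ℝ, EN).prod 𝓘(ℝ, VF)) 𝓘(ℝ, EM).tangent ∞
    (fun z : TotalSpace VF F ↦ (⟨η z.proj, ρ z.proj z.2⟩ : TangentBundle 𝓘(ℝ, EM) M))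
  /-- the bracket on the smooth sections of `F` -/
  bracket : Cₛ^∞⟮𝓘(ℝ, EN); VF, F⟯ → Cₛ^∞⟮𝓘(ℝ, EN); VF, F⟯ → Cₛ^∞⟮𝓘(ℝ, EN); VF, F⟯
  bracket_add : ∀ σ τ τ', bracket σ (τ + τ') = bracket σ τ + bracket σ τ'
  bracket_smul : ∀ (c : ℝ) σ τ, bracket σ (c • τ) = c • bracket σ τ
  bracket_skew : ∀ σ τ, bracket σ τ = -bracket τ σ
  jacobi : ∀ σ τ υ,
    bracket σ (bracket τ υ) + bracket τ (bracket υ σ) + bracket υ (bracket σ τ) = 0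
  leibniz : ∀ (σ τ τ' : Cₛ^∞⟮𝓘(ℝ, EN); VF, F⟯) (f : N → ℝ),
    ContMDiff 𝓘(ℝ, EN) 𝓘(ℝ, ℝ) ∞ f → (∀ y, τ' y = f y • τ y) →
    ∀ y, bracket σ τ' y = f y • bracket σ τ y + anchorDeriv h η ρ σ f y • τ y
  anchor_hom : ∀ (σ τ : Cₛ^∞⟮𝓘(ℝ, EN); VF, F⟯) (f : N → ℝ),
    ContMDiff 𝓘(ℝ, EN) 𝓘(ℝ, ℝ) ∞ f → ∀ y,
    anchorDeriv h η ρ (bracket σ τ) f y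
      = anchorDeriv h η ρ σ (anchorDeriv h η ρ τ f) y
        - anchorDeriv h η ρ τ (anchorDeriv h η ρ σ f) y

open Classical in
/-- The anchor of the pull-back bundle `h^*F`, i.e. `Z^α (ρ_α^i ∘ h) ∂_i` at the point `x`. It is
`ρ` on the fibre over `h x` if `η (h x) = x`. The Leibniz rule of the bracket forces `ρ` to vanish
on the fibre over `h x` if `η (h x) ≠ x`, so the anchor is zero there. -/
def GenLieAlgebroid.anchorAt [VectorBundle ℝ VF F] (A : GenLieAlgebroid EM M EN VF F) (x : M) :
    F (A.h x) →ₗ[ℝ] TangentSpace 𝓘(ℝ, EM) x :=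
  if hx : A.η (A.h x) = x then hx ▸ A.ρ (A.h x) else 0

end Algebroid

/-! ### The generalized tangent bundle of the dual bundle -/

section Main

variable {EM : Type u₁} [NormedAddCommGroup EM] [NormedSpace ℝ EM]
  {M : Type u₂} [TopologicalSpace M] [ChartedSpace EM M] [IsManifold 𝓘(ℝ, EM) ∞ M]
  {EN : Type u₃} [NormedAddCommGroup EN] [NormedSpace ℝ EN]
  {N : Type u₄} [TopologicalSpace N] [ChartedSpace EN N]
  {VF : Type u₅} [NormedAddCommGroup VF] [NormedSpace ℝ VF]
  {F : N → Type u₆} [∀ y, AddCommGroup (F y)] [∀ y, Module ℝ (F y)]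
  [∀ y, TopologicalSpace (F y)] [TopologicalSpace (TotalSpace VF F)]
  [FiberBundle VF F] [VectorBundle ℝ VF F]
  {VE : Type u₇} [NormedAddCommGroup VE] [NormedSpace ℝ VE]
  {E : M → Type u₈} [∀ x, AddCommGroup (E x)] [∀ x, Module ℝ (E x)]
  [∀ x, TopologicalSpace (E x)] [TopologicalSpace (TotalSpace VE E)]
  [FiberBundle VE E] [VectorBundle ℝ VE E]

variable (VE E) in
/-- The total space of the dual vector bundle of `E`. -/
abbrev DualSpace : Type _ := TotalSpace (VE →L[ℝ] ℝ) (fun x : M ↦ E x →L[ℝ] ℝ)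

variable (EM VE) in
/-- The model of the manifold `DualSpace VE E`. -/
abbrev modelD : ModelWithCorners ℝ (EM × (VE →L[ℝ] ℝ)) (ModelProd EM (VE →L[ℝ] ℝ)) :=
  𝓘(ℝ, EM).prod 𝓘(ℝ, VE →L[ℝ] ℝ)

variable (VE E) in
/-- The fibre at `u` of the generalized tangent bundle: the pairs `(z, v)` in
`F_{h(π u)} × T_u E^*` of the form `Z^α T_α ⊕ (Z^α (ρ_α^i ∘ h ∘ π) ∂_i + Y_a ∂^a)`. -/
def GenTangent (A : GenLieAlgebroid EM M EN VF F) (u : DualSpace VE E) :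
    Submodule ℝ (F (A.h u.proj) × TangentSpace (modelD EM VE) u) :=
  LinearMap.eqLocus
    ((mfderiv (modelD EM VE) 𝓘(ℝ, EM) (TotalSpace.proj : DualSpace VE E → M) u).toLinearMap ∘ₗ
      LinearMap.snd ℝ (F (A.h u.proj)) (TangentSpace (modelD EM VE) u))
    (A.anchorAt u.proj ∘ₗ LinearMap.fst ℝ (F (A.h u.proj)) (TangentSpace (modelD EM VE) u))

variable (VE E) in
/-- The sections (of any regularity) of the generalized tangent bundle. -/
abbrev GenSection (A : GenLieAlgebroid EM M EN VF F) : Type _ :=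
  ∀ u : DualSpace VE E, GenTangent VE E A u

variable [ContMDiffVectorBundle ∞ VE E 𝓘(ℝ, EM)]

/-- A section of the generalized tangent bundle is smooth on `O` if both its components are. -/
def SmoothSectionOn (A : GenLieAlgebroid EM M EN VF F) (X : GenSection VE E A)
    (O : Set (DualSpace VE E)) : Prop :=
  ContMDiffOn (modelD EM VE) (𝓘(ℝ, EN).prod 𝓘(ℝ, VF)) ∞
    (fun u ↦ (⟨A.h u.proj, (X u).1.1⟩ : TotalSpace VF F)) O ∧
  ContMDiffOn (modelD EM VE) (modelD EM VE).tangent ∞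
    (fun u ↦ (⟨u, (X u).1.2⟩ : TangentBundle (modelD EM VE) (DualSpace VE E))) O

/-- Differentiability at a point of a section of the generalized tangent bundle. -/
def DiffSectionAt (A : GenLieAlgebroid EM M EN VF F) (X : GenSection VE E A)
    (u₀ : DualSpace VE E) : Prop :=
  MDifferentiableAt (modelD EM VE) (𝓘(ℝ, EN).prod 𝓘(ℝ, VF))
    (fun u ↦ (⟨A.h u.proj, (X u).1.1⟩ : TotalSpace VF F)) u₀ ∧
  MDifferentiableAt (modelD EM VE) (modelD EM VE).tangent
    (fun u ↦ (⟨u, (X u).1.2⟩ : TangentBundle (modelD EM VE) (DualSpace VE E))) u₀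

/-- The projection of the dual bundle is a submersion. -/
theorem exists_lift_tangent (u : DualSpace VE E) (v : TangentSpace 𝓘(ℝ, EM) u.proj) :
    ∃ w : TangentSpace (modelD EM VE) u,
      mfderiv (modelD EM VE) 𝓘(ℝ, EM) (TotalSpace.proj : DualSpace VE E → M) u w = v := by
  set e := trivializationAt (VE →L[ℝ] ℝ) (fun x : M ↦ E x →L[ℝ] ℝ) u.proj with he
  have hx : u.proj ∈ e.baseSet :=
    mem_baseSet_trivializationAt (VE →L[ℝ] ℝ) (fun x : M ↦ E x →L[ℝ] ℝ) u.proj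
  let s : M → DualSpace VE E := fun x ↦ e.toOpenPartialHomeomorph.symm (x, (e u).2)
  have hs : ContMDiffAt 𝓘(ℝ, EM) (modelD EM VE) ∞ s u.proj := by
    have h1 := e.contMDiffOn_symm (IB := 𝓘(ℝ, EM)) (n := ∞)
    have h2 : ContMDiffAt (𝓘(ℝ, EM).prod 𝓘(ℝ, VE →L[ℝ] ℝ)) (modelD EM VE) ∞
        e.toOpenPartialHomeomorph.symm (u.proj, (e u).2) :=
      h1.contMDiffAt (e.open_target.mem_nhds (by simp [e.mem_target, hx]))
    exact h2.comp (f := fun x : M ↦ (x, (e u).2)) u.proj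
      (contMDiffAt_id.prodMk contMDiffAt_const)
  have hsu : s u.proj = u := by
    have hu : u ∈ e.source := e.mem_source.2 hx
    have := e.symm_proj_apply u hx
    have h3 : (u.proj, (e u).2) = e u := by
      rw [e.mk_proj_snd hu]
    change e.toOpenPartialHomeomorph.symm (u.proj, (e u).2) = u
    rw [h3]
    exact e.toOpenPartialHomeomorph.left_inv hu
  have hps : (TotalSpace.proj : DualSpace VE E → M) ∘ s =ᶠ[𝓝 u.proj] id := by
    filter_upwards [e.open_baseSet.mem_nhds hx] with x hx'
    exact e.proj_symm_apply' hx'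
  have key : ∀ u' : DualSpace VE E, s u.proj = u' → ∃ w : TangentSpace (modelD EM VE) u',
      mfderiv (modelD EM VE) 𝓘(ℝ, EM) (TotalSpace.proj : DualSpace VE E → M) u' w
        = (v : EM) := by
    rintro u' rfl
    refine ⟨mfderiv 𝓘(ℝ, EM) (modelD EM VE) s u.proj v, ?_⟩
    have hp : MDifferentiableAt (modelD EM VE) 𝓘(ℝ, EM)
        (TotalSpace.proj : DualSpace VE E → M) (s u.proj) :=
      (contMDiffAt_proj (n := ∞) (fun x : M ↦ E x →L[ℝ] ℝ)).mdifferentiableAt (by simp)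
    have hc := mfderiv_comp u.proj hp (hs.mdifferentiableAt (by simp))
    have hi : mfderiv 𝓘(ℝ, EM) 𝓘(ℝ, EM) ((TotalSpace.proj : DualSpace VE E → M) ∘ s) u.proj
        = mfderiv 𝓘(ℝ, EM) 𝓘(ℝ, EM) (id : M → M) u.proj := hps.mfderiv_eq
    rw [mfderiv_id] at hi
    have := DFunLike.congr_fun (hc.symm.trans hi) v
    exact this
  exact key u hsu

/-- The tangent vector at `t = 0` of the curve `t ↦ u + t q` in the fibre of the dual bundle:
the vertical lift of the covector `q` to the point `u`. -/
def vlift (u : DualSpace VE E) (q : E u.proj →L[ℝ] ℝ) : TangentSpace (modelD EM VE) u :=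
  (mfderiv 𝓘(ℝ, ℝ) (modelD EM VE)
    (fun t : ℝ ↦ (⟨u.proj, u.2 + t • q⟩ : DualSpace VE E)) 0 (1 : ℝ) : EM × (VE →L[ℝ] ℝ))

theorem mfderiv_proj_vlift (u : DualSpace VE E) (q : E u.proj →L[ℝ] ℝ) :
    mfderiv (modelD EM VE) 𝓘(ℝ, EM) (TotalSpace.proj : DualSpace VE E → M) u (vlift u q) = 0 := by
  let c : ℝ → DualSpace VE E := fun t : ℝ ↦ ⟨u.proj, u.2 + t • q⟩
  have hc0 : c 0 = u := by simp [c]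
  have key : ∀ u' : DualSpace VE E, c 0 = u' →
      mfderiv (modelD EM VE) 𝓘(ℝ, EM) (TotalSpace.proj : DualSpace VE E → M) u'
        (mfderiv 𝓘(ℝ, ℝ) (modelD EM VE) c 0 (1 : ℝ) : EM × (VE →L[ℝ] ℝ)) = (0 : EM) := by
    rintro u' rfl
    by_cases hd : MDifferentiableAt 𝓘(ℝ, ℝ) (modelD EM VE) c 0
    · have hp : MDifferentiableAt (modelD EM VE) 𝓘(ℝ, EM)
          (TotalSpace.proj : DualSpace VE E → M) (c 0) :=
        (contMDiffAt_proj (n := ∞) (fun x : M ↦ E x →L[ℝ] ℝ)).mdifferentiableAt (by simp)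
      have hc := mfderiv_comp (0 : ℝ) hp hd
      have hi : mfderiv 𝓘(ℝ, ℝ) 𝓘(ℝ, EM) ((TotalSpace.proj : DualSpace VE E → M) ∘ c) 0 = 0 :=
        mfderiv_const
      exact DFunLike.congr_fun (hc.symm.trans hi) (1 : ℝ)
    · rw [mfderiv_zero_of_not_mdifferentiableAt hd]
      exact map_zero (mfderiv (modelD EM VE) 𝓘(ℝ, EM)
        (TotalSpace.proj : DualSpace VE E → M) (c 0))
  exact key u hc0

/-! ### Nonlinear connections, frames and the adapted base -/

variable (VE E) in
/-- A `(ρ, η)`-connection for the dual bundle: a smooth left splitting of the inclusion of the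
vertical subbundle (the pairs with vanishing first component) in the generalized tangent bundle. -/
structure NonlinConnection (A : GenLieAlgebroid EM M EN VF F) where
  proj : ∀ u : DualSpace VE E, GenTangent VE E A u →ₗ[ℝ] GenTangent VE E A u
  proj_vertical : ∀ u X, (proj u X).1.1 = 0
  proj_of_vertical : ∀ u (X : GenTangent VE E A u), X.1.1 = 0 → proj u X = X
  smooth : ∀ (X : GenSection VE E A) (O : Set (DualSpace VE E)), IsOpen O →
    SmoothSectionOn A X O → SmoothSectionOn A (fun u ↦ proj u (X u)) O

variable {A : GenLieAlgebroid EM M EN VF F}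

theorem NonlinConnection.exists_hlift (Γ : NonlinConnection VE E A) (u : DualSpace VE E)
    (z : F (A.h u.proj)) : ∃ X : GenTangent VE E A u, X.1.1 = z ∧ Γ.proj u X = 0 := by
  obtain ⟨w, hw⟩ := exists_lift_tangent u (A.anchorAt u.proj z)
  let X : GenTangent VE E A u := ⟨(z, w), hw⟩
  refine ⟨X - Γ.proj u X, ?_, ?_⟩
  · change z - (Γ.proj u X).1.1 = z
    rw [Γ.proj_vertical, sub_zero]
  · rw [map_sub, Γ.proj_of_vertical u _ (Γ.proj_vertical u X), sub_self]

/-- The horizontal lift of `z` to the point `u`; it is the only vector of the generalized tangent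
bundle at `u` with these two properties. -/
def NonlinConnection.hlift (Γ : NonlinConnection VE E A) (u : DualSpace VE E)
    (z : F (A.h u.proj)) : GenTangent VE E A u := (Γ.exists_hlift u z).choose

variable (VE E A) in
/-- An identification of the vector bundle `E` over `M` with `F` over `N`: an isomorphism of vector
bundles over `h` (the identity if `F = E` and `h = id`). -/
structure BundleIdent where
  equiv : ∀ x : M, E x ≃ₗ[ℝ] F (A.h x)
  smooth : ContMDiff (𝓘(ℝ, EM).prod 𝓘(ℝ, VE)) (𝓘(ℝ, EN).prod 𝓘(ℝ, VF)) ∞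
    (fun z : TotalSpace VE E ↦ (⟨A.h z.proj, equiv z.proj z.2⟩ : TotalSpace VF F))

/-- A vector chart over the open set `U`, given by a frame `s_a` of `E` over `U` with its dual frame
`coframe`, and the frame `t_a` of `F` over `h(U)` that corresponds to `s_a`. The sections are defined
globally but are a frame over `U` only; near each point every local frame is of this form. -/
structure VectorChart (φ : BundleIdent VE E A) where
  U : Set M
  isOpen : IsOpen U
  s : Fin (Module.finrank ℝ VE) → Cₛ^∞⟮𝓘(ℝ, EM); VE, E⟯
  coframe : Fin (Module.finrank ℝ VE) → Cₛ^∞⟮𝓘(ℝ, EM); VE →L[ℝ] ℝ, fun x : M ↦ E x →L[ℝ] ℝ⟯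
  t : Fin (Module.finrank ℝ VE) → Cₛ^∞⟮𝓘(ℝ, EN); VF, F⟯
  span : ∀ x ∈ U, Submodule.span ℝ (range fun a ↦ s a x) = ⊤
  dual : ∀ x ∈ U, ∀ a b, coframe a x (s b x) = if a = b then 1 else 0
  corr : ∀ x ∈ U, ∀ a, t a (A.h x) = φ.equiv x (s a x)

variable {φ : BundleIdent VE E A}

namespace VectorChart

/-- The structure function `L^a_{bc} ∘ h`, where `[t_b, t_c] = L^a_{bc} t_a`. -/
def strFun (c : VectorChart φ) (a b d : Fin (Module.finrank ℝ VE)) (x : M) : ℝ :=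
  c.coframe a x ((φ.equiv x).symm (A.bracket (c.t b) (c.t d) (A.h x)))

/-- The horizontal part `δ_a` of the adapted base. -/
def delta (c : VectorChart φ) (Γ : NonlinConnection VE E A) (a : Fin (Module.finrank ℝ VE)) :
    GenSection VE E A := fun u ↦ Γ.hlift u (c.t a (A.h u.proj))

/-- The vertical part `∂^a` of the adapted base. -/
def vert (c : VectorChart φ) (a : Fin (Module.finrank ℝ VE)) : GenSection VE E A := fun u ↦
  ⟨(0, vlift u (c.coframe a u.proj)),
    (mfderiv_proj_vlift u (c.coframe a u.proj)).trans (map_zero (A.anchorAt u.proj)).symm⟩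

/-- The coordinate `dz^a(X)` of a vector `X` of the generalized tangent bundle. -/
def dz (c : VectorChart φ) (a : Fin (Module.finrank ℝ VE)) (u : DualSpace VE E)
    (X : GenTangent VE E A u) : ℝ :=
  c.coframe a u.proj ((φ.equiv u.proj).symm X.1.1)

/-- The coordinate `δp_a(X)` of a vector `X` of the generalized tangent bundle: the derivative of
the function `p_a` in the direction of the vertical part of `X`. -/
def deltap (c : VectorChart φ) (Γ : NonlinConnection VE E A) (a : Fin (Module.finrank ℝ VE))
    (u : DualSpace VE E) (X : GenTangent VE E A u) : ℝ :=
  mfderiv (modelD EM VE) 𝓘(ℝ, ℝ) (fun w : DualSpace VE E ↦ w.2 (c.s a w.proj)) u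
    (Γ.proj u X).1.2

end VectorChart

/-! ### Tensor d-fields and (pseudo)metrical structures -/

variable (VE E A) in
/-- Fields of bilinear maps on the generalized tangent bundle with values in it. -/
abbrev GenTensor : Type _ :=
  ∀ u : DualSpace VE E, GenTangent VE E A u →ₗ[ℝ] GenTangent VE E A u →ₗ[ℝ] GenTangent VE E A u

/-- Smooth tensor fields `T^a_{bc} δ_a ⊗ dz^b ⊗ dz^c`. -/
structure IsHTensor (Γ : NonlinConnection VE E A) (T : GenTensor VE E A) : Prop where
  horizontal : ∀ u X Y, Γ.proj u (T u X Y) = 0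
  left : ∀ u (X Y : GenTangent VE E A u), X.1.1 = 0 → T u X Y = 0
  right : ∀ u (X Y : GenTangent VE E A u), Y.1.1 = 0 → T u X Y = 0
  smooth : ∀ (X Y : GenSection VE E A) (O : Set (DualSpace VE E)), IsOpen O →
    SmoothSectionOn A X O → SmoothSectionOn A Y O →
    SmoothSectionOn A (fun u ↦ T u (X u) (Y u)) O

/-- Smooth tensor fields `S^{ac}_b ∂^b ⊗ δp_a ⊗ δp_c`. -/
structure IsVTensor (Γ : NonlinConnection VE E A) (S : GenTensor VE E A) : Prop where
  vertical : ∀ u X Y, (S u X Y).1.1 = 0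
  left : ∀ u (X Y : GenTangent VE E A u), Γ.proj u X = 0 → S u X Y = 0
  right : ∀ u (X Y : GenTangent VE E A u), Γ.proj u Y = 0 → S u X Y = 0
  smooth : ∀ (X Y : GenSection VE E A) (O : Set (DualSpace VE E)), IsOpen O →
    SmoothSectionOn A X O → SmoothSectionOn A Y O →
    SmoothSectionOn A (fun u ↦ S u (X u) (Y u)) O

/-- (Pseudo)metrical structures `G = g_{ab} dz^a ⊗ dz^b + g^{ab} δp_a ⊗ δp_b`. -/
structure PseudoMetric (Γ : NonlinConnection VE E A) where
  form : ∀ u : DualSpace VE E, GenTangent VE E A u →ₗ[ℝ] GenTangent VE E A u →ₗ[ℝ] ℝ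
  symm : ∀ u X Y, form u X Y = form u Y X
  mixed : ∀ u (X Y : GenTangent VE E A u), X.1.1 = 0 → Γ.proj u Y = 0 → form u X Y = 0
  nondegenerate : ∀ u X, (∀ Y, form u X Y = 0) → X = 0
  smooth : ∀ (X Y : GenSection VE E A) (O : Set (DualSpace VE E)), IsOpen O →
    SmoothSectionOn A X O → SmoothSectionOn A Y O →
    ContMDiffOn (modelD EM VE) 𝓘(ℝ, ℝ) ∞ (fun u ↦ form u (X u) (Y u)) O

variable {Γ : NonlinConnection VE E A}

/-- The components `G(δ_a, δ_b)` of the horizontal part of `G`. -/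
def PseudoMetric.low (G : PseudoMetric Γ) (c : VectorChart φ)
    (a b : Fin (Module.finrank ℝ VE)) (u : DualSpace VE E) : ℝ :=
  G.form u (c.delta Γ a u) (c.delta Γ b u)

/-- The components `g^{ab} = G(∂^a, ∂^b)` of the vertical part of `G`. -/
def PseudoMetric.up (G : PseudoMetric Γ) (c : VectorChart φ)
    (a b : Fin (Module.finrank ℝ VE)) (u : DualSpace VE E) : ℝ :=
  G.form u (c.vert a u) (c.vert b u)

/-- `G` is determined by its vertical part: in each vector chart the matrix of the horizontal part
is the inverse of the matrix of the vertical part. -/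
def PseudoMetric.DeterminedByVertical (G : PseudoMetric Γ) (φ : BundleIdent VE E A) : Prop :=
  ∀ (c : VectorChart φ) (u : DualSpace VE E), u.proj ∈ c.U →
    ∀ a b, ∑ e, G.low c a e u * G.up c e b u = if a = b then 1 else 0

/-! ### Distinguished linear connections -/

/-- The derivative at `u` of a function in the direction of (the anchor of) the vector `X`. -/
def lieD (u : DualSpace VE E) (X : GenTangent VE E A u) (f : DualSpace VE E → ℝ) : ℝ :=
  mfderiv (modelD EM VE) 𝓘(ℝ, ℝ) f u X.1.2

/-- Distinguished linear `(ρ, η)`-connections: covariant derivatives on the generalized tangent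
bundle which preserve the horizontal and the vertical subbundle. Here `D Y u x` is the value at `u`
of `D_X Y`, where `x` is the value of `X` at `u`. -/
structure DistConnection (Γ : NonlinConnection VE E A) where
  D : GenSection VE E A → ∀ u : DualSpace VE E, GenTangent VE E A u →ₗ[ℝ] GenTangent VE E A u
  add : ∀ (Y Y' : GenSection VE E A) (u), DiffSectionAt A Y u → DiffSectionAt A Y' u →
    D (fun w ↦ Y w + Y' w) u = D Y u + D Y' u
  leibniz : ∀ (f : DualSpace VE E → ℝ) (Y : GenSection VE E A) (u),
    MDifferentiableAt (modelD EM VE) 𝓘(ℝ, ℝ) f u → DiffSectionAt A Y u →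
    ∀ x, D (fun w ↦ f w • Y w) u x = f u • D Y u x + lieD u x f • Y u
  smooth : ∀ (X Y : GenSection VE E A) (O : Set (DualSpace VE E)), IsOpen O →
    SmoothSectionOn A X O → SmoothSectionOn A Y O → SmoothSectionOn A (fun u ↦ D Y u (X u)) O
  horizontal : ∀ (Y : GenSection VE E A) (u), DiffSectionAt A Y u →
    (∀ᶠ w in 𝓝 u, Γ.proj w (Y w) = 0) → ∀ x, Γ.proj u (D Y u x) = 0
  vertical : ∀ (Y : GenSection VE E A) (u), DiffSectionAt A Y u →
    (∀ᶠ w in 𝓝 u, (Y w).1.1 = 0) → ∀ x, (D Y u x).1.1 = 0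

namespace DistConnection

/-- The component `H^a_{bd}` of `D_{δ_d} δ_b = H^a_{bd} δ_a`. -/
def compHH (D : DistConnection Γ) (c : VectorChart φ) (a b d : Fin (Module.finrank ℝ VE))
    (u : DualSpace VE E) : ℝ := c.dz a u (D.D (c.delta Γ b) u (c.delta Γ d u))

/-- The component `H^a_{bd}` of `D_{δ_d} ∂^a = - H^a_{bd} ∂^b`. -/
def compHV (D : DistConnection Γ) (c : VectorChart φ) (a b d : Fin (Module.finrank ℝ VE))
    (u : DualSpace VE E) : ℝ := -c.deltap Γ b u (D.D (c.vert a) u (c.delta Γ d u))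

/-- The component `V^{ad}_b` of `D_{∂^d} δ_b = - V^{ad}_b δ_a`. -/
def compVH (D : DistConnection Γ) (c : VectorChart φ) (a d b : Fin (Module.finrank ℝ VE))
    (u : DualSpace VE E) : ℝ := -c.dz a u (D.D (c.delta Γ b) u (c.vert d u))

/-- The component `V^{ad}_b` of `D_{∂^d} ∂^a = V^{ad}_b ∂^b`. -/
def compVV (D : DistConnection Γ) (c : VectorChart φ) (a d b : Fin (Module.finrank ℝ VE))
    (u : DualSpace VE E) : ℝ := c.deltap Γ b u (D.D (c.vert a) u (c.vert d u))

/-- Normal connections: the components on the horizontal and on the vertical subbundle agree in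
each vector chart. -/
def IsNormal (D : DistConnection Γ) (φ : BundleIdent VE E A) : Prop :=
  ∀ (c : VectorChart φ) (u : DualSpace VE E), u.proj ∈ c.U → ∀ a b d,
    D.compHH c a b d u = D.compHV c a b d u ∧ D.compVH c a d b u = D.compVV c a d b u

/-- `D_X G = 0` for all `X`. -/
def IsMetric (D : DistConnection Γ) (G : PseudoMetric Γ) : Prop :=
  ∀ (Y Z : GenSection VE E A) (u), DiffSectionAt A Y u → DiffSectionAt A Z u → ∀ x,
    lieD u x (fun w ↦ G.form w (Y w) (Z w))
      = G.form u (D.D Y u x) (Z u) + G.form u (Y u) (D.D Z u x)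

end DistConnection

/-- The bracket of the Lie algebroid `(ρ, η)TE^*`, computed over a vector chart:
the pair of `(X^a Y^b L^d_{ab} ∘ h ∘ π + X(Y^d) - Y(X^d)) T_d` and the bracket of vector fields. -/
def genBracket (c : VectorChart φ) (X Y : GenSection VE E A) (u : DualSpace VE E) :
    F (A.h u.proj) × TangentSpace (modelD EM VE) u :=
  (∑ d, (∑ a, ∑ b, c.dz a u (X u) * c.dz b u (Y u) * c.strFun d a b u.proj
      + lieD u (X u) (fun w ↦ c.dz d w (Y w)) - lieD u (Y u) (fun w ↦ c.dz d w (X w)))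
      • c.t d (A.h u.proj),
    VectorField.mlieBracket (modelD EM VE) (fun w ↦ (X w).1.2) (fun w ↦ (Y w).1.2) u)

/-- The torsion `D_X Y - D_Y X - [X, Y]`, computed over a vector chart. -/
def DistConnection.torsion (D : DistConnection Γ) (c : VectorChart φ) (X Y : GenSection VE E A)
    (u : DualSpace VE E) : F (A.h u.proj) × TangentSpace (modelD EM VE) u :=
  (D.D Y u (X u)).1 - (D.D X u (Y u)).1 - genBracket c X Y u

/-! ### The explicit components -/

/-- The components `H^a_{bd}` of the connection of Levi-Civita type. -/
def leviCivitaH (G : PseudoMetric Γ) (c : VectorChart φ) (a b d : Fin (Module.finrank ℝ VE))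
    (u : DualSpace VE E) : ℝ :=
  (1 / 2) * ∑ e, G.up c a e u *
    (lieD u (c.delta Γ b u) (G.low c e d) + lieD u (c.delta Γ d u) (G.low c b e)
      - lieD u (c.delta Γ e u) (G.low c b d)
      - ∑ k, G.low c d k u * c.strFun k b e u.proj
      + ∑ k, G.low c b k u * c.strFun k e d u.proj
      - ∑ k, G.low c e k u * c.strFun k b d u.proj)

/-- The components `V^{ad}_b` of the connection of Levi-Civita type. -/
def leviCivitaV (G : PseudoMetric Γ) (c : VectorChart φ) (a d b : Fin (Module.finrank ℝ VE))
    (u : DualSpace VE E) : ℝ :=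
  (1 / 2) * ∑ e, G.low c b e u *
    (lieD u (c.vert d u) (G.up c e a) + lieD u (c.vert a u) (G.up c e d)
      - lieD u (c.vert e u) (G.up c a d))

/-- The components `T^a_{bd}` of a horizontal tensor field. -/
def tensorH (Γ : NonlinConnection VE E A) (T : GenTensor VE E A) (c : VectorChart φ)
    (a b d : Fin (Module.finrank ℝ VE)) (u : DualSpace VE E) : ℝ :=
  c.dz a u (T u (c.delta Γ b u) (c.delta Γ d u))

/-- The components `S^{ad}_b` of a vertical tensor field. -/
def tensorV (Γ : NonlinConnection VE E A) (S : GenTensor VE E A) (c : VectorChart φ)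
    (a d b : Fin (Module.finrank ℝ VE)) (u : DualSpace VE E) : ℝ :=
  c.deltap Γ b u (S u (c.vert a u) (c.vert d u))

/-- The horizontal components of the modified connection. -/
def modifiedH (G : PseudoMetric Γ) (T : GenTensor VE E A) (c : VectorChart φ)
    (a b d : Fin (Module.finrank ℝ VE)) (u : DualSpace VE E) : ℝ :=
  leviCivitaH G c a b d u + (1 / 2) * ∑ e, G.up c a e u *
    (∑ k, G.low c e k u * tensorH Γ T c k b d u
      - ∑ k, G.low c b k u * tensorH Γ T c k e d u
      + ∑ k, G.low c d k u * tensorH Γ T c k b e u)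

/-- The vertical components of the modified connection. -/
def modifiedV (G : PseudoMetric Γ) (S : GenTensor VE E A) (c : VectorChart φ)
    (a d b : Fin (Module.finrank ℝ VE)) (u : DualSpace VE E) : ℝ :=
  leviCivitaV G c a d b u + (1 / 2) * ∑ e, G.low c b e u *
    (∑ k, G.up c e k u * tensorV Γ S c a d k u
      - ∑ k, G.up c a k u * tensorV Γ S c e d k u
      + ∑ k, G.up c d k u * tensorV Γ S c a e k u)

end Main

end GenHamilton

end

/-!
Over a vector chart `c` the components determine a connection form
`Ω^a_b = H^a_{bd} dz^d - V^{ad}_b δp_d`, and the connection of the chart (`localConn`) is given by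
`D δ_b = Ω^a_b δ_a` and `D ∂^a = -Ω^a_b ∂^b`. As the same form occurs twice, `D` is normal over `c`.

The formulas for the components are instances of the Koszul formula `koszul`: `H` solves it for
the matrix `g_{ab}` and the torsion `T - L`, and `V` solves it for the inverse matrix `g^{ab}` and
the torsion `S`. Hence the skew parts are as prescribed (`koszul_sub`), which gives the torsion,
and `Ω` preserves `g_{ab}` in horizontal directions while `-Ωᵀ` preserves `g^{ab}` in vertical
directions (`koszul_metric`). Since the two matrices are inverse to each other, `Ω` preserves
`g_{ab}` if and only if `-Ωᵀ` preserves `g^{ab}` (`metric_inverse_iff`), so that both hold in all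
directions (`lieD_lowMat`, `lieD_upMat`), and `D` is metric (`localConn_metric`).

The connections of the charts agree on overlaps (`localConn_eq`). This needs no transformation of
the Koszul formula. Three properties of the connection of `c` make sense over any other chart `c'`:
* it is metric;
* it has the torsion `T`, `S` (`localConn_torsionH`, `localConn_torsionV`), because the structure
  functions transform in the same inhomogeneous way as the skew part of `H` (`strFun_change`);
* its horizontal and vertical parts are dual (`deltap_localConn_vert_eq_neg`), because the pairing
  of horizontal with vertical vectors that comes from `E` and its dual does not depend on the chart
  (`pairing_eq`).

By the uniqueness part of the Koszul formula (`eq_koszul`) the first two determine the components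
`H` and `V` over `c'`, and the third one the remaining components.

Two facts about the geometry are behind this. The bracket is local, and its Leibniz rule forces `ρ`
to vanish on the fibre over `η⁻¹ x` if `η (h x) ≠ x` (`GenLieAlgebroid.anchorVal_eq_zero`); thus the
anchor of `h^*F` is the vector field `ρ ∘ σ` (`GenLieAlgebroid.anchorAt_apply`), which is smooth and
enters the transformation of the structure functions. And vertical lifts commute
(`mlieBracket_vlift`), so that the bracket of the generalized tangent bundle does not contribute to
the vertical torsion.
-/

set_option linter.unusedSectionVars false

noncomputable section

namespace GenHamilton

/-! ### Sections along maps and vector fields -/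

section Tools

variable {EP : Type*} [NormedAddCommGroup EP] [NormedSpace ℝ EP] {HP : Type*} [TopologicalSpace HP]
  {IP : ModelWithCorners ℝ EP HP} {P : Type*} [TopologicalSpace P] [ChartedSpace HP P]
  {EB : Type*} [NormedAddCommGroup EB] [NormedSpace ℝ EB] {HB : Type*} [TopologicalSpace HB]
  {IB : ModelWithCorners ℝ EB HB} {B : Type*} [TopologicalSpace B] [ChartedSpace HB B]
  {W : Type*} [NormedAddCommGroup W] [NormedSpace ℝ W]
  {V : B → Type*} [∀ y, AddCommGroup (V y)] [∀ y, Module ℝ (V y)]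
  [∀ y, TopologicalSpace (V y)] [TopologicalSpace (TotalSpace W V)]
  [FiberBundle W V] [VectorBundle ℝ W V] {n : WithTop ℕ∞}

/-- Linear operations preserve the smoothness of sections along a map `b`, since a trivialization
around `b p₀` is linear on the fibres. -/
theorem contMDiffAt_along_add_smul {b : P → B} {z w : ∀ p, V (b p)} {f : P → ℝ} {p₀ : P}
    (hz : ContMDiffAt IP (IB.prod 𝓘(ℝ, W)) n (fun p ↦ (⟨b p, z p⟩ : TotalSpace W V)) p₀)
    (hw : ContMDiffAt IP (IB.prod 𝓘(ℝ, W)) n (fun p ↦ (⟨b p, w p⟩ : TotalSpace W V)) p₀)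
    (hf : ContMDiffAt IP 𝓘(ℝ, ℝ) n f p₀) :
    ContMDiffAt IP (IB.prod 𝓘(ℝ, W)) n
      (fun p ↦ (⟨b p, z p + f p • w p⟩ : TotalSpace W V)) p₀ := by
  rw [contMDiffAt_totalSpace] at hz hw ⊢
  refine ⟨hz.1, ?_⟩
  refine (hz.2.add (hf.smul hw.2)).congr_of_eventuallyEq ?_
  have hb : ∀ᶠ p in 𝓝 p₀, b p ∈ (trivializationAt W V (b p₀)).baseSet :=
    hz.1.continuousAt ((trivializationAt W V (b p₀)).open_baseSet.mem_nhds
      (mem_baseSet_trivializationAt W V (b p₀)))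
  filter_upwards [hb] with p hp
  have hl := (trivializationAt W V (b p₀)).linear ℝ hp
  change (trivializationAt W V (b p₀) ⟨b p, z p + f p • w p⟩).2 =
    (trivializationAt W V (b p₀) ⟨b p, z p⟩).2 + f p • (trivializationAt W V (b p₀) ⟨b p, w p⟩).2
  rw [hl.map_add, hl.map_smul]

theorem contMDiffAt_along_zero {b : P → B} {p₀ : P} [ContMDiffVectorBundle n W V IB]
    (hb : ContMDiffAt IP IB n b p₀) :
    ContMDiffAt IP (IB.prod 𝓘(ℝ, W)) n (fun p ↦ (⟨b p, 0⟩ : TotalSpace W V)) p₀ :=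
  (contMDiff_zeroSection ℝ V).contMDiffAt.comp p₀ hb

variable [IsManifold IP ∞ P]

theorem contMDiffAt_mfderiv_vectorField {v : ∀ p : P, TangentSpace IP p} {f : P → ℝ} {p₀ : P}
    (hv : ContMDiffAt IP IP.tangent ∞ (fun p ↦ (⟨p, v p⟩ : TangentBundle IP P)) p₀)
    (hf : ContMDiffAt IP 𝓘(ℝ, ℝ) ∞ f p₀) :
    ContMDiffAt IP 𝓘(ℝ, ℝ) ∞ (fun p ↦ (mfderiv IP 𝓘(ℝ, ℝ) f p (v p) : ℝ)) p₀ := by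
  have h1 := hf.mfderiv_const (m := ∞) (by simp)
  have h2 := ContMDiffAt.clm_apply_of_inCoordinates (b₁ := fun p : P ↦ p) (b₂ := f)
    (E₁ := TangentSpace IP) (E₂ := TangentSpace 𝓘(ℝ, ℝ)) h1 hv hf
  exact (contMDiff_snd_tangentBundle_modelSpace ℝ 𝓘(ℝ, ℝ)).contMDiffAt.comp p₀ h2

theorem mdifferentiableAt_mfderiv_vectorField {v : ∀ p : P, TangentSpace IP p} {f : P → ℝ} {p₀ : P}
    (hv : MDifferentiableAt IP IP.tangent (fun p ↦ (⟨p, v p⟩ : TangentBundle IP P)) p₀)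
    (hf : ContMDiffAt IP 𝓘(ℝ, ℝ) ∞ f p₀) :
    MDifferentiableAt IP 𝓘(ℝ, ℝ) (fun p ↦ (mfderiv IP 𝓘(ℝ, ℝ) f p (v p) : ℝ)) p₀ := by
  have h1 := (hf.mfderiv_const (m := ∞) (by simp)).mdifferentiableAt (by simp)
  have h2 := MDifferentiableAt.clm_apply_of_inCoordinates (b₁ := fun p : P ↦ p) (b₂ := f)
    (E₁ := TangentSpace IP) (E₂ := TangentSpace 𝓘(ℝ, ℝ)) h1 hv (hf.mdifferentiableAt (by simp))
  exact ((contMDiff_snd_tangentBundle_modelSpace ℝ 𝓘(ℝ, ℝ) (n := 1)).mdifferentiableAt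
    (by simp)).comp p₀ h2

theorem trivializationAt_tangent_snd [IsManifold IP 1 P] {p₀ p : P}
    (hp : p ∈ (chartAt HP p₀).source) (v : TangentSpace IP p) :
    (trivializationAt EP (TangentSpace IP) p₀ ⟨p, v⟩).2
      = (mfderiv IP 𝓘(ℝ, EP) (extChartAt IP p₀) p v : EP) := by
  have h := congrArg (fun l : TangentSpace IP p →L[ℝ] EP ↦ l v)
    (TangentBundle.continuousLinearMapAt_trivializationAt (I := IP) hp)
  have h' : (trivializationAt EP (TangentSpace IP) p₀).continuousLinearMapAt ℝ p v
      = (trivializationAt EP (TangentSpace IP) p₀ ⟨p, v⟩).2 := by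
    rw [Trivialization.continuousLinearMapAt_apply, Trivialization.linearMapAt_apply, if_pos]
    simpa using hp
  exact h'.symm.trans h

/-- A vector field is smooth if its representative in an extended chart is. -/
theorem contMDiffAt_vectorField_of_extChartAt {v : ∀ p : P, TangentSpace IP p} {p₀ p₁ : P}
    (h₁ : p₁ ∈ (chartAt HP p₀).source) {w : P → EP} (hw : ContMDiffAt IP 𝓘(ℝ, EP) ∞ w p₁)
    (h : ∀ p ∈ (chartAt HP p₀).source,
      mfderiv IP 𝓘(ℝ, EP) (extChartAt IP p₀) p (v p) = w p) :
    ContMDiffAt IP IP.tangent ∞ (fun p ↦ (⟨p, v p⟩ : TangentBundle IP P)) p₁ := by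
  have : IsManifold IP 1 P := IsManifold.of_le (n := ∞) (by simp)
  refine ((trivializationAt EP (TangentSpace IP) p₀).contMDiffAt_section_iff
    (by simpa using h₁)).2 (hw.congr_of_eventuallyEq ?_)
  filter_upwards [(chartAt HP p₀).open_source.mem_nhds h₁] with p hs
  exact (trivializationAt_tangent_snd hs (v p)).trans (h p hs)

/-- The representative of a smooth vector field in an extended chart is smooth. -/
theorem contMDiffAt_extChartAt_vectorField {v : ∀ p : P, TangentSpace IP p} {p₀ p₁ : P}
    (h₁ : p₁ ∈ (chartAt HP p₀).source)
    (hv : ContMDiffAt IP IP.tangent ∞ (fun p ↦ (⟨p, v p⟩ : TangentBundle IP P)) p₁) :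
    ContMDiffAt IP 𝓘(ℝ, EP) ∞
      (fun p ↦ (mfderiv IP 𝓘(ℝ, EP) (extChartAt IP p₀) p (v p) : EP)) p₁ := by
  have : IsManifold IP 1 P := IsManifold.of_le (n := ∞) (by simp)
  refine (((trivializationAt EP (TangentSpace IP) p₀).contMDiffAt_section_iff
    (by simpa using h₁)).1 hv).congr_of_eventuallyEq ?_
  filter_upwards [(chartAt HP p₀).open_source.mem_nhds h₁] with p hs
  exact (trivializationAt_tangent_snd hs (v p)).symm

end Tools

/-- The differential of a real function at a point, as a linear form with values in `ℝ`. -/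
def differential {EP : Type*} [NormedAddCommGroup EP] [NormedSpace ℝ EP] {HP : Type*}
    [TopologicalSpace HP] (IP : ModelWithCorners ℝ EP HP) {P : Type*} [TopologicalSpace P]
    [ChartedSpace HP P] (f : P → ℝ) (p : P) : TangentSpace IP p →ₗ[ℝ] ℝ :=
  (mfderiv IP 𝓘(ℝ, ℝ) f p).toLinearMap

/-! ### Vertical vectors on the dual bundle -/

section Vertical

variable {EM : Type*} [NormedAddCommGroup EM] [NormedSpace ℝ EM]
  {M : Type*} [TopologicalSpace M] [ChartedSpace EM M] [IsManifold 𝓘(ℝ, EM) ∞ M]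
  {VE : Type*} [NormedAddCommGroup VE] [NormedSpace ℝ VE]
  {E : M → Type*} [∀ x, AddCommGroup (E x)] [∀ x, Module ℝ (E x)]
  [∀ x, TopologicalSpace (E x)] [TopologicalSpace (TotalSpace VE E)]
  [FiberBundle VE E] [VectorBundle ℝ VE E] [ContMDiffVectorBundle ∞ VE E 𝓘(ℝ, EM)]

variable (VE E) in
/-- The trivialization of the dual bundle that underlies the charts around the fibre over `x`. -/
abbrev dualTriv (x : M) : Trivialization (VE →L[ℝ] ℝ) (TotalSpace.proj : DualSpace VE E → M) :=
  trivializationAt (VE →L[ℝ] ℝ) (fun x : M ↦ E x →L[ℝ] ℝ) x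

/-- The charts of the dual bundle consist of a chart of the base and a trivialization. -/
theorem extChartAt_dual {u₀ u : DualSpace VE E} (hu : u.proj ∈ (dualTriv VE E u₀.proj).baseSet) :
    extChartAt (modelD EM VE) u₀ u
      = (extChartAt 𝓘(ℝ, EM) u₀.proj u.proj, (dualTriv VE E u₀.proj u).2) := by
  rw [FiberBundle.extChartAt]
  change (extChartAt 𝓘(ℝ, EM) u₀.proj (dualTriv VE E u₀.proj u).1, _) = _
  rw [(dualTriv VE E u₀.proj).coe_fst' hu]
  rfl

theorem mem_chart_source_dual {u₀ u : DualSpace VE E} :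
    u ∈ (chartAt (ModelProd EM (VE →L[ℝ] ℝ)) u₀).source ↔
      u.proj ∈ (dualTriv VE E u₀.proj).baseSet ∧ u.proj ∈ (chartAt EM u₀.proj).source := by
  rw [FiberBundle.chartedSpace_chartAt]
  constructor
  · intro h
    have h1 : u.proj ∈ (dualTriv VE E u₀.proj).baseSet := by
      simpa [Trivialization.mem_source] using! h.1
    refine ⟨h1, ?_⟩
    have h2 := h.2
    have h3 : (dualTriv VE E u₀.proj u).1 ∈ (chartAt EM u₀.proj).source := h2.1
    rwa [(dualTriv VE E u₀.proj).coe_fst' h1] at h3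
  · rintro ⟨h1, h2⟩
    refine ⟨(dualTriv VE E u₀.proj).mem_source.2 h1, ?_, trivial⟩
    change (dualTriv VE E u₀.proj u).1 ∈ (chartAt EM u₀.proj).source
    rwa [(dualTriv VE E u₀.proj).coe_fst' h1]

theorem contMDiff_dualProj :
    ContMDiff (modelD EM VE) 𝓘(ℝ, EM) ∞ (TotalSpace.proj : DualSpace VE E → M) :=
  contMDiff_proj (fun x : M ↦ E x →L[ℝ] ℝ)

/-- The base component of a tangent vector of the dual bundle in a chart is the coordinate
expression of its projection. -/
theorem fst_mfderiv_extChartAt_dual {u₀ u : DualSpace VE E}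
    (hu : u ∈ (chartAt (ModelProd EM (VE →L[ℝ] ℝ)) u₀).source) (v : TangentSpace (modelD EM VE) u) :
    (mfderiv (modelD EM VE) 𝓘(ℝ, EM × (VE →L[ℝ] ℝ)) (extChartAt (modelD EM VE) u₀) u v :
        EM × (VE →L[ℝ] ℝ)).1
      = (mfderiv 𝓘(ℝ, EM) 𝓘(ℝ, EM) (extChartAt 𝓘(ℝ, EM) u₀.proj) u.proj
        (mfderiv (modelD EM VE) 𝓘(ℝ, EM) (TotalSpace.proj : DualSpace VE E → M) u v) : EM) := by
  have : IsManifold (modelD EM VE) 1 (DualSpace VE E) := IsManifold.of_le (n := ∞) (by simp)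
  have : IsManifold 𝓘(ℝ, EM) 1 M := IsManifold.of_le (n := ∞) (by simp)
  obtain ⟨h1, h2⟩ := mem_chart_source_dual.1 hu
  have hev : (fun w ↦ (extChartAt (modelD EM VE) u₀ w).1)
      =ᶠ[𝓝 u] (extChartAt 𝓘(ℝ, EM) u₀.proj) ∘ (TotalSpace.proj : DualSpace VE E → M) := by
    filter_upwards [(chartAt (ModelProd EM (VE →L[ℝ] ℝ)) u₀).open_source.mem_nhds hu] with w hw
    rw [extChartAt_dual (mem_chart_source_dual.1 hw).1]
    rfl
  have hd : MDifferentiableAt (modelD EM VE) 𝓘(ℝ, EM × (VE →L[ℝ] ℝ))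
      (extChartAt (modelD EM VE) u₀) u := mdifferentiableAt_extChartAt hu
  have hf : MDifferentiableAt 𝓘(ℝ, EM × (VE →L[ℝ] ℝ)) 𝓘(ℝ, EM)
      (ContinuousLinearMap.fst ℝ EM (VE →L[ℝ] ℝ)) (extChartAt (modelD EM VE) u₀ u) :=
    (ContinuousLinearMap.differentiableAt _).mdifferentiableAt
  have e1 := mfderiv_comp u hf hd
  have e2 := mfderiv_comp u (mdifferentiableAt_extChartAt (I := 𝓘(ℝ, EM)) h2)
    ((contMDiff_dualProj (EM := EM) (VE := VE) (E := E)).mdifferentiableAt (by simp) (x := u))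
  have e3 := hev.mfderiv_eq (I := modelD EM VE) (I' := 𝓘(ℝ, EM))
  have e4 : mfderiv 𝓘(ℝ, EM × (VE →L[ℝ] ℝ)) 𝓘(ℝ, EM) (ContinuousLinearMap.fst ℝ EM (VE →L[ℝ] ℝ))
      (extChartAt (modelD EM VE) u₀ u) = ContinuousLinearMap.fst ℝ EM (VE →L[ℝ] ℝ) := by
    rw [mfderiv_eq_fderiv]; exact ContinuousLinearMap.fderiv _
  rw [e4] at e1
  exact DFunLike.congr_fun (e1.symm.trans (e3.trans e2)) v

/-- The line through `u` in the fibre of the dual bundle with direction `q`. -/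
def dualLine (u : DualSpace VE E) (q : E u.proj →L[ℝ] ℝ) (t : ℝ) : DualSpace VE E :=
  ⟨u.proj, u.2 + t • q⟩

theorem dualLine_zero (u : DualSpace VE E) (q : E u.proj →L[ℝ] ℝ) : dualLine u q 0 = u := by
  simp [dualLine]

theorem snd_dualTriv_dualLine {x : M} (u : DualSpace VE E) (q : E u.proj →L[ℝ] ℝ) (t : ℝ)
    (hx : u.proj ∈ (dualTriv VE E x).baseSet) :
    (dualTriv VE E x (dualLine u q t)).2
      = (dualTriv VE E x u).2 + t • (dualTriv VE E x ⟨u.proj, q⟩).2 := by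
  have hl := (dualTriv VE E x).linear ℝ hx
  change (dualTriv VE E x ⟨u.proj, u.2 + t • q⟩).2 = _
  rw [hl.map_add, hl.map_smul]

theorem mdifferentiableAt_dualLine (u : DualSpace VE E) (q : E u.proj →L[ℝ] ℝ) (t : ℝ) :
    MDifferentiableAt 𝓘(ℝ, ℝ) (modelD EM VE) (dualLine u q) t := by
  refine ContMDiffAt.mdifferentiableAt (n := ∞) ?_ (by simp)
  refine contMDiffAt_totalSpace.2 ⟨contMDiffAt_const, ?_⟩
  have : (fun s ↦ (dualTriv VE E u.proj (dualLine u q s)).2)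
      = fun s ↦ (dualTriv VE E u.proj u).2 + s • (dualTriv VE E u.proj ⟨u.proj, q⟩).2 := by
    funext s
    exact snd_dualTriv_dualLine u q s (mem_baseSet_trivializationAt _ _ _)
  change ContMDiffAt 𝓘(ℝ, ℝ) 𝓘(ℝ, VE →L[ℝ] ℝ) ∞
    (fun s ↦ (dualTriv VE E u.proj (dualLine u q s)).2) t
  rw [this]
  exact contMDiffAt_const.add (contMDiffAt_id.smul contMDiffAt_const)

/-- The derivative of a function or map in the direction of a vertical lift. -/
theorem mfderiv_vlift {W : Type*} [NormedAddCommGroup W] [NormedSpace ℝ W]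
    {f : DualSpace VE E → W} {u : DualSpace VE E} (q : E u.proj →L[ℝ] ℝ)
    (hf : MDifferentiableAt (modelD EM VE) 𝓘(ℝ, W) f u) {w : W}
    (hw : HasDerivAt (f ∘ dualLine u q) w 0) :
    mfderiv (modelD EM VE) 𝓘(ℝ, W) f u (vlift u q) = w := by
  have key : ∀ u' : DualSpace VE E, dualLine u q 0 = u' →
      MDifferentiableAt (modelD EM VE) 𝓘(ℝ, W) f u' →
      (mfderiv (modelD EM VE) 𝓘(ℝ, W) f u'
        (mfderiv 𝓘(ℝ, ℝ) (modelD EM VE) (dualLine u q) 0 (1 : ℝ) : EM × (VE →L[ℝ] ℝ)) : W) = w := by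
    rintro u' rfl hf
    have hc := mfderiv_comp (0 : ℝ) hf (mdifferentiableAt_dualLine u q 0)
    have := DFunLike.congr_fun hc (1 : ℝ)
    refine this.symm.trans ?_
    rw [mfderiv_eq_fderiv]
    exact (DFunLike.congr_fun hw.hasFDerivAt.fderiv (1 : ℝ)).trans (one_smul ℝ w)
  exact key u (dualLine_zero u q) hf

/-- In a chart the vertical lift of `q` has base component `0` and the coordinates of `q` as fibre
component. -/
theorem mfderiv_extChartAt_vlift {u₀ u : DualSpace VE E}
    (hu : u ∈ (chartAt (ModelProd EM (VE →L[ℝ] ℝ)) u₀).source) (q : E u.proj →L[ℝ] ℝ) :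
    mfderiv (modelD EM VE) 𝓘(ℝ, EM × (VE →L[ℝ] ℝ)) (extChartAt (modelD EM VE) u₀) u (vlift u q)
      = ((0, (dualTriv VE E u₀.proj ⟨u.proj, q⟩).2) : EM × (VE →L[ℝ] ℝ)) := by
  have : IsManifold (modelD EM VE) 1 (DualSpace VE E) := IsManifold.of_le (n := ∞) (by simp)
  refine mfderiv_vlift q (mdifferentiableAt_extChartAt hu) ?_
  have h1 := (mem_chart_source_dual.1 hu).1
  have : extChartAt (modelD EM VE) u₀ ∘ dualLine u q = fun t ↦
      (extChartAt 𝓘(ℝ, EM) u₀.proj u.proj, (dualTriv VE E u₀.proj u).2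
        + t • (dualTriv VE E u₀.proj ⟨u.proj, q⟩).2) := by
    funext t
    rw [Function.comp_apply, extChartAt_dual (show (dualLine u q t).proj ∈ _ from h1),
      snd_dualTriv_dualLine u q t h1]
    rfl
  rw [this]
  refine (hasDerivAt_const _ _).prodMk ?_
  simpa using ((hasDerivAt_id (0 : ℝ)).smul_const
    (dualTriv VE E u₀.proj ⟨u.proj, q⟩).2).const_add (dualTriv VE E u₀.proj u).2

theorem eq_of_mfderiv_extChartAt_eq {u₀ u : DualSpace VE E}
    (hu : u ∈ (chartAt (ModelProd EM (VE →L[ℝ] ℝ)) u₀).source)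
    {v w : TangentSpace (modelD EM VE) u}
    (h : mfderiv (modelD EM VE) 𝓘(ℝ, EM × (VE →L[ℝ] ℝ)) (extChartAt (modelD EM VE) u₀) u v
      = mfderiv (modelD EM VE) 𝓘(ℝ, EM × (VE →L[ℝ] ℝ)) (extChartAt (modelD EM VE) u₀) u w) :
    v = w := by
  have : IsManifold (modelD EM VE) 1 (DualSpace VE E) := IsManifold.of_le (n := ∞) (by simp)
  exact (isInvertible_mfderiv_extChartAt (I := modelD EM VE)
    (by simpa [extChartAt_source] using hu)).injective h

/-- The kernel of `Tπ` consists of the vertical lifts. -/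
theorem exists_eq_vlift {u : DualSpace VE E} (v : TangentSpace (modelD EM VE) u)
    (hv : mfderiv (modelD EM VE) 𝓘(ℝ, EM) (TotalSpace.proj : DualSpace VE E → M) u v = 0) :
    ∃ q : E u.proj →L[ℝ] ℝ, v = vlift u q := by
  have hu := mem_chart_source (ModelProd EM (VE →L[ℝ] ℝ)) u
  set w : EM × (VE →L[ℝ] ℝ) := mfderiv (modelD EM VE) 𝓘(ℝ, EM × (VE →L[ℝ] ℝ))
    (extChartAt (modelD EM VE) u) u v with hw
  refine ⟨(dualTriv VE E u.proj).symm u.proj w.2, eq_of_mfderiv_extChartAt_eq hu ?_⟩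
  rw [mfderiv_extChartAt_vlift hu]
  refine Prod.ext ?_ ?_
  · refine (fst_mfderiv_extChartAt_dual hu v).trans ?_
    rw [hv]
    exact map_zero (mfderiv 𝓘(ℝ, EM) 𝓘(ℝ, EM) (extChartAt 𝓘(ℝ, EM) u.proj) u.proj)
  · have h2 : (dualTriv VE E u.proj ⟨u.proj, (dualTriv VE E u.proj).symm u.proj w.2⟩).2 = w.2 :=
      congrArg Prod.snd ((dualTriv VE E u.proj).apply_mk_symm
        (mem_baseSet_trivializationAt _ _ u.proj) w.2)
    exact h2.symm

/-- The fibre coordinate `u ↦ u(s)` of a smooth section `s` of `E` is smooth on the dual bundle. -/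
theorem contMDiff_dual_apply (s : Cₛ^∞⟮𝓘(ℝ, EM); VE, E⟯) :
    ContMDiff (modelD EM VE) 𝓘(ℝ, ℝ) ∞ (fun w : DualSpace VE E ↦ w.2 (s w.proj)) := by
  have h := ContMDiff.clm_bundle_apply (n := ∞) (IB := 𝓘(ℝ, EM)) (IM := modelD EM VE)
    (E₁ := E) (E₂ := Trivial M ℝ) (b := (TotalSpace.proj : DualSpace VE E → M))
    (ϕ := fun w : DualSpace VE E ↦ w.2) (v := fun w ↦ s w.proj)
    contMDiff_id (s.contMDiff.comp contMDiff_dualProj)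
  intro u
  exact (contMDiffAt_totalSpace.1 (h u)).2

theorem mfderiv_dual_apply_vlift (s : Cₛ^∞⟮𝓘(ℝ, EM); VE, E⟯) {u : DualSpace VE E}
    (q : E u.proj →L[ℝ] ℝ) :
    mfderiv (modelD EM VE) 𝓘(ℝ, ℝ) (fun w : DualSpace VE E ↦ w.2 (s w.proj)) u (vlift u q)
      = q (s u.proj) := by
  refine mfderiv_vlift q ((contMDiff_dual_apply s).mdifferentiableAt (by simp)) ?_
  change HasDerivAt (fun t : ℝ ↦ (u.2 + t • q) (s u.proj)) _ 0
  simp only [add_apply, smul_apply, smul_eq_mul]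
  simpa using! ((hasDerivAt_id (0 : ℝ)).mul_const (q (s u.proj))).const_add (u.2 (s u.proj))

theorem contMDiff_vlift (q : Cₛ^∞⟮𝓘(ℝ, EM); VE →L[ℝ] ℝ, fun x : M ↦ E x →L[ℝ] ℝ⟯) :
    ContMDiff (modelD EM VE) (modelD EM VE).tangent ∞
      (fun u : DualSpace VE E ↦ (⟨u, vlift u (q u.proj)⟩ : TangentBundle (modelD EM VE) _)) := by
  intro u₀
  have h := (contMDiffAt_totalSpace.1 ((q.contMDiff.comp contMDiff_dualProj) u₀)).2
  refine contMDiffAt_vectorField_of_extChartAt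
    (mem_chart_source (ModelProd EM (VE →L[ℝ] ℝ)) u₀)
    (w := fun u ↦ ((0, (dualTriv VE E u₀.proj ⟨u.proj, q u.proj⟩).2) : EM × (VE →L[ℝ] ℝ))) ?_ ?_
  · exact contMDiffAt_const.prodMk_space h
  · exact fun u hu ↦ mfderiv_extChartAt_vlift hu (q u.proj)

end Vertical

/-! ### The bracket of vertical lifts, and lifts of vector fields -/

section Lifts

variable {EM : Type*} [NormedAddCommGroup EM] [NormedSpace ℝ EM]
  {M : Type*} [TopologicalSpace M] [ChartedSpace EM M] [IsManifold 𝓘(ℝ, EM) ∞ M]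
  {VE : Type*} [NormedAddCommGroup VE] [NormedSpace ℝ VE]
  {E : M → Type*} [∀ x, AddCommGroup (E x)] [∀ x, Module ℝ (E x)]
  [∀ x, TopologicalSpace (E x)] [TopologicalSpace (TotalSpace VE E)]
  [FiberBundle VE E] [VectorBundle ℝ VE E] [ContMDiffVectorBundle ∞ VE E 𝓘(ℝ, EM)]

/-- No differentiability of `g` is needed: `fderiv` vanishes where it fails. -/
theorem fderiv_comp_fst_apply_inr {W₁ W₂ W₃ : Type*} [NormedAddCommGroup W₁] [NormedSpace ℝ W₁]
    [NormedAddCommGroup W₂] [NormedSpace ℝ W₂] [NormedAddCommGroup W₃] [NormedSpace ℝ W₃]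
    (g : W₁ → W₃) (y : W₁ × W₂) (b : W₂) :
    fderiv ℝ (fun z : W₁ × W₂ ↦ g z.1) y (0, b) = 0 := by
  by_cases hd : DifferentiableAt ℝ (fun z : W₁ × W₂ ↦ g z.1) y
  · rw [← hd.lineDeriv_eq_fderiv, lineDeriv]
    simp
  · simp [fderiv_zero_of_not_differentiableAt hd]

/-- Vertical vector fields with coefficients that are constant along the fibres commute. -/
theorem lieBracketWithin_eq_zero_of_vertical {W₁ W₂ : Type*} [NormedAddCommGroup W₁]
    [NormedSpace ℝ W₁] [NormedAddCommGroup W₂] [NormedSpace ℝ W₂] {X Y : W₁ × W₂ → W₁ × W₂}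
    {f g : W₁ → W₂} {y : W₁ × W₂} {s : Set (W₁ × W₂)} (hs : s = univ)
    (hX : X =ᶠ[𝓝 y] fun z ↦ (0, f z.1)) (hY : Y =ᶠ[𝓝 y] fun z ↦ (0, g z.1)) :
    VectorField.lieBracketWithin ℝ X Y s y = 0 := by
  rw [hs, VectorField.lieBracketWithin_univ, VectorField.lieBracket, hX.fderiv_eq, hY.fderiv_eq,
    hX.eq_of_nhds, hY.eq_of_nhds, fderiv_comp_fst_apply_inr (fun x ↦ ((0, g x) : W₁ × W₂)),
    fderiv_comp_fst_apply_inr (fun x ↦ ((0, f x) : W₁ × W₂)), sub_zero]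

/-- The coordinate expression of the vertical lift of a section of the dual bundle is constant along
the fibres. -/
theorem mpullback_vlift {u₀ : DualSpace VE E} (q : ∀ x : M, E x →L[ℝ] ℝ)
    {y : EM × (VE →L[ℝ] ℝ)} (hy : y ∈ (extChartAt (modelD EM VE) u₀).target) :
    VectorField.mpullbackWithin 𝓘(ℝ, EM × (VE →L[ℝ] ℝ)) (modelD EM VE)
        (extChartAt (modelD EM VE) u₀).symm (fun u ↦ vlift u (q u.proj)) (range (modelD EM VE)) y
      = ((0, (dualTriv VE E u₀.proj ⟨(extChartAt 𝓘(ℝ, EM) u₀.proj).symm y.1,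
          q ((extChartAt 𝓘(ℝ, EM) u₀.proj).symm y.1)⟩).2) : EM × (VE →L[ℝ] ℝ)) := by
  have : IsManifold (modelD EM VE) 1 (DualSpace VE E) := IsManifold.of_le (n := ∞) (by simp)
  have hs : (extChartAt (modelD EM VE) u₀).symm y
      ∈ (chartAt (ModelProd EM (VE →L[ℝ] ℝ)) u₀).source := by
    simpa [extChartAt_source] using (extChartAt (modelD EM VE) u₀).map_target hy
  have hp : ((extChartAt (modelD EM VE) u₀).symm y).proj
      = (extChartAt 𝓘(ℝ, EM) u₀.proj).symm y.1 := by
    have h1 := mem_chart_source_dual.1 hs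
    have h2 := extChartAt_dual (EM := EM) h1.1
    rw [(extChartAt (modelD EM VE) u₀).right_inv hy] at h2
    rw [show y.1 = _ from congrArg Prod.fst h2,
      (extChartAt 𝓘(ℝ, EM) u₀.proj).left_inv (by simpa [extChartAt_source] using h1.2)]
  have h3 := mfderiv_extChartAt_vlift hs (q ((extChartAt (modelD EM VE) u₀).symm y).proj)
  refine Eq.trans ?_ (h3.trans (congrArg (fun x ↦
    ((0, (dualTriv VE E u₀.proj ⟨x, q x⟩).2) : EM × (VE →L[ℝ] ℝ))) hp))
  have h4 : (mfderivWithin 𝓘(ℝ, EM × (VE →L[ℝ] ℝ)) (modelD EM VE)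
      (extChartAt (modelD EM VE) u₀).symm (range (modelD EM VE)) y).inverse
      = mfderiv (modelD EM VE) 𝓘(ℝ, EM × (VE →L[ℝ] ℝ)) (extChartAt (modelD EM VE) u₀)
        ((extChartAt (modelD EM VE) u₀).symm y) :=
    ContinuousLinearMap.inverse_eq
      (mfderivWithin_extChartAt_symm_comp_mfderiv_extChartAt (I := modelD EM VE) hy)
      (mfderiv_extChartAt_comp_mfderivWithin_extChartAt_symm (I := modelD EM VE) hy)
  rw [VectorField.mpullbackWithin_apply]
  exact DFunLike.congr_fun h4 _

/-- The vertical lifts of two sections of the dual bundle commute. -/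
theorem mlieBracket_vlift (q₁ q₂ : ∀ x : M, E x →L[ℝ] ℝ) (u : DualSpace VE E) :
    VectorField.mlieBracket (modelD EM VE) (fun w : DualSpace VE E ↦ vlift w (q₁ w.proj))
      (fun w ↦ vlift w (q₂ w.proj)) u = 0 := by
  have hr : range (modelD EM VE) = univ := ModelWithCorners.range_eq_univ _
  have key : ∀ q : (∀ x : M, E x →L[ℝ] ℝ),
      VectorField.mpullbackWithin 𝓘(ℝ, EM × (VE →L[ℝ] ℝ)) (modelD EM VE)
        (extChartAt (modelD EM VE) u).symm (fun u ↦ vlift u (q u.proj)) (range (modelD EM VE))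
      =ᶠ[𝓝 (extChartAt (modelD EM VE) u u)] fun y : EM × (VE →L[ℝ] ℝ) ↦
        ((0, (dualTriv VE E u.proj ⟨(extChartAt 𝓘(ℝ, EM) u.proj).symm y.1,
          q ((extChartAt 𝓘(ℝ, EM) u.proj).symm y.1)⟩).2) : EM × (VE →L[ℝ] ℝ)) := by
    intro q
    filter_upwards [extChartAt_target_mem_nhds (I := modelD EM VE) u] with y hy
    exact mpullback_vlift q hy
  let k (q : ∀ x : M, E x →L[ℝ] ℝ) (x : EM) : VE →L[ℝ] ℝ :=
    (dualTriv VE E u.proj ⟨(extChartAt 𝓘(ℝ, EM) u.proj).symm x,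
      q ((extChartAt 𝓘(ℝ, EM) u.proj).symm x)⟩).2
  have h1 := lieBracketWithin_eq_zero_of_vertical (f := k q₁) (g := k q₂)
    (s := (extChartAt (modelD EM VE) u).symm ⁻¹' univ ∩ range (modelD EM VE))
    (by rw [hr, preimage_univ, inter_univ]) (key q₁) (key q₂)
  rw [← VectorField.mlieBracketWithin_univ, VectorField.mlieBracketWithin_apply]
  exact (congrArg _ h1).trans (ContinuousLinearMap.map_zero _)

/-- A vector field on the base lifts, near a point of the dual bundle, to a smooth vector field. -/
theorem exists_smooth_lift {V : ∀ x : M, TangentSpace 𝓘(ℝ, EM) x} (u₀ : DualSpace VE E)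
    (hV : ContMDiff 𝓘(ℝ, EM) 𝓘(ℝ, EM).tangent ∞
      (fun x ↦ (⟨x, V x⟩ : TangentBundle 𝓘(ℝ, EM) M))) :
    ∃ (v : ∀ u : DualSpace VE E, TangentSpace (modelD EM VE) u) (O : Set (DualSpace VE E)),
      IsOpen O ∧ u₀ ∈ O ∧
      (∀ u ∈ O, mfderiv (modelD EM VE) 𝓘(ℝ, EM) (TotalSpace.proj : DualSpace VE E → M) u (v u)
        = V u.proj) ∧
      ContMDiffOn (modelD EM VE) (modelD EM VE).tangent ∞
        (fun u ↦ (⟨u, v u⟩ : TangentBundle (modelD EM VE) (DualSpace VE E))) O := by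
  have : IsManifold (modelD EM VE) 1 (DualSpace VE E) := IsManifold.of_le (n := ∞) (by simp)
  have : IsManifold 𝓘(ℝ, EM) 1 M := IsManifold.of_le (n := ∞) (by simp)
  let w : DualSpace VE E → EM × (VE →L[ℝ] ℝ) := fun u ↦
    (mfderiv 𝓘(ℝ, EM) 𝓘(ℝ, EM) (extChartAt 𝓘(ℝ, EM) u₀.proj) u.proj (V u.proj), 0)
  -- In the chart around `u₀` the lift has the fibre component `0`.
  let v : ∀ u : DualSpace VE E, TangentSpace (modelD EM VE) u := fun u ↦
    (mfderiv (modelD EM VE) 𝓘(ℝ, EM × (VE →L[ℝ] ℝ)) (extChartAt (modelD EM VE) u₀) u).inverse (w u)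
  have hv : ∀ u ∈ (chartAt (ModelProd EM (VE →L[ℝ] ℝ)) u₀).source,
      mfderiv (modelD EM VE) 𝓘(ℝ, EM × (VE →L[ℝ] ℝ)) (extChartAt (modelD EM VE) u₀) u (v u)
        = w u := fun u hu ↦
    (isInvertible_mfderiv_extChartAt (I := modelD EM VE)
      (by simpa [extChartAt_source] using hu)).self_apply_inverse _
  refine ⟨v, (chartAt (ModelProd EM (VE →L[ℝ] ℝ)) u₀).source,
    (chartAt (ModelProd EM (VE →L[ℝ] ℝ)) u₀).open_source, mem_chart_source _ _, fun u hu ↦ ?_,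
    fun u hu ↦ (contMDiffAt_vectorField_of_extChartAt hu (w := w) ?_ hv).contMDiffWithinAt⟩
  · have h1 := fst_mfderiv_extChartAt_dual hu (v u)
    have h2 : (mfderiv 𝓘(ℝ, EM) 𝓘(ℝ, EM) (extChartAt 𝓘(ℝ, EM) u₀.proj) u.proj (V u.proj) : EM)
        = _ :=
      (congrArg Prod.fst (hv u hu)).symm.trans h1
    exact ((isInvertible_mfderiv_extChartAt (I := 𝓘(ℝ, EM))
      (by simpa [extChartAt_source] using (mem_chart_source_dual.1 hu).2)).injective h2).symm
  · refine ContMDiffAt.prodMk_space ?_ contMDiffAt_const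
    exact (contMDiffAt_extChartAt_vectorField (mem_chart_source_dual.1 hu).2 (hV u.proj)).comp u
      contMDiff_dualProj.contMDiffAt

end Lifts

/-! ### Smooth sections with prescribed values -/

section Extension

variable {EB : Type*} [NormedAddCommGroup EB] [NormedSpace ℝ EB] [FiniteDimensional ℝ EB]
  {B : Type*} [TopologicalSpace B] [T2Space B] [ChartedSpace EB B] [IsManifold 𝓘(ℝ, EB) ∞ B]
  {W : Type*} [NormedAddCommGroup W] [NormedSpace ℝ W]
  {V : B → Type*} [∀ y, AddCommGroup (V y)] [∀ y, Module ℝ (V y)]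
  [∀ y, TopologicalSpace (V y)] [TopologicalSpace (TotalSpace W V)]
  [FiberBundle W V] [VectorBundle ℝ W V] [ContMDiffVectorBundle ∞ W V 𝓘(ℝ, EB)]

/-- Smooth bump functions, as plain functions. -/
theorem exists_bump {y : B} {s : Set B} (hs : s ∈ 𝓝 y) :
    ∃ f : B → ℝ, ContMDiff 𝓘(ℝ, EB) 𝓘(ℝ, ℝ) ∞ f ∧ (∀ᶠ z in 𝓝 y, f z = 1) ∧ tsupport f ⊆ s := by
  obtain ⟨f, -, hf⟩ := (SmoothBumpFunction.nhds_basis_tsupport (I := 𝓘(ℝ, EB)) y).mem_iff.1 hs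
  exact ⟨f, f.contMDiff, f.eventuallyEq_one, hf⟩

/-- The product of a smooth function and a smooth section. -/
def fnSmul (f : B → ℝ) (hf : ContMDiff 𝓘(ℝ, EB) 𝓘(ℝ, ℝ) ∞ f) (τ : Cₛ^∞⟮𝓘(ℝ, EB); W, V⟯) :
    Cₛ^∞⟮𝓘(ℝ, EB); W, V⟯ :=
  ⟨fun y ↦ f y • τ y, hf.smul_section τ.contMDiff⟩

/-- A frame of a trivialization extends from a neighbourhood of a point to smooth global
sections. -/
theorem exists_section_eq_symm (e : Trivialization W (TotalSpace.proj : TotalSpace W V → B))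
    [MemTrivializationAtlas e] {y : B} (hy : y ∈ e.baseSet) :
    ∃ τ : W → Cₛ^∞⟮𝓘(ℝ, EB); W, V⟯, ∀ᶠ z in 𝓝 y, ∀ w, τ w z = e.symm z w := by
  obtain ⟨f, hf, h1, hsup⟩ := exists_bump (EB := EB) (e.open_baseSet.mem_nhds hy)
  have hs : ∀ w : W, ContMDiffOn 𝓘(ℝ, EB) (𝓘(ℝ, EB).prod 𝓘(ℝ, W)) ∞
      (fun z ↦ (⟨z, e.symm z w⟩ : TotalSpace W V)) e.baseSet := by
    intro w
    rw [e.contMDiffOn_section_baseSet_iff]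
    refine (contMDiffOn_const (c := w)).congr fun z hz ↦ ?_
    exact congrArg Prod.snd (e.apply_mk_symm hz w)
  refine ⟨fun w ↦ ⟨fun z ↦ f z • e.symm z w,
    ContMDiffOn.smul_section_of_tsupport hf.contMDiffOn e.open_baseSet hsup (hs w)⟩, ?_⟩
  filter_upwards [h1] with z hz w
  change f z • e.symm z w = _
  rw [hz, one_smul]

theorem exists_section_apply_eq (y : B) (v : V y) : ∃ τ : Cₛ^∞⟮𝓘(ℝ, EB); W, V⟯, τ y = v := by
  obtain ⟨τ, hτ⟩ := exists_section_eq_symm (EB := EB) (trivializationAt W V y)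
    (mem_baseSet_trivializationAt W V y)
  refine ⟨τ (trivializationAt W V y ⟨y, v⟩).2, (hτ.self_of_nhds _).trans ?_⟩
  exact (trivializationAt W V y).symm_apply_apply_mk (mem_baseSet_trivializationAt W V y) v

/-- A tangent vector which annihilates all smooth functions vanishes. -/
theorem eq_zero_of_mfderiv_eq_zero {y : B} (v : TangentSpace 𝓘(ℝ, EB) y)
    (h : ∀ f : B → ℝ, ContMDiff 𝓘(ℝ, EB) 𝓘(ℝ, ℝ) ∞ f →
      (mfderiv 𝓘(ℝ, EB) 𝓘(ℝ, ℝ) f y v : ℝ) = 0) : v = 0 := by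
  have : IsManifold 𝓘(ℝ, EB) 1 B := IsManifold.of_le (n := ∞) (by simp)
  obtain ⟨ψ⟩ : Nonempty (SmoothBumpFunction 𝓘(ℝ, EB) y) := inferInstance
  have key : ∀ l : EB →L[ℝ] ℝ, l (v : EB) = 0 := by
    intro l
    have hg : ContMDiffOn 𝓘(ℝ, EB) 𝓘(ℝ, ℝ) ∞ (fun z ↦ l (extChartAt 𝓘(ℝ, EB) y z))
        (chartAt EB y).source := l.contMDiff.comp_contMDiffOn contMDiffOn_extChartAt
    have h1 := h _ (ψ.contMDiff_smul hg)
    have h2 : (fun z ↦ ψ z • l (extChartAt 𝓘(ℝ, EB) y z)) =ᶠ[𝓝 y]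
        (l ∘ extChartAt 𝓘(ℝ, EB) y) := by
      filter_upwards [ψ.eventuallyEq_one] with z hz
      simp [hz]
    have h3 := mfderiv_comp y (I'' := 𝓘(ℝ, ℝ)) (g := l)
      (ContinuousLinearMap.differentiableAt l).mdifferentiableAt
      (mdifferentiableAt_extChartAt (I := 𝓘(ℝ, EB)) (mem_chart_source EB y))
    have h4 : mfderiv 𝓘(ℝ, EB) 𝓘(ℝ, ℝ) l (extChartAt 𝓘(ℝ, EB) y y) = l := by
      rw [mfderiv_eq_fderiv]; exact ContinuousLinearMap.fderiv _
    have h5 := DFunLike.congr_fun (h2.mfderiv_eq.trans h3) v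
    rw [h4] at h5
    have h6 := DFunLike.congr_fun (mfderiv_extChartAt_self (I := 𝓘(ℝ, EB)) (x := y)) v
    exact (congrArg l h6).symm.trans (h5.symm.trans h1)
  have hw : ∀ w : EB, (∀ l : EB →L[ℝ] ℝ, l w = 0) → w = 0 := fun w hw ↦
    SeparatingDual.eq_zero_of_forall_dual_eq_zero (R := ℝ) hw
  exact hw v key

end Extension

/-! ### Locality of the bracket and the anchor -/

namespace GenLieAlgebroid

variable {EM : Type*} [NormedAddCommGroup EM] [NormedSpace ℝ EM]
  {M : Type*} [TopologicalSpace M] [ChartedSpace EM M] [IsManifold 𝓘(ℝ, EM) ∞ M]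
  {EN : Type*} [NormedAddCommGroup EN] [NormedSpace ℝ EN] [FiniteDimensional ℝ EN]
  {N : Type*} [TopologicalSpace N] [T2Space N] [ChartedSpace EN N] [IsManifold 𝓘(ℝ, EN) ∞ N]
  {VF : Type*} [NormedAddCommGroup VF] [NormedSpace ℝ VF]
  {F : N → Type*} [∀ y, AddCommGroup (F y)] [∀ y, Module ℝ (F y)]
  [∀ y, TopologicalSpace (F y)] [TopologicalSpace (TotalSpace VF F)]
  [FiberBundle VF F] [VectorBundle ℝ VF F] [ContMDiffVectorBundle ∞ VF F 𝓘(ℝ, EN)]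
  (A : GenLieAlgebroid EM M EN VF F)

/-- The bracket with a fixed section as an additive map. -/
def bracketHom (σ : Cₛ^∞⟮𝓘(ℝ, EN); VF, F⟯) :
    Cₛ^∞⟮𝓘(ℝ, EN); VF, F⟯ →+ Cₛ^∞⟮𝓘(ℝ, EN); VF, F⟯ :=
  AddMonoidHom.mk' (A.bracket σ) (A.bracket_add σ)

/-- Locality of the bracket, from the Leibniz rule for `τ = (1 - f) τ`, where `f` is a bump function
with support in the zero set of `τ`. -/
theorem bracket_eq_zero_of_eventuallyEq (σ : Cₛ^∞⟮𝓘(ℝ, EN); VF, F⟯)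
    {τ : Cₛ^∞⟮𝓘(ℝ, EN); VF, F⟯} {y : N} (h : ∀ᶠ z in 𝓝 y, τ z = 0) : A.bracket σ τ y = 0 := by
  obtain ⟨f, hf, h1, hsup⟩ := exists_bump (EB := EN) h
  have hl := A.leibniz σ τ τ (fun z ↦ 1 - f z) (contMDiff_const.sub hf) (fun z ↦ ?_) y
  · rw [hl, h1.self_of_nhds, h.self_of_nhds]
    simp
  · by_cases hz : f z = 0
    · simp [hz]
    · have : τ z = 0 := hsup (subset_tsupport f hz)
      simp [this]

theorem bracket_congr_right (σ : Cₛ^∞⟮𝓘(ℝ, EN); VF, F⟯) {τ τ' : Cₛ^∞⟮𝓘(ℝ, EN); VF, F⟯} {y : N}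
    (h : ∀ᶠ z in 𝓝 y, τ z = τ' z) : A.bracket σ τ y = A.bracket σ τ' y := by
  have h0 : A.bracket σ (τ - τ') y = 0 := by
    refine A.bracket_eq_zero_of_eventuallyEq σ ?_
    filter_upwards [h] with z hz
    simp [hz]
  have h1 : A.bracket σ (τ - τ') = A.bracket σ τ - A.bracket σ τ' := (A.bracketHom σ).map_sub τ τ'
  rw [h1] at h0
  exact sub_eq_zero.1 h0

/-- The value at `x` of the vector field `ρ ∘ σ`, which is `ρ (σ (η⁻¹ x))`. It belongs to the
tangent space at `η (η⁻¹ x)`, which is identified with that at `x` through the common model space.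
-/
def anchorVal (σ : ∀ y : N, F y) (x : M) : TangentSpace 𝓘(ℝ, EM) x :=
  (A.ρ (A.η.symm x) (σ (A.η.symm x)) : EM)

theorem contMDiff_anchorVal (σ : Cₛ^∞⟮𝓘(ℝ, EN); VF, F⟯) :
    ContMDiff 𝓘(ℝ, EM) 𝓘(ℝ, EM).tangent ∞
      (fun x ↦ (⟨x, A.anchorVal σ x⟩ : TangentBundle 𝓘(ℝ, EM) M)) := by
  have h := A.ρ_smooth.comp (σ.contMDiff.comp A.η.symm.contMDiff)
  refine h.congr fun x ↦ ?_
  have key : ∀ x', x' = x → ∀ v : EM,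
      ((⟨x, v⟩ : TangentBundle 𝓘(ℝ, EM) M)) = ⟨x', v⟩ := by
    rintro x' rfl v; rfl
  exact key _ (A.η.apply_symm_apply x) _

/-- The derivation of functions on `N` at the point `h x`, in terms of the vector field `ρ ∘ σ` at
`x`. -/
theorem anchorDeriv_apply (σ : ∀ y : N, F y) (f : N → ℝ) (x : M) :
    anchorDeriv A.h A.η A.ρ σ f (A.h x)
      = mfderiv 𝓘(ℝ, EN) 𝓘(ℝ, ℝ) f (A.h x)
        (mfderiv 𝓘(ℝ, EM) 𝓘(ℝ, EN) A.h x (A.anchorVal σ x)) := by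
  have h1 := congrArg (fun x' : M ↦ (mfderiv 𝓘(ℝ, EN) 𝓘(ℝ, ℝ) f (A.h (A.η (A.η.symm x')))
    (mfderiv 𝓘(ℝ, EM) 𝓘(ℝ, EN) A.h (A.η (A.η.symm x')) (A.ρ _ (σ (A.η.symm x')))) : ℝ))
    (A.h.symm_apply_apply x)
  have h2 := congrArg (fun x' : M ↦ (mfderiv 𝓘(ℝ, EN) 𝓘(ℝ, ℝ) f (A.h x')
    (mfderiv 𝓘(ℝ, EM) 𝓘(ℝ, EN) A.h x' (A.ρ _ (σ (A.η.symm x)) : EM)) : ℝ))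
    (A.η.apply_symm_apply x)
  exact h1.trans h2

theorem anchorAt_of_eq {x : M} (hx : A.η (A.h x) = x) (z : F (A.h x)) :
    A.anchorAt x z = (A.ρ (A.h x) z : EM) := by
  have key : ∀ (x' : M) (R : F (A.h x) →ₗ[ℝ] TangentSpace 𝓘(ℝ, EM) x') (e : x' = x),
      ((e ▸ R : F (A.h x) →ₗ[ℝ] TangentSpace 𝓘(ℝ, EM) x) z : EM) = (R z : EM) := by
    intro x' R e; subst e; rfl
  rw [anchorAt, dif_pos hx]
  exact key _ _ hx

/-- Where `η (h x) ≠ x`, the vector field `ρ ∘ σ` vanishes. The section `σ` may be cut off outside a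
neighbourhood of `η⁻¹ x`, so that it vanishes near `h x`. Then its bracket with any section vanishes
at `h x`, and the Leibniz rule leaves `(Th (ρ σ) g) τ = 0` there, for all functions `g` and sections
`τ`. -/
theorem anchorVal_eq_zero {x : M} (hx : A.η (A.h x) ≠ x) (σ : Cₛ^∞⟮𝓘(ℝ, EN); VF, F⟯) :
    A.anchorVal σ x = 0 := by
  by_cases hF : ∃ z : F (A.h x), z ≠ 0
  · obtain ⟨z, hz⟩ := hF
    obtain ⟨τ, rfl⟩ := exists_section_apply_eq (EB := EN) (W := VF) (A.h x) z
    have hw : ({A.h x}ᶜ : Set N) ∈ 𝓝 (A.η.symm x) := by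
      refine isOpen_compl_singleton.mem_nhds fun h ↦ hx ?_
      rw [← mem_singleton_iff.1 h, A.η.apply_symm_apply]
    obtain ⟨f, hf, h1, hsup⟩ := exists_bump (EB := EN) hw
    have hσ : ∀ᶠ y in 𝓝 (A.h x), fnSmul f hf σ y = 0 := by
      have hf0 : f =ᶠ[𝓝 (A.h x)] 0 :=
        notMem_tsupport_iff_eventuallyEq.1 fun h ↦ hsup h rfl
      filter_upwards [hf0] with y hy
      change f y • σ y = 0
      rw [hy]
      simp
    have hbr : ∀ τ' : Cₛ^∞⟮𝓘(ℝ, EN); VF, F⟯, A.bracket (fnSmul f hf σ) τ' (A.h x) = 0 := by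
      intro τ'
      rw [A.bracket_skew]
      exact neg_eq_zero.2 (A.bracket_eq_zero_of_eventuallyEq τ' hσ)
    have hval : A.anchorVal (fnSmul f hf σ) x = A.anchorVal σ x := by
      have : fnSmul f hf σ (A.η.symm x) = σ (A.η.symm x) := by
        change f _ • σ _ = _
        rw [h1.self_of_nhds, one_smul]
      rw [anchorVal, anchorVal, this]
    have hd : mfderiv 𝓘(ℝ, EM) 𝓘(ℝ, EN) A.h x (A.anchorVal σ x) = 0 := by
      refine eq_zero_of_mfderiv_eq_zero (EB := EN) (y := A.h x) _ fun g hg ↦ ?_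
      have hl := A.leibniz (fnSmul f hf σ) τ (fnSmul g hg τ) g hg (fun _ ↦ rfl) (A.h x)
      rw [hbr, hbr, smul_zero, zero_add, A.anchorDeriv_apply, hval] at hl
      exact (smul_eq_zero.1 hl.symm).resolve_right hz
    -- As `h` is a diffeomorphism, `Th (ρ σ) = 0` implies `ρ σ = 0`.
    have hinj := (A.h.mfderivToContinuousLinearEquiv (by simp) x).injective
    refine hinj (hd.trans ?_)
    exact (map_zero (A.h.mfderivToContinuousLinearEquiv (by simp) x)).symm
  -- If the fibre over `h x` is zero, then so is the model fibre, and with it every fibre of `F`.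
  · push Not at hF
    have hsub : ∀ v : VF, v = 0 := by
      intro v
      have h1 := (trivializationAt VF F (A.h x)).apply_mk_symm
        (mem_baseSet_trivializationAt VF F (A.h x)) v
      have h2 := ((trivializationAt VF F (A.h x)).linear ℝ
        (mem_baseSet_trivializationAt VF F (A.h x))).map_zero
      rw [hF ((trivializationAt VF F (A.h x)).symm (A.h x) v)] at h1
      exact (congrArg Prod.snd h1).symm.trans h2
    have h0 : σ (A.η.symm x) = 0 := by
      have h1 := (trivializationAt VF F (A.η.symm x)).symm_apply_apply_mk
        (mem_baseSet_trivializationAt VF F (A.η.symm x)) (σ (A.η.symm x))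
      have h2 := (trivializationAt VF F (A.η.symm x)).symm_apply_apply_mk
        (mem_baseSet_trivializationAt VF F (A.η.symm x)) 0
      exact h1.symm.trans ((congrArg _ ((hsub _).trans (hsub _).symm)).trans h2)
    rw [anchorVal, h0]
    exact map_zero (A.ρ (A.η.symm x))

/-- The anchor of `h^*F` is the vector field `ρ ∘ σ`. -/
theorem anchorAt_apply (σ : Cₛ^∞⟮𝓘(ℝ, EN); VF, F⟯) (x : M) :
    A.anchorAt x (σ (A.h x)) = A.anchorVal σ x := by
  by_cases hx : A.η (A.h x) = x
  · rw [A.anchorAt_of_eq hx]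
    have : A.h x = A.η.symm x := by rw [← hx, A.η.symm_apply_apply, hx]
    exact congrArg (fun w ↦ (A.ρ w (σ w) : EM)) this
  · rw [A.anchorVal_eq_zero hx, anchorAt, dif_neg hx]
    rfl

theorem anchorDeriv_eq_mfderiv_comp (σ : Cₛ^∞⟮𝓘(ℝ, EN); VF, F⟯) {f : N → ℝ} {x : M}
    (hf : MDifferentiableAt 𝓘(ℝ, EN) 𝓘(ℝ, ℝ) f (A.h x)) :
    anchorDeriv A.h A.η A.ρ σ f (A.h x)
      = differential 𝓘(ℝ, EM) (f ∘ A.h) x (A.anchorAt x (σ (A.h x))) := by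
  rw [A.anchorDeriv_apply, A.anchorAt_apply, differential,
    mfderiv_comp x hf (A.h.contMDiff.mdifferentiableAt (by simp))]
  rfl

/-- The bracket of two linear combinations of sections. -/
theorem bracket_sum_smul {ι : Type*} [Fintype ι] (t : ι → Cₛ^∞⟮𝓘(ℝ, EN); VF, F⟯)
    {f g : ι → N → ℝ} (hf : ∀ a, ContMDiff 𝓘(ℝ, EN) 𝓘(ℝ, ℝ) ∞ (f a))
    (hg : ∀ a, ContMDiff 𝓘(ℝ, EN) 𝓘(ℝ, ℝ) ∞ (g a)) {σ τ : Cₛ^∞⟮𝓘(ℝ, EN); VF, F⟯} {x : M}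
    (hσ : ∀ᶠ y in 𝓝 (A.h x), σ y = ∑ a, f a y • t a y)
    (hτ : ∀ᶠ y in 𝓝 (A.h x), τ y = ∑ a, g a y • t a y) :
    A.bracket σ τ (A.h x) = ∑ a, ∑ b, (f a (A.h x) * g b (A.h x)) • A.bracket (t a) (t b) (A.h x)
      + ∑ b, differential 𝓘(ℝ, EM) (g b ∘ A.h) x (A.anchorAt x (σ (A.h x))) • t b (A.h x)
      - ∑ a, differential 𝓘(ℝ, EM) (f a ∘ A.h) x (A.anchorAt x (τ (A.h x)))
        • t a (A.h x) := by
  have key : ∀ {k : ι → N → ℝ} (hk : ∀ a, ContMDiff 𝓘(ℝ, EN) 𝓘(ℝ, ℝ) ∞ (k a))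
      (υ κ : Cₛ^∞⟮𝓘(ℝ, EN); VF, F⟯), (∀ᶠ y in 𝓝 (A.h x), κ y = ∑ a, k a y • t a y) →
      A.bracket υ κ (A.h x) = ∑ a, (k a (A.h x) • A.bracket υ (t a) (A.h x)
        + differential 𝓘(ℝ, EM) (k a ∘ A.h) x (A.anchorAt x (υ (A.h x)))
          • t a (A.h x)) := by
    intro k hk υ κ hκ
    have h1 : ∀ᶠ y in 𝓝 (A.h x), κ y = (∑ a, fnSmul (k a) (hk a) (t a)) y := by
      filter_upwards [hκ] with y hy
      rw [hy, ← ContMDiffSection.coeAddHom_apply, map_sum, Finset.sum_apply]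
      rfl
    rw [A.bracket_congr_right υ h1]
    have h2 : A.bracket υ (∑ a, fnSmul (k a) (hk a) (t a))
        = ∑ a, A.bracket υ (fnSmul (k a) (hk a) (t a)) := map_sum (A.bracketHom υ) _ _
    rw [h2, ← ContMDiffSection.coeAddHom_apply, map_sum, Finset.sum_apply]
    refine Finset.sum_congr rfl fun a _ ↦ ?_
    rw [← A.anchorDeriv_eq_mfderiv_comp υ ((hk a).mdifferentiableAt (by simp))]
    exact A.leibniz υ (t a) _ (k a) (hk a) (fun _ ↦ rfl) (A.h x)
  rw [key hg σ τ hτ]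
  have h3 : ∀ b, A.bracket σ (t b) (A.h x) = ∑ a, f a (A.h x) • A.bracket (t a) (t b) (A.h x)
      - ∑ a, differential 𝓘(ℝ, EM) (f a ∘ A.h) x (A.anchorAt x (t b (A.h x)))
        • t a (A.h x) := by
    intro b
    rw [A.bracket_skew]
    change -(A.bracket (t b) σ (A.h x)) = _
    rw [key hf (t b) σ hσ, Finset.sum_add_distrib, neg_add, sub_eq_add_neg,
      ← Finset.sum_neg_distrib]
    congr 1
    refine Finset.sum_congr rfl fun a _ ↦ ?_
    rw [A.bracket_skew (t b)]
    change -(f a (A.h x) • -(A.bracket (t a) (t b) (A.h x))) = _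
    rw [smul_neg, neg_neg]
  have h4 : ∀ a, differential 𝓘(ℝ, EM) (f a ∘ A.h) x (A.anchorAt x (τ (A.h x)))
      = ∑ b, g b (A.h x)
        * differential 𝓘(ℝ, EM) (f a ∘ A.h) x (A.anchorAt x (t b (A.h x))) := by
    intro a
    rw [hτ.self_of_nhds, map_sum]
    rw [map_sum]
    refine Finset.sum_congr rfl fun b _ ↦ ?_
    rw [map_smul, map_smul, smul_eq_mul]
  simp only [h3, h4, Finset.sum_add_distrib, smul_sub, Finset.smul_sum, Finset.sum_sub_distrib,
    Finset.sum_smul, smul_smul]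
  rw [Finset.sum_comm (f := fun b a ↦ (g b (A.h x) * f a (A.h x)) • _),
    Finset.sum_comm (f := fun b a ↦ (g b (A.h x) * _) • t a (A.h x))]
  simp only [mul_comm (g _ _) (f _ _)]
  abel

end GenLieAlgebroid

/-! ### The adapted base is a base -/

section AdaptedBase

variable {EM : Type*} [NormedAddCommGroup EM] [NormedSpace ℝ EM]
  {M : Type*} [TopologicalSpace M] [ChartedSpace EM M] [IsManifold 𝓘(ℝ, EM) ∞ M]
  {EN : Type*} [NormedAddCommGroup EN] [NormedSpace ℝ EN]
  {N : Type*} [TopologicalSpace N] [ChartedSpace EN N]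
  {VF : Type*} [NormedAddCommGroup VF] [NormedSpace ℝ VF]
  {F : N → Type*} [∀ y, AddCommGroup (F y)] [∀ y, Module ℝ (F y)]
  [∀ y, TopologicalSpace (F y)] [TopologicalSpace (TotalSpace VF F)]
  [FiberBundle VF F] [VectorBundle ℝ VF F]
  {VE : Type*} [NormedAddCommGroup VE] [NormedSpace ℝ VE]
  {E : M → Type*} [∀ x, AddCommGroup (E x)] [∀ x, Module ℝ (E x)]
  [∀ x, TopologicalSpace (E x)] [TopologicalSpace (TotalSpace VE E)]
  [FiberBundle VE E] [VectorBundle ℝ VE E] [ContMDiffVectorBundle ∞ VE E 𝓘(ℝ, EM)]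
  {A : GenLieAlgebroid EM M EN VF F} {φ : BundleIdent VE E A} {Γ : NonlinConnection VE E A}

namespace NonlinConnection

theorem hlift_fst (Γ : NonlinConnection VE E A) (u : DualSpace VE E) (z : F (A.h u.proj)) :
    (Γ.hlift u z).1.1 = z := (Γ.exists_hlift u z).choose_spec.1

theorem proj_hlift (Γ : NonlinConnection VE E A) (u : DualSpace VE E) (z : F (A.h u.proj)) :
    Γ.proj u (Γ.hlift u z) = 0 := (Γ.exists_hlift u z).choose_spec.2

theorem proj_eq_sub_hlift (Γ : NonlinConnection VE E A) (u : DualSpace VE E)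
    (X : GenTangent VE E A u) : Γ.proj u X = X - Γ.hlift u X.1.1 := by
  have h : Γ.proj u (X - Γ.hlift u X.1.1) = X - Γ.hlift u X.1.1 := by
    refine Γ.proj_of_vertical u _ ?_
    change X.1.1 - (Γ.hlift u X.1.1).1.1 = 0
    rw [Γ.hlift_fst, sub_self]
  rw [← h, map_sub, Γ.proj_hlift, sub_zero]

end NonlinConnection

/-- The derivative of a function in the direction of the anchor, as a linear form on the fibre of
the generalized tangent bundle. -/
def lieLin (A : GenLieAlgebroid EM M EN VF F) (u : DualSpace VE E) (f : DualSpace VE E → ℝ) :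
    GenTangent VE E A u →ₗ[ℝ] ℝ :=
  differential (modelD EM VE) f u ∘ₗ LinearMap.snd ℝ _ _ ∘ₗ (GenTangent VE E A u).subtype

theorem lieLin_apply (u : DualSpace VE E) (f : DualSpace VE E → ℝ) (X : GenTangent VE E A u) :
    lieLin A u f X = lieD u X f := rfl

theorem lieD_add_left (u : DualSpace VE E) (f : DualSpace VE E → ℝ) (X Y : GenTangent VE E A u) :
    lieD u (X + Y) f = lieD u X f + lieD u Y f := (lieLin A u f).map_add X Y

theorem lieD_smul_left (u : DualSpace VE E) (f : DualSpace VE E → ℝ) (r : ℝ)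
    (X : GenTangent VE E A u) : lieD u (r • X) f = r * lieD u X f := (lieLin A u f).map_smul r X

theorem lieD_sum_left {ι : Type*} (s : Finset ι) (u : DualSpace VE E) (f : DualSpace VE E → ℝ)
    (X : ι → GenTangent VE E A u) :
    lieD u (∑ i ∈ s, X i) f = ∑ i ∈ s, lieD u (X i) f := map_sum (lieLin A u f) X s

theorem lieD_congr (u : DualSpace VE E) (X : GenTangent VE E A u) {f g : DualSpace VE E → ℝ}
    (h : f =ᶠ[𝓝 u] g) : lieD u X f = lieD u X g := by
  rw [lieD, lieD, h.mfderiv_eq]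
  rfl

theorem lieD_const (u : DualSpace VE E) (X : GenTangent VE E A u) (r : ℝ) :
    lieD u X (fun _ ↦ r) = 0 := by
  rw [lieD, mfderiv_const]
  rfl

theorem lieD_add (u : DualSpace VE E) (X : GenTangent VE E A u) {f g : DualSpace VE E → ℝ}
    (hf : MDifferentiableAt (modelD EM VE) 𝓘(ℝ, ℝ) f u)
    (hg : MDifferentiableAt (modelD EM VE) 𝓘(ℝ, ℝ) g u) :
    lieD u X (fun w ↦ f w + g w) = lieD u X f + lieD u X g := by
  have h := mfderiv_add hf hg
  exact DFunLike.congr_fun h X.1.2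

theorem lieD_mul (u : DualSpace VE E) (X : GenTangent VE E A u) {f g : DualSpace VE E → ℝ}
    (hf : MDifferentiableAt (modelD EM VE) 𝓘(ℝ, ℝ) f u)
    (hg : MDifferentiableAt (modelD EM VE) 𝓘(ℝ, ℝ) g u) :
    lieD u X (fun w ↦ f w * g w) = f u * lieD u X g + g u * lieD u X f := by
  have h := (hf.hasMFDerivAt.mul hg.hasMFDerivAt).mfderiv
  exact DFunLike.congr_fun h X.1.2

/-- The sum rule, together with the differentiability of the sum, which an induction needs. -/
theorem lieD_sum {ι : Type*} (s : Finset ι) (u : DualSpace VE E) (X : GenTangent VE E A u)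
    {f : ι → DualSpace VE E → ℝ}
    (hf : ∀ i, MDifferentiableAt (modelD EM VE) 𝓘(ℝ, ℝ) (f i) u) :
    MDifferentiableAt (modelD EM VE) 𝓘(ℝ, ℝ) (fun w ↦ ∑ i ∈ s, f i w) u ∧
    lieD u X (fun w ↦ ∑ i ∈ s, f i w) = ∑ i ∈ s, lieD u X (f i) := by
  classical
  induction s using Finset.induction_on with
  | empty => simp [lieD_const, mdifferentiableAt_const]
  | insert i s hi ih =>
    simp only [Finset.sum_insert hi]
    exact ⟨(hf i).add ih.1, (lieD_add u X (hf i) ih.1).trans (by rw [ih.2])⟩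

/-- The derivative of the pull-back of a function on `M` depends on the first component only. -/
theorem lieD_comp_proj (u : DualSpace VE E) (X : GenTangent VE E A u) {f : M → ℝ}
    (hf : MDifferentiableAt 𝓘(ℝ, EM) 𝓘(ℝ, ℝ) f u.proj) :
    lieD u X (fun w ↦ f w.proj) = differential 𝓘(ℝ, EM) f u.proj (A.anchorAt u.proj X.1.1) := by
  have h := mfderiv_comp u hf (contMDiff_dualProj (EM := EM) (VE := VE) (E := E).mdifferentiableAt
    (by simp))
  have hX : mfderiv (modelD EM VE) 𝓘(ℝ, EM) (TotalSpace.proj : DualSpace VE E → M) u X.1.2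
    = A.anchorAt u.proj X.1.1 := X.2
  refine (DFunLike.congr_fun h X.1.2).trans ?_
  exact congrArg (differential 𝓘(ℝ, EM) f u.proj) hX

theorem vlift_zero (u : DualSpace VE E) : vlift (EM := EM) u (0 : E u.proj →L[ℝ] ℝ) = 0 := by
  have h : (fun t : ℝ ↦ (⟨u.proj, u.2 + t • (0 : E u.proj →L[ℝ] ℝ)⟩ : DualSpace VE E))
      = fun _ ↦ ⟨u.proj, u.2 + (0 : ℝ) • (0 : E u.proj →L[ℝ] ℝ)⟩ := by
    funext t
    simp
  rw [vlift, h, mfderiv_const]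
  rfl

namespace VectorChart

variable (c : VectorChart φ)

theorem expand_E {x : M} (hx : x ∈ c.U) (e : E x) : e = ∑ a, c.coframe a x e • c.s a x := by
  have h : LinearMap.id = ∑ a, ((c.coframe a x).toLinearMap.smulRight (c.s a x)) := by
    refine LinearMap.ext_on_range (c.span x hx) fun b ↦ ?_
    simp [c.dual x hx]
  simpa using LinearMap.congr_fun h e

theorem expand_dual {x : M} (hx : x ∈ c.U) (q : E x →L[ℝ] ℝ) :
    q = ∑ a, q (c.s a x) • c.coframe a x := by
  ext e
  conv_lhs => rw [c.expand_E hx e]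
  simp [mul_comm]

theorem expand_F {x : M} (hx : x ∈ c.U) (z : F (A.h x)) :
    z = ∑ a, c.coframe a x ((φ.equiv x).symm z) • c.t a (A.h x) := by
  conv_lhs => rw [← (φ.equiv x).apply_symm_apply z, c.expand_E hx ((φ.equiv x).symm z)]
  simp [c.corr x hx]

theorem coframe_t {x : M} (hx : x ∈ c.U) (a b : Fin (Module.finrank ℝ VE)) :
    c.coframe a x ((φ.equiv x).symm (c.t b (A.h x))) = if a = b then 1 else 0 := by
  rw [c.corr x hx, LinearEquiv.symm_apply_apply, c.dual x hx]

/-- The coordinate `dz^a` as a linear form. -/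
def dzLin (a : Fin (Module.finrank ℝ VE)) (u : DualSpace VE E) : GenTangent VE E A u →ₗ[ℝ] ℝ :=
  (c.coframe a u.proj).toLinearMap ∘ₗ (φ.equiv u.proj).symm.toLinearMap ∘ₗ LinearMap.fst ℝ _ _ ∘ₗ
    (GenTangent VE E A u).subtype

/-- The coordinate `δp_a` as a linear form. -/
def deltapLin (Γ : NonlinConnection VE E A) (a : Fin (Module.finrank ℝ VE)) (u : DualSpace VE E) :
    GenTangent VE E A u →ₗ[ℝ] ℝ :=
  lieLin A u (fun w : DualSpace VE E ↦ w.2 (c.s a w.proj)) ∘ₗ Γ.proj u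

theorem dzLin_apply (a : Fin (Module.finrank ℝ VE)) (u : DualSpace VE E) (X : GenTangent VE E A u) :
    c.dzLin a u X = c.dz a u X := rfl

theorem deltapLin_apply (a : Fin (Module.finrank ℝ VE)) (u : DualSpace VE E)
    (X : GenTangent VE E A u) : c.deltapLin Γ a u X = c.deltap Γ a u X := rfl

theorem dz_eq_zero {u : DualSpace VE E} {X : GenTangent VE E A u} (hX : X.1.1 = 0)
    (a : Fin (Module.finrank ℝ VE)) : c.dz a u X = 0 := by
  rw [dz, hX, map_zero, map_zero]

theorem deltap_eq_zero {u : DualSpace VE E} {X : GenTangent VE E A u} (hX : Γ.proj u X = 0)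
    (a : Fin (Module.finrank ℝ VE)) : c.deltap Γ a u X = 0 := by
  rw [← deltapLin_apply, deltapLin, LinearMap.comp_apply, hX, map_zero]

theorem dz_delta {u : DualSpace VE E} (hu : u.proj ∈ c.U) (a b : Fin (Module.finrank ℝ VE)) :
    c.dz a u (c.delta Γ b u) = if a = b then 1 else 0 := by
  rw [dz, delta, Γ.hlift_fst, c.coframe_t hu]

theorem dz_vert (u : DualSpace VE E) (a b : Fin (Module.finrank ℝ VE)) :
    c.dz a u (c.vert b u) = 0 := c.dz_eq_zero rfl a

theorem proj_delta (u : DualSpace VE E) (a : Fin (Module.finrank ℝ VE)) :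
    Γ.proj u (c.delta Γ a u) = 0 := Γ.proj_hlift u _

theorem deltap_delta (u : DualSpace VE E) (a b : Fin (Module.finrank ℝ VE)) :
    c.deltap Γ a u (c.delta Γ b u) = 0 := c.deltap_eq_zero (c.proj_delta u b) a

/-- On the vertical lift of `q` the coordinates `δp_a` are the values of `q` on the frame. -/
theorem deltap_of_vlift {u : DualSpace VE E} {X : GenTangent VE E A u} (hX : X.1.1 = 0)
    {q : E u.proj →L[ℝ] ℝ} (hq : X.1.2 = vlift u q) (a : Fin (Module.finrank ℝ VE)) :
    c.deltap Γ a u X = q (c.s a u.proj) := by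
  rw [deltap, Γ.proj_of_vertical u X hX, hq]
  exact mfderiv_dual_apply_vlift (c.s a) q

theorem deltap_vert {u : DualSpace VE E} (hu : u.proj ∈ c.U) (a b : Fin (Module.finrank ℝ VE)) :
    c.deltap Γ a u (c.vert b u) = if a = b then 1 else 0 := by
  rw [c.deltap_of_vlift (X := c.vert b u) rfl rfl, c.dual _ hu]
  simp [eq_comm]

theorem exists_vlift {u : DualSpace VE E} {X : GenTangent VE E A u} (hX : X.1.1 = 0) :
    ∃ q : E u.proj →L[ℝ] ℝ, X.1.2 = vlift u q := by
  refine exists_eq_vlift X.1.2 ?_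
  have h : mfderiv (modelD EM VE) 𝓘(ℝ, EM) (TotalSpace.proj : DualSpace VE E → M) u X.1.2
    = A.anchorAt u.proj X.1.1 := X.2
  rw [h, hX, map_zero]

theorem eq_zero_of_coord {u : DualSpace VE E} (hu : u.proj ∈ c.U) {X : GenTangent VE E A u}
    (hz : ∀ a, c.dz a u X = 0) (hp : ∀ a, c.deltap Γ a u X = 0) : X = 0 := by
  have h1 : X.1.1 = 0 := by
    rw [c.expand_F hu X.1.1]
    exact Finset.sum_eq_zero fun a _ ↦ by rw [show c.coframe a _ _ = 0 from hz a, zero_smul]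
  obtain ⟨q, hq⟩ := exists_vlift h1
  have h2 : q = 0 := by
    rw [c.expand_dual hu q]
    exact Finset.sum_eq_zero fun a _ ↦ by
      rw [← c.deltap_of_vlift (Γ := Γ) h1 hq a, hp, zero_smul]
  rw [h2, vlift_zero] at hq
  exact Subtype.ext (Prod.ext h1 hq)

theorem ext_coord {u : DualSpace VE E} (hu : u.proj ∈ c.U) {X Y : GenTangent VE E A u}
    (hz : ∀ a, c.dz a u X = c.dz a u Y) (hp : ∀ a, c.deltap Γ a u X = c.deltap Γ a u Y) :
    X = Y := by
  refine sub_eq_zero.1 (c.eq_zero_of_coord (Γ := Γ) hu (fun a ↦ ?_) fun a ↦ ?_)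
  · rw [← dzLin_apply, map_sub, dzLin_apply, dzLin_apply, hz, sub_self]
  · rw [← deltapLin_apply, map_sub, deltapLin_apply, deltapLin_apply, hp, sub_self]

/-- The vector with prescribed coordinates with respect to the adapted base. -/
def comb (Γ : NonlinConnection VE E A) (u : DualSpace VE E)
    (f g : Fin (Module.finrank ℝ VE) → ℝ) : GenTangent VE E A u :=
  ∑ a, f a • c.delta Γ a u + ∑ a, g a • c.vert a u

theorem dz_comb {u : DualSpace VE E} (hu : u.proj ∈ c.U) (f g : Fin (Module.finrank ℝ VE) → ℝ)
    (a : Fin (Module.finrank ℝ VE)) : c.dz a u (c.comb Γ u f g) = f a := by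
  rw [← dzLin_apply, comb, map_add, map_sum, map_sum]
  simp [dzLin_apply, c.dz_delta hu, c.dz_vert]

theorem deltap_comb {u : DualSpace VE E} (hu : u.proj ∈ c.U) (f g : Fin (Module.finrank ℝ VE) → ℝ)
    (a : Fin (Module.finrank ℝ VE)) : c.deltap Γ a u (c.comb Γ u f g) = g a := by
  rw [← deltapLin_apply, comb, map_add, map_sum, map_sum]
  simp [deltapLin_apply, c.deltap_delta, c.deltap_vert hu]

theorem eq_comb {u : DualSpace VE E} (hu : u.proj ∈ c.U) (X : GenTangent VE E A u) :
    X = c.comb Γ u (fun a ↦ c.dz a u X) (fun a ↦ c.deltap Γ a u X) :=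
  c.ext_coord (Γ := Γ) hu (fun a ↦
    (c.dz_comb (Γ := Γ) hu (fun b ↦ c.dz b u X) (fun b ↦ c.deltap Γ b u X) a).symm) fun a ↦
    (c.deltap_comb (Γ := Γ) hu (fun b ↦ c.dz b u X) (fun b ↦ c.deltap Γ b u X) a).symm

theorem proj_eq_zero_iff {u : DualSpace VE E} (hu : u.proj ∈ c.U) (X : GenTangent VE E A u) :
    Γ.proj u X = 0 ↔ ∀ a, c.deltap Γ a u X = 0 := by
  refine ⟨fun h ↦ c.deltap_eq_zero h, fun h ↦ ?_⟩
  refine c.eq_zero_of_coord (Γ := Γ) hu (c.dz_eq_zero (Γ.proj_vertical u X)) fun a ↦ ?_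
  rw [← h a, deltap, deltap, Γ.proj_of_vertical u _ (Γ.proj_vertical u X)]

theorem fst_eq_zero_iff {u : DualSpace VE E} (hu : u.proj ∈ c.U) (X : GenTangent VE E A u) :
    X.1.1 = 0 ↔ ∀ a, c.dz a u X = 0 := by
  refine ⟨fun h ↦ c.dz_eq_zero h, fun h ↦ ?_⟩
  rw [c.expand_F hu X.1.1]
  exact Finset.sum_eq_zero fun a _ ↦ by rw [show c.coframe a _ _ = 0 from h a, zero_smul]

/-- `δp_a` in terms of the derivative of the function `p_a`. -/
theorem deltap_eq {u : DualSpace VE E} (hu : u.proj ∈ c.U) (a : Fin (Module.finrank ℝ VE))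
    (X : GenTangent VE E A u) :
    c.deltap Γ a u X = lieD u X (fun w ↦ w.2 (c.s a w.proj))
      - ∑ b, c.dz b u X * lieD u (c.delta Γ b u) (fun w ↦ w.2 (c.s a w.proj)) := by
  have h : Γ.proj u X = X - ∑ b, c.dz b u X • c.delta Γ b u := by
    have h1 := c.eq_comb (Γ := Γ) hu X
    have h2 : Γ.proj u (∑ b, c.deltap Γ b u X • c.vert b u)
        = ∑ b, c.deltap Γ b u X • c.vert b u := by
      refine Γ.proj_of_vertical u _ ((c.fst_eq_zero_iff hu _).2 fun b ↦ ?_)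
      rw [← dzLin_apply, map_sum]
      simp [dzLin_apply, c.dz_vert]
    have h3 : Γ.proj u (∑ b, c.dz b u X • c.delta Γ b u) = 0 := by
      rw [map_sum]
      simp [c.proj_delta]
    refine ((congrArg (Γ.proj u) h1).trans ?_).trans (eq_sub_of_add_eq' h1.symm)
    rw [comb, map_add, h2, h3, zero_add]
  rw [← deltapLin_apply, deltapLin, LinearMap.comp_apply, h, map_sub, map_sum]
  simp only [map_smul, lieLin_apply, smul_eq_mul]

end VectorChart

end AdaptedBase

/-! ### Regularity of coordinates and of the adapted base -/

section Regularity

variable {EM : Type*} [NormedAddCommGroup EM] [NormedSpace ℝ EM]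
  {M : Type*} [TopologicalSpace M] [ChartedSpace EM M] [IsManifold 𝓘(ℝ, EM) ∞ M]
  {EN : Type*} [NormedAddCommGroup EN] [NormedSpace ℝ EN]
  {N : Type*} [TopologicalSpace N] [ChartedSpace EN N]
  {VF : Type*} [NormedAddCommGroup VF] [NormedSpace ℝ VF]
  {F : N → Type*} [∀ y, AddCommGroup (F y)] [∀ y, Module ℝ (F y)]
  [∀ y, TopologicalSpace (F y)] [TopologicalSpace (TotalSpace VF F)]
  [FiberBundle VF F] [VectorBundle ℝ VF F]
  {VE : Type*} [NormedAddCommGroup VE] [NormedSpace ℝ VE]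
  {E : M → Type*} [∀ x, AddCommGroup (E x)] [∀ x, Module ℝ (E x)]
  [∀ x, TopologicalSpace (E x)] [TopologicalSpace (TotalSpace VE E)]
  [FiberBundle VE E] [VectorBundle ℝ VE E] [ContMDiffVectorBundle ∞ VE E 𝓘(ℝ, EM)]
  {A : GenLieAlgebroid EM M EN VF F} {φ : BundleIdent VE E A} {Γ : NonlinConnection VE E A}

/-- Smoothness at a point of a section of the generalized tangent bundle. -/
def SmoothSectionAt (A : GenLieAlgebroid EM M EN VF F) (X : GenSection VE E A)
    (u₀ : DualSpace VE E) : Prop :=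
  ContMDiffAt (modelD EM VE) (𝓘(ℝ, EN).prod 𝓘(ℝ, VF)) ∞
    (fun u ↦ (⟨A.h u.proj, (X u).1.1⟩ : TotalSpace VF F)) u₀ ∧
  ContMDiffAt (modelD EM VE) (modelD EM VE).tangent ∞
    (fun u ↦ (⟨u, (X u).1.2⟩ : TangentBundle (modelD EM VE) (DualSpace VE E))) u₀

theorem SmoothSectionOn.smoothSectionAt {X : GenSection VE E A} {O : Set (DualSpace VE E)}
    (hX : SmoothSectionOn A X O) (hO : IsOpen O) {u : DualSpace VE E} (hu : u ∈ O) :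
    SmoothSectionAt A X u :=
  ⟨hX.1.contMDiffAt (hO.mem_nhds hu), hX.2.contMDiffAt (hO.mem_nhds hu)⟩

theorem smoothSectionOn_of_forall {X : GenSection VE E A} {O : Set (DualSpace VE E)}
    (hX : ∀ u ∈ O, SmoothSectionAt A X u) : SmoothSectionOn A X O :=
  ⟨fun u hu ↦ (hX u hu).1.contMDiffWithinAt, fun u hu ↦ (hX u hu).2.contMDiffWithinAt⟩

theorem SmoothSectionAt.diffSectionAt {X : GenSection VE E A} {u : DualSpace VE E}
    (hX : SmoothSectionAt A X u) : DiffSectionAt A X u :=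
  ⟨hX.1.mdifferentiableAt (by simp), hX.2.mdifferentiableAt (by simp)⟩

theorem SmoothSectionAt.congr {X Y : GenSection VE E A} {u : DualSpace VE E}
    (hX : SmoothSectionAt A X u) (h : ∀ᶠ w in 𝓝 u, Y w = X w) : SmoothSectionAt A Y u := by
  refine ⟨hX.1.congr_of_eventuallyEq ?_, hX.2.congr_of_eventuallyEq ?_⟩ <;>
  · filter_upwards [h] with w hw
    rw [hw]

theorem SmoothSectionAt.add_smul {X Y : GenSection VE E A} {f : DualSpace VE E → ℝ}
    {u : DualSpace VE E} (hX : SmoothSectionAt A X u) (hY : SmoothSectionAt A Y u)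
    (hf : ContMDiffAt (modelD EM VE) 𝓘(ℝ, ℝ) ∞ f u) :
    SmoothSectionAt A (fun w ↦ X w + f w • Y w) u :=
  ⟨contMDiffAt_along_add_smul hX.1 hY.1 hf,
    contMDiffAt_along_add_smul (V := TangentSpace (modelD EM VE)) (b := fun w ↦ w) hX.2 hY.2 hf⟩

theorem smoothSectionAt_zero [IsManifold 𝓘(ℝ, EN) ∞ N] [ContMDiffVectorBundle ∞ VF F 𝓘(ℝ, EN)]
    (u : DualSpace VE E) : SmoothSectionAt A (fun _ ↦ 0) u :=
  ⟨contMDiffAt_along_zero (A.h.contMDiff.comp contMDiff_dualProj).contMDiffAt,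
    contMDiffAt_along_zero (V := TangentSpace (modelD EM VE)) (b := fun w ↦ w) contMDiffAt_id⟩

theorem SmoothSectionAt.lieD {X : GenSection VE E A} {u : DualSpace VE E}
    (hX : SmoothSectionAt A X u) {f : DualSpace VE E → ℝ}
    (hf : ContMDiffAt (modelD EM VE) 𝓘(ℝ, ℝ) ∞ f u) :
    ContMDiffAt (modelD EM VE) 𝓘(ℝ, ℝ) ∞ (fun w ↦ lieD w (X w) f) u :=
  contMDiffAt_mfderiv_vectorField hX.2 hf

theorem DiffSectionAt.lieD {X : GenSection VE E A} {u : DualSpace VE E}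
    (hX : DiffSectionAt A X u) {f : DualSpace VE E → ℝ}
    (hf : ContMDiffAt (modelD EM VE) 𝓘(ℝ, ℝ) ∞ f u) :
    MDifferentiableAt (modelD EM VE) 𝓘(ℝ, ℝ) (fun w ↦ lieD w (X w) f) u :=
  mdifferentiableAt_mfderiv_vectorField hX.2 hf

namespace VectorChart

variable (c : VectorChart φ)

/-- The frame `t` of `F` in a trivialization, as a linear map `ℝⁿ → VF`. -/
def frameMap (x₀ x : M) : (Fin (Module.finrank ℝ VE) → ℝ) →L[ℝ] VF :=
  ∑ a, (ContinuousLinearMap.proj (R := ℝ) (φ := fun _ : Fin (Module.finrank ℝ VE) ↦ ℝ) a).smulRight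
    (trivializationAt VF F (A.h x₀) ⟨A.h x, c.t a (A.h x)⟩).2

/-- Over the domain of the chart, the inverse of the frame matrix computes the coordinates with
respect to the frame. -/
theorem frameMap_eq {x₀ x : M} (hx : x ∈ c.U)
    (hx' : A.h x ∈ (trivializationAt VF F (A.h x₀)).baseSet) :
    ∃ L : (Fin (Module.finrank ℝ VE) → ℝ) ≃L[ℝ] VF, c.frameMap x₀ x = L ∧
      ∀ z : F (A.h x), L.symm (trivializationAt VF F (A.h x₀) ⟨A.h x, z⟩).2
        = fun a ↦ c.coframe a x ((φ.equiv x).symm z) := by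
  let e := trivializationAt VF F (A.h x₀)
  let L₁ : (Fin (Module.finrank ℝ VE) → ℝ) ≃ₗ[ℝ] F (A.h x) :=
    { toFun := fun w ↦ ∑ a, w a • c.t a (A.h x)
      map_add' := fun w w' ↦ by simp [add_smul, Finset.sum_add_distrib]
      map_smul' := fun r w ↦ by simp [Finset.smul_sum, smul_smul]
      invFun := fun z a ↦ c.coframe a x ((φ.equiv x).symm z)
      left_inv := fun w ↦ by
        funext a
        simp [map_sum, c.coframe_t hx]
      right_inv := fun z ↦ (c.expand_F hx z).symm }
  let L₂ : F (A.h x) ≃ₗ[ℝ] VF := e.linearEquivAt ℝ (A.h x) hx'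
  refine ⟨(L₁.trans L₂).toContinuousLinearEquiv, ?_, fun z ↦ ?_⟩
  · ext w
    have h1 : L₂ (L₁ w) = ∑ a, w a • L₂ (c.t a (A.h x)) := by
      simp [L₁, map_sum]
    change c.frameMap x₀ x w = L₂ (L₁ w)
    rw [h1, frameMap]
    simp only [sum_apply, ContinuousLinearMap.smulRight_apply,
      ContinuousLinearMap.proj_apply]
    rfl
  · change L₁.symm (L₂.symm (L₂ z)) = _
    rw [L₂.symm_apply_apply]
    rfl

theorem contMDiffAt_frameMap_inverse [FiniteDimensional ℝ VE] {x₀ : M} (hx₀ : x₀ ∈ c.U) :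
    ContMDiffAt 𝓘(ℝ, EM) 𝓘(ℝ, VF →L[ℝ] (Fin (Module.finrank ℝ VE) → ℝ)) ∞
      (fun x ↦ (c.frameMap x₀ x).inverse) x₀ := by
  obtain ⟨L, hL, -⟩ := c.frameMap_eq hx₀ (mem_baseSet_trivializationAt VF F (A.h x₀))
  have h1 : ContMDiffAt 𝓘(ℝ, EM) 𝓘(ℝ, (Fin (Module.finrank ℝ VE) → ℝ) →L[ℝ] VF) ∞
      (fun x ↦ c.frameMap x₀ x) x₀ := by
    refine ContMDiffAt.sum fun a _ ↦ ?_
    have h2 := (contMDiffAt_totalSpace.1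
      (((c.t a).contMDiff.comp A.h.contMDiff).contMDiffAt (x := x₀))).2
    exact (ContinuousLinearMap.smulRightL ℝ (Fin (Module.finrank ℝ VE) → ℝ) VF
      (ContinuousLinearMap.proj a)).contMDiff.contMDiffAt.comp x₀ h2
  have h3 : ContDiffAt ℝ ∞ ContinuousLinearMap.inverse (c.frameMap x₀ x₀) := by
    have : CompleteSpace (Fin (Module.finrank ℝ VE) → ℝ) := inferInstance
    rw [hL]
    exact contDiffAt_map_inverse L
  exact h3.contMDiffAt.comp x₀ h1

section Along

variable {EP : Type*} [NormedAddCommGroup EP] [NormedSpace ℝ EP] {HP : Type*} [TopologicalSpace HP]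
  {IP : ModelWithCorners ℝ EP HP} {P : Type*} [TopologicalSpace P] [ChartedSpace HP P]

/-- The identification `φ` is not assumed to have a smooth inverse; the coordinates of sections of
`F` are smooth because they come from the inverse of the frame matrix. -/
theorem coframe_eventuallyEq {b : P → M} {p₀ : P} (hb₀ : b p₀ ∈ c.U) (hb : ContinuousAt b p₀)
    (z : ∀ p, F (A.h (b p))) (a : Fin (Module.finrank ℝ VE)) :
    (fun p ↦ c.coframe a (b p) ((φ.equiv (b p)).symm (z p))) =ᶠ[𝓝 p₀]
      fun p ↦ (c.frameMap (b p₀) (b p)).inverse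
        (trivializationAt VF F (A.h (b p₀)) ⟨A.h (b p), z p⟩).2 a := by
  have h1 : ∀ᶠ p in 𝓝 p₀, A.h (b p) ∈ (trivializationAt VF F (A.h (b p₀))).baseSet :=
    (A.h.continuous.continuousAt.comp hb)
      ((trivializationAt VF F (A.h (b p₀))).open_baseSet.mem_nhds
        (mem_baseSet_trivializationAt VF F (A.h (b p₀))))
  filter_upwards [hb (c.isOpen.mem_nhds hb₀), h1] with p hp hp'
  obtain ⟨L, hL, hL'⟩ := c.frameMap_eq hp hp'
  rw [hL, ContinuousLinearMap.inverse_equiv]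
  exact (congrFun (hL' (z p)) a).symm

/-- The coordinates of a smooth section of `F` along `h ∘ b` are smooth. -/
theorem contMDiffAt_coframe [FiniteDimensional ℝ VE] {b : P → M} {p₀ : P} (hb₀ : b p₀ ∈ c.U)
    (hb : ContMDiffAt IP 𝓘(ℝ, EM) ∞ b p₀) {z : ∀ p, F (A.h (b p))}
    (hz : ContMDiffAt IP (𝓘(ℝ, EN).prod 𝓘(ℝ, VF)) ∞
      (fun p ↦ (⟨A.h (b p), z p⟩ : TotalSpace VF F)) p₀) (a : Fin (Module.finrank ℝ VE)) :
    ContMDiffAt IP 𝓘(ℝ, ℝ) ∞ (fun p ↦ c.coframe a (b p) ((φ.equiv (b p)).symm (z p))) p₀ := by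
  refine ContMDiffAt.congr_of_eventuallyEq ?_ (c.coframe_eventuallyEq hb₀ hb.continuousAt z a)
  have h1 := ContMDiffAt.clm_apply ((c.contMDiffAt_frameMap_inverse hb₀).comp p₀ hb)
    (contMDiffAt_totalSpace.1 hz).2
  exact (ContinuousLinearMap.proj (R := ℝ) (φ := fun _ : Fin (Module.finrank ℝ VE) ↦ ℝ)
    a).contMDiff.contMDiffAt.comp p₀ h1

theorem mdifferentiableAt_coframe [FiniteDimensional ℝ VE] {b : P → M} {p₀ : P}
    (hb₀ : b p₀ ∈ c.U) (hb : ContMDiffAt IP 𝓘(ℝ, EM) ∞ b p₀) {z : ∀ p, F (A.h (b p))}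
    (hz : MDifferentiableAt IP (𝓘(ℝ, EN).prod 𝓘(ℝ, VF))
      (fun p ↦ (⟨A.h (b p), z p⟩ : TotalSpace VF F)) p₀) (a : Fin (Module.finrank ℝ VE)) :
    MDifferentiableAt IP 𝓘(ℝ, ℝ) (fun p ↦ c.coframe a (b p) ((φ.equiv (b p)).symm (z p))) p₀ := by
  refine MDifferentiableAt.congr_of_eventuallyEq ?_
    (c.coframe_eventuallyEq hb₀ hb.continuousAt z a)
  have h1 := MDifferentiableAt.clm_apply
    (((c.contMDiffAt_frameMap_inverse hb₀).comp p₀ hb).mdifferentiableAt (by simp))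
    ((mdifferentiableAt_totalSpace _ _).1 hz).2
  exact ((ContinuousLinearMap.proj (R := ℝ) (φ := fun _ : Fin (Module.finrank ℝ VE) ↦ ℝ)
    a).contMDiff.mdifferentiableAt (n := 1) (by simp)).comp p₀ h1

end Along

theorem contMDiffAt_dz [FiniteDimensional ℝ VE] {u : DualSpace VE E} (hu : u.proj ∈ c.U)
    {X : GenSection VE E A} (hX : SmoothSectionAt A X u) (a : Fin (Module.finrank ℝ VE)) :
    ContMDiffAt (modelD EM VE) 𝓘(ℝ, ℝ) ∞ (fun w ↦ c.dz a w (X w)) u :=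
  c.contMDiffAt_coframe (b := TotalSpace.proj) hu contMDiff_dualProj.contMDiffAt hX.1 a

theorem mdifferentiableAt_dz [FiniteDimensional ℝ VE] {u : DualSpace VE E} (hu : u.proj ∈ c.U)
    {X : GenSection VE E A} (hX : DiffSectionAt A X u) (a : Fin (Module.finrank ℝ VE)) :
    MDifferentiableAt (modelD EM VE) 𝓘(ℝ, ℝ) (fun w ↦ c.dz a w (X w)) u :=
  c.mdifferentiableAt_coframe (b := TotalSpace.proj) hu contMDiff_dualProj.contMDiffAt hX.1 a

theorem contMDiffAt_strFun [FiniteDimensional ℝ VE] {u : DualSpace VE E} (hu : u.proj ∈ c.U)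
    (a b d : Fin (Module.finrank ℝ VE)) :
    ContMDiffAt (modelD EM VE) 𝓘(ℝ, ℝ) ∞ (fun w ↦ c.strFun a b d w.proj) u :=
  c.contMDiffAt_coframe (b := TotalSpace.proj) hu contMDiff_dualProj.contMDiffAt
    ((A.bracket (c.t b) (c.t d)).contMDiff.comp
      (A.h.contMDiff.comp contMDiff_dualProj)).contMDiffAt a

variable [FiniteDimensional ℝ EN] [T2Space N] [IsManifold 𝓘(ℝ, EN) ∞ N]
  [ContMDiffVectorBundle ∞ VF F 𝓘(ℝ, EN)]

/-- A smooth lift `v` of the anchor of `t_a` gives a smooth section `(t_a, v)` of the generalized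
tangent bundle; its horizontal part is `δ_a`. -/
theorem smoothSectionAt_delta (a : Fin (Module.finrank ℝ VE)) (u : DualSpace VE E) :
    SmoothSectionAt A (c.delta Γ a) u := by
  classical
  obtain ⟨v, O, hO, hu, hlift, hv⟩ := exists_smooth_lift u (A.contMDiff_anchorVal (c.t a))
  have hmem : ∀ w ∈ O, ((c.t a (A.h w.proj), v w) : F (A.h w.proj) × TangentSpace (modelD EM VE) w)
      ∈ GenTangent VE E A w := fun w hw ↦
    (hlift w hw).trans (A.anchorAt_apply (c.t a) w.proj).symm
  let X : GenSection VE E A := fun w ↦ if hw : w ∈ O then ⟨_, hmem w hw⟩ else 0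
  have hXO : ∀ w (hw : w ∈ O), X w = ⟨_, hmem w hw⟩ := fun w hw ↦ dif_pos hw
  have hX : SmoothSectionOn A X O := by
    refine ⟨?_, hv.congr fun w hw ↦ by rw [hXO w hw]⟩
    refine ((c.t a).contMDiff.comp (A.h.contMDiff.comp contMDiff_dualProj)).contMDiffOn.congr
      fun w hw ↦ ?_
    rw [hXO w hw]
    rfl
  have h1 := (hX.smoothSectionAt hO hu).add_smul ((Γ.smooth X O hO hX).smoothSectionAt hO hu)
    (contMDiffAt_const (c := (-1 : ℝ)))
  refine h1.congr ?_
  filter_upwards [hO.mem_nhds hu] with w hw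
  have key : ∀ Y : GenTangent VE E A w, Γ.hlift w Y.1.1 = Y + (-1 : ℝ) • Γ.proj w Y := fun Y ↦ by
    have h3 : (-1 : ℝ) • Γ.proj w Y = -Γ.proj w Y :=
      neg_one_smul (R := ℝ) (M := GenTangent VE E A w) _
    rw [h3, Γ.proj_eq_sub_hlift, neg_sub, add_sub_cancel]
  have h2 := key (X w)
  rw [hXO w hw] at h2 ⊢
  exact h2

theorem smoothSectionAt_vert (a : Fin (Module.finrank ℝ VE)) (u : DualSpace VE E) :
    SmoothSectionAt A (c.vert a) u :=
  ⟨contMDiffAt_along_zero (A.h.contMDiff.comp contMDiff_dualProj).contMDiffAt,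
    (contMDiff_vlift (c.coframe a)) u⟩

theorem smoothSectionAt_comb {u : DualSpace VE E}
    {f g : Fin (Module.finrank ℝ VE) → DualSpace VE E → ℝ}
    (hf : ∀ a, ContMDiffAt (modelD EM VE) 𝓘(ℝ, ℝ) ∞ (f a) u)
    (hg : ∀ a, ContMDiffAt (modelD EM VE) 𝓘(ℝ, ℝ) ∞ (g a) u) :
    SmoothSectionAt A (fun w ↦ c.comb Γ w (fun a ↦ f a w) (fun a ↦ g a w)) u := by
  have key : ∀ (s : Finset (Fin (Module.finrank ℝ VE)))
      (k : Fin (Module.finrank ℝ VE) → DualSpace VE E → ℝ)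
      (_ : ∀ a, ContMDiffAt (modelD EM VE) 𝓘(ℝ, ℝ) ∞ (k a) u)
      (Y : Fin (Module.finrank ℝ VE) → GenSection VE E A) (_ : ∀ a, SmoothSectionAt A (Y a) u),
      SmoothSectionAt A (fun w ↦ ∑ a ∈ s, k a w • Y a w) u := by
    intro s k hk Y hY
    classical
    induction s using Finset.induction_on with
    | empty => simpa using smoothSectionAt_zero u
    | insert i s hi ih =>
      simp only [Finset.sum_insert hi, add_comm (k i _ • Y i _)]
      exact ih.add_smul (hY i) (hk i)
  have h1 := (key Finset.univ f hf _ fun a ↦ c.smoothSectionAt_delta (Γ := Γ) a u).add_smul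
    (key Finset.univ g hg _ fun a ↦ c.smoothSectionAt_vert a u) (contMDiffAt_const (c := (1 : ℝ)))
  simp only [one_smul] at h1
  exact h1

/-- By `deltap_eq`, `δp_a(X)` is a combination of derivatives of `p_a`, which avoids the projection
of a section that is smooth at a single point only. -/
theorem contMDiffAt_deltap [FiniteDimensional ℝ VE] {u : DualSpace VE E} (hu : u.proj ∈ c.U)
    {X : GenSection VE E A} (hX : SmoothSectionAt A X u) (a : Fin (Module.finrank ℝ VE)) :
    ContMDiffAt (modelD EM VE) 𝓘(ℝ, ℝ) ∞ (fun w ↦ c.deltap Γ a w (X w)) u := by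
  have hp := (contMDiff_dual_apply (EM := EM) (c.s a)).contMDiffAt (x := u)
  have h1 := (hX.lieD hp).sub (ContMDiffAt.sum (t := Finset.univ) fun b _ ↦
    (c.contMDiffAt_dz hu hX b).mul ((c.smoothSectionAt_delta (Γ := Γ) b u).lieD hp))
  refine h1.congr_of_eventuallyEq ?_
  filter_upwards [(contMDiff_dualProj (EM := EM) (VE := VE) (E := E)).continuous.continuousAt
    (c.isOpen.mem_nhds hu)] with w hw
  simpa using! c.deltap_eq hw a (X w)

theorem mdifferentiableAt_deltap [FiniteDimensional ℝ VE] {u : DualSpace VE E} (hu : u.proj ∈ c.U)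
    {X : GenSection VE E A} (hX : DiffSectionAt A X u) (a : Fin (Module.finrank ℝ VE)) :
    MDifferentiableAt (modelD EM VE) 𝓘(ℝ, ℝ) (fun w ↦ c.deltap Γ a w (X w)) u := by
  have hp := (contMDiff_dual_apply (EM := EM) (c.s a)).contMDiffAt (x := u)
  have h1 := (hX.lieD hp).sub (lieD_sum Finset.univ u (0 : GenTangent VE E A u) fun b ↦
    (c.mdifferentiableAt_dz hu hX b).mul
      (((c.smoothSectionAt_delta (Γ := Γ) b u).lieD hp).mdifferentiableAt (by simp))).1
  refine h1.congr_of_eventuallyEq ?_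
  filter_upwards [(contMDiff_dualProj (EM := EM) (VE := VE) (E := E)).continuous.continuousAt
    (c.isOpen.mem_nhds hu)] with w hw
  exact c.deltap_eq hw a (X w)

end VectorChart

end Regularity

/-! ### Existence of vector charts -/

section ChartExistence

variable {EM : Type*} [NormedAddCommGroup EM] [NormedSpace ℝ EM]
  {M : Type*} [TopologicalSpace M] [ChartedSpace EM M] [IsManifold 𝓘(ℝ, EM) ∞ M]
  {EN : Type*} [NormedAddCommGroup EN] [NormedSpace ℝ EN]
  {N : Type*} [TopologicalSpace N] [ChartedSpace EN N]
  {VF : Type*} [NormedAddCommGroup VF] [NormedSpace ℝ VF]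
  {F : N → Type*} [∀ y, AddCommGroup (F y)] [∀ y, Module ℝ (F y)]
  [∀ y, TopologicalSpace (F y)] [TopologicalSpace (TotalSpace VF F)]
  [FiberBundle VF F] [VectorBundle ℝ VF F]
  {VE : Type*} [NormedAddCommGroup VE] [NormedSpace ℝ VE]
  {E : M → Type*} [∀ x, AddCommGroup (E x)] [∀ x, Module ℝ (E x)]
  [∀ x, TopologicalSpace (E x)] [TopologicalSpace (TotalSpace VE E)]
  [FiberBundle VE E] [VectorBundle ℝ VE E] [ContMDiffVectorBundle ∞ VE E 𝓘(ℝ, EM)]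
  {A : GenLieAlgebroid EM M EN VF F} {φ : BundleIdent VE E A} {Γ : NonlinConnection VE E A}

/-- The trivialization of the dual bundle is dual to that of `E`. -/
theorem snd_dualTriv_apply {x₀ x : M} (hx : x ∈ (trivializationAt VE E x₀).baseSet)
    (q : E x →L[ℝ] ℝ) (v : VE) :
    (dualTriv VE E x₀ ⟨x, q⟩).2 v = q ((trivializationAt VE E x₀).symm x v) := by
  have h := hom_trivializationAt_apply (σ := RingHom.id ℝ) (F₁ := VE) (E₁ := E) (F₂ := ℝ)
    (E₂ := Bundle.Trivial M ℝ) x₀ ⟨x, q⟩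
  refine (congrArg (fun z ↦ z.2 v) h).trans ?_
  change ContinuousLinearMap.inCoordinates VE E ℝ (Bundle.Trivial M ℝ) x₀ x x₀ x q v = _
  rw [ContinuousLinearMap.inCoordinates_eq hx (by simp [Bundle.Trivial.trivialization])]
  simp

variable (φ) in
/-- Every point of `M` has a vector chart. -/
theorem VectorChart.exists_mem [FiniteDimensional ℝ EM] [T2Space M] [FiniteDimensional ℝ VE]
    (x₀ : M) : ∃ c : VectorChart φ, x₀ ∈ c.U := by
  let e := trivializationAt VE E x₀
  let e' := dualTriv VE E x₀
  let β := Module.finBasis ℝ VE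
  have he : x₀ ∈ e.baseSet := mem_baseSet_trivializationAt VE E x₀
  have he' : x₀ ∈ e'.baseSet := mem_baseSet_trivializationAt _ _ x₀
  obtain ⟨τ, hτ⟩ := exists_section_eq_symm (EB := EM) e he
  obtain ⟨κ, hκ⟩ := exists_section_eq_symm (EB := EM) e' he'
  obtain ⟨U, hU, hUo, hxU⟩ := eventually_nhds_iff.1
    (((hτ.and hκ).and (e.open_baseSet.mem_nhds he)).and (e'.open_baseSet.mem_nhds he'))
  let co : Fin (Module.finrank ℝ VE) → (VE →L[ℝ] ℝ) := fun a ↦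
    LinearMap.toContinuousLinearMap (β.coord a)
  have hs : ∀ x (hx : x ∈ U) a, τ (β a) x = (e.linearEquivAt ℝ x (hU x hx).1.2).symm (β a) :=
    fun x hx a ↦ (hU x hx).1.1.1 (β a)
  refine ⟨{ U := U, isOpen := hUo, s := fun a ↦ τ (β a), coframe := fun a ↦ κ (co a)
            t := fun a ↦ ⟨fun y ↦
              A.h.apply_symm_apply y ▸ φ.equiv (A.h.symm y) (τ (β a) (A.h.symm y)), ?_⟩
            span := fun x hx ↦ ?_
            dual := fun x hx a b ↦ ?_
            corr := fun x hx a ↦ ?_ }, hxU⟩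
  · have h := φ.smooth.comp ((τ (β a)).contMDiff.comp A.h.symm.contMDiff)
    refine h.congr fun y ↦ ?_
    have key : ∀ y' (e : y' = y) (v : F y'), (⟨y, e ▸ v⟩ : TotalSpace VF F) = ⟨y', v⟩ := by
      rintro y' rfl v; rfl
    exact key _ _ _
  · have h1 : (range fun a ↦ τ (β a) x)
        = (e.linearEquivAt ℝ x (hU x hx).1.2).symm '' range β := by
      rw [← range_comp]
      exact congrArg range (funext fun a ↦ hs x hx a)
    rw [h1, ← LinearEquiv.coe_coe, Submodule.span_image, β.span_eq, Submodule.map_top,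
      LinearEquiv.range]
  · have h1 : e'.symm x (co a) = κ (co a) x := ((hU x hx).1.1.2 (co a)).symm
    have h2 : (e' ⟨x, e'.symm x (co a)⟩).2 = co a :=
      congrArg Prod.snd (e'.apply_mk_symm (hU x hx).2 (co a))
    rw [(hU x hx).1.1.1 (β b), ← snd_dualTriv_apply (hU x hx).1.2, ← h1]
    refine (DFunLike.congr_fun h2 (β b)).trans ?_
    simp [co, Finsupp.single_apply, eq_comm]
  · have key : ∀ x' (e : A.h x' = A.h x),
        (e ▸ φ.equiv x' (τ (β a) x') : F (A.h x)) = φ.equiv x (τ (β a) x) := by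
      intro x' e'
      obtain rfl := A.h.injective e'
      rfl
    exact key _ _

end ChartExistence

/-! ### The algebra of the Koszul formula -/

section Koszul

variable {ι : Type*} [Fintype ι]

/-- The Koszul formula: the solution `H^a_{bd}` of the system `H^a_{bd} - H^a_{db} = W^a_{bd}`,
`dg_{abd} = g_{eb} H^e_{ad} + g_{ae} H^e_{bd}`, where `k` is the inverse of the matrix `g`. -/
def koszul (g k : ι → ι → ℝ) (dg W : ι → ι → ι → ℝ) (a b d : ι) : ℝ :=
  (1 / 2) * ∑ e, k a e * (dg e d b + dg b e d - dg b d e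
    + ∑ j, g e j * W j b d - ∑ j, g b j * W j e d + ∑ j, g d j * W j b e)

theorem sum_mul_mul_eq [DecidableEq ι] {g k : ι → ι → ℝ}
    (hgk : ∀ a b, ∑ e, g a e * k e b = if a = b then 1 else 0) (a : ι) (X : ι → ℝ) :
    ∑ e, g a e * ∑ j, k e j * X j = X a := by
  simp only [Finset.mul_sum, ← mul_assoc]
  rw [Finset.sum_comm]
  simp only [← Finset.sum_mul, hgk]
  simp

/-- A right inverse of a square matrix is a left inverse. -/
theorem sum_mul_eq_comm [DecidableEq ι] {g k : ι → ι → ℝ}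
    (hgk : ∀ a b, ∑ e, g a e * k e b = if a = b then 1 else 0) (a b : ι) :
    ∑ e, k a e * g e b = if a = b then 1 else 0 := by
  have h : Matrix.of g * Matrix.of k = 1 := by
    ext i j
    simp [Matrix.mul_apply, hgk, Matrix.one_apply]
  have h1 : Matrix.of k * Matrix.of g = 1 := mul_eq_one_comm.1 h
  have h' := congrFun (congrFun h1 a) b
  simpa [Matrix.mul_apply, Matrix.one_apply] using h'

variable [DecidableEq ι] {g k : ι → ι → ℝ} {dg W : ι → ι → ι → ℝ}

theorem sum_mul_koszul (hgk : ∀ a b, ∑ e, g a e * k e b = if a = b then 1 else 0) (a b d : ι) :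
    ∑ e, g a e * koszul g k dg W e b d
      = (1 / 2) * (dg a d b + dg b a d - dg b d a
        + ∑ j, g a j * W j b d - ∑ j, g b j * W j a d + ∑ j, g d j * W j b a) := by
  simp only [koszul, mul_left_comm (g a _) (1 / 2 : ℝ), ← Finset.mul_sum]
  rw [sum_mul_mul_eq hgk]

theorem sum_mul_skew (hW : ∀ a b d, W a b d = -W a d b) (a b d : ι) :
    ∑ j, g a j * W j b d = -∑ j, g a j * W j d b := by
  rw [← Finset.sum_neg_distrib]
  exact Finset.sum_congr rfl fun j _ ↦ by rw [hW j b d, mul_neg]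

/-- The skew part of the solution is the prescribed torsion `W`. -/
theorem koszul_sub (hgk : ∀ a b, ∑ e, g a e * k e b = if a = b then 1 else 0)
    (hdg : ∀ a b c, dg a b c = dg b a c) (hW : ∀ a b d, W a b d = -W a d b) (a b d : ι) :
    koszul g k dg W a b d - koszul g k dg W a d b = W a b d := by
  have key : ∀ e, ∑ j, g e j * (koszul g k dg W j b d - koszul g k dg W j d b)
      = ∑ j, g e j * W j b d := fun e ↦ by
    simp only [mul_sub, Finset.sum_sub_distrib, sum_mul_koszul hgk]
    rw [sum_mul_skew hW e d b, sum_mul_skew hW d e b, sum_mul_skew hW b e d, hdg e d b,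
      hdg b e d, hdg b d e]
    ring
  have h := congrArg (fun X : ι → ℝ ↦ ∑ e, k a e * X e) (funext key)
  simpa only [sum_mul_mul_eq (sum_mul_eq_comm hgk) a
    (fun j ↦ koszul g k dg W j b d - koszul g k dg W j d b),
    sum_mul_mul_eq (sum_mul_eq_comm hgk) a (fun j ↦ W j b d)] using h

/-- The solution preserves `g`. -/
theorem koszul_metric (hgk : ∀ a b, ∑ e, g a e * k e b = if a = b then 1 else 0)
    (hg : ∀ a b, g a b = g b a)
    (hdg : ∀ a b c, dg a b c = dg b a c) (hW : ∀ a b d, W a b d = -W a d b) (a b c : ι) :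
    dg a b c = ∑ e, g e b * koszul g k dg W e a c + ∑ e, g a e * koszul g k dg W e b c := by
  simp only [hg _ b, sum_mul_koszul hgk]
  rw [sum_mul_skew hW c a b, hdg b c a, hdg b a c, hdg a c b]
  ring

/-- Uniqueness: the skew part and the metric condition determine `H`. -/
theorem eq_koszul (hgk : ∀ a b, ∑ e, g a e * k e b = if a = b then 1 else 0)
    (hg : ∀ a b, g a b = g b a) {H : ι → ι → ι → ℝ}
    (hH : ∀ a b d, H a b d - H a d b = W a b d)
    (hm : ∀ a b c, dg a b c = ∑ e, g e b * H e a c + ∑ e, g a e * H e b c) (a b d : ι) :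
    H a b d = koszul g k dg W a b d := by
  have hw : ∀ e b d, ∑ j, g e j * W j b d = ∑ j, g e j * H j b d - ∑ j, g e j * H j d b :=
    fun e b d ↦ by simp only [← hH, mul_sub, Finset.sum_sub_distrib]
  have h := sum_mul_mul_eq (sum_mul_eq_comm hgk) a (fun j ↦ H j b d)
  rw [← h, koszul, Finset.mul_sum]
  refine Finset.sum_congr rfl fun e _ ↦ ?_
  simp only [hw, hm, hg _ d, hg _ e]
  ring

end Koszul

section MetricMatrix

open Matrix

variable {ι : Type*} [Fintype ι] [DecidableEq ι]

/-- `Ω` preserves a bilinear form, in the sense that `dg = Ωᵀ g + g Ω`, if and only if its negative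
transpose preserves the inverse form. -/
theorem metric_inverse_iff {g k dg dk Ω : Matrix ι ι ℝ} (hgk : g * k = 1)
    (hd : dg * k + g * dk = 0) :
    dg = Ωᵀ * g + g * Ω ↔ dk = -(k * Ωᵀ + Ω * k) := by
  have hkg : k * g = 1 := mul_eq_one_comm.1 hgk
  refine ⟨fun h ↦ ?_, fun h ↦ ?_⟩
  · have h1 : dk = k * (g * dk) := by rw [← mul_assoc, hkg, one_mul]
    rw [h1, eq_neg_of_add_eq_zero_right hd, h, add_mul, mul_assoc, hgk, mul_one, mul_neg, mul_add,
      mul_assoc g, ← mul_assoc k g, hkg, one_mul]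
  · have h1 : dg = dg * k * g := by rw [mul_assoc, hkg, mul_one]
    rw [h1, eq_neg_of_add_eq_zero_left hd, h, mul_neg, neg_neg, mul_add, add_mul, ← mul_assoc, hgk,
      one_mul, mul_assoc g, mul_assoc Ω, hkg, mul_one]

/-- The product rule for the values of a bilinear form which is preserved by `Ω`. -/
theorem metric_product_rule {g Ω : Matrix ι ι ℝ} (y y' z z' : ι → ℝ) :
    y ⬝ᵥ (Ωᵀ * g + g * Ω) *ᵥ z + y' ⬝ᵥ g *ᵥ z + y ⬝ᵥ g *ᵥ z'
      = (y' + Ω *ᵥ y) ⬝ᵥ g *ᵥ z + y ⬝ᵥ g *ᵥ (z' + Ω *ᵥ z) := by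
  rw [add_mulVec, dotProduct_add, add_dotProduct, mulVec_add, dotProduct_add, ← mulVec_mulVec,
    ← mulVec_mulVec, dotProduct_mulVec y Ωᵀ, vecMul_transpose]
  ring

end MetricMatrix

/-! ### The local connection form -/

section ConnectionForm

open Matrix

variable {EM : Type*} [NormedAddCommGroup EM] [NormedSpace ℝ EM]
  {M : Type*} [TopologicalSpace M] [ChartedSpace EM M] [IsManifold 𝓘(ℝ, EM) ∞ M]
  {EN : Type*} [NormedAddCommGroup EN] [NormedSpace ℝ EN]
  {N : Type*} [TopologicalSpace N] [ChartedSpace EN N]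
  {VF : Type*} [NormedAddCommGroup VF] [NormedSpace ℝ VF]
  {F : N → Type*} [∀ y, AddCommGroup (F y)] [∀ y, Module ℝ (F y)]
  [∀ y, TopologicalSpace (F y)] [TopologicalSpace (TotalSpace VF F)]
  [FiberBundle VF F] [VectorBundle ℝ VF F]
  {VE : Type*} [NormedAddCommGroup VE] [NormedSpace ℝ VE]
  {E : M → Type*} [∀ x, AddCommGroup (E x)] [∀ x, Module ℝ (E x)]
  [∀ x, TopologicalSpace (E x)] [TopologicalSpace (TotalSpace VE E)]
  [FiberBundle VE E] [VectorBundle ℝ VE E] [ContMDiffVectorBundle ∞ VE E 𝓘(ℝ, EM)]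
  {A : GenLieAlgebroid EM M EN VF F} {φ : BundleIdent VE E A} {Γ : NonlinConnection VE E A}

/-- A bilinear form for which the families `e` and `e'` are orthogonal. -/
theorem bilin_sum_add_sum {ι V : Type*} [Fintype ι] [AddCommGroup V] [Module ℝ V]
    (B : V →ₗ[ℝ] V →ₗ[ℝ] ℝ) (e e' : ι → V) (h : ∀ a b, B (e a) (e' b) = 0)
    (h' : ∀ a b, B (e' a) (e b) = 0) (f g f' g' : ι → ℝ) :
    B (∑ a, f a • e a + ∑ a, g a • e' a) (∑ a, f' a • e a + ∑ a, g' a • e' a)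
      = f ⬝ᵥ (of fun a b ↦ B (e a) (e b)) *ᵥ f' + g ⬝ᵥ (of fun a b ↦ B (e' a) (e' b)) *ᵥ g' := by
  simp [dotProduct, mulVec, h, h', Finset.mul_sum, mul_comm]

namespace VectorChart

variable (c : VectorChart φ)

/-- The vector of the coordinates `dz^a(X)`. -/
def dzVec (u : DualSpace VE E) (X : GenTangent VE E A u) : Fin (Module.finrank ℝ VE) → ℝ :=
  fun a ↦ c.dz a u X

/-- The vector of the coordinates `δp_a(X)`. -/
def dpVec (Γ : NonlinConnection VE E A) (u : DualSpace VE E) (X : GenTangent VE E A u) :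
    Fin (Module.finrank ℝ VE) → ℝ :=
  fun a ↦ c.deltap Γ a u X

theorem strFun_skew (a b d : Fin (Module.finrank ℝ VE)) (x : M) :
    c.strFun a b d x = -c.strFun a d b x := by
  rw [strFun, A.bracket_skew, strFun, ← map_neg, ← map_neg]
  rfl

/-- A linear map is determined by its values on the adapted base. -/
theorem linearMap_ext {V : Type*} [AddCommGroup V] [Module ℝ V] {u : DualSpace VE E}
    (hu : u.proj ∈ c.U) {f g : GenTangent VE E A u →ₗ[ℝ] V}
    (h : ∀ a, f (c.delta Γ a u) = g (c.delta Γ a u)) (h' : ∀ a, f (c.vert a u) = g (c.vert a u)) :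
    f = g := by
  ext1 X
  have hX := c.eq_comb (Γ := Γ) hu X
  refine (congrArg f hX).trans (Eq.trans ?_ (congrArg g hX).symm)
  simp only [comb, map_add, map_sum, map_smul, h, h']

end VectorChart

theorem tensorH_skew {T : GenTensor VE E A} (hT : ∀ u X Y, T u X Y = -T u Y X)
    (c : VectorChart φ) (a b d : Fin (Module.finrank ℝ VE)) (u : DualSpace VE E) :
    tensorH Γ T c a b d u = -tensorH Γ T c a d b u := by
  rw [tensorH, hT, ← VectorChart.dzLin_apply, map_neg]
  rfl

theorem tensorV_skew {S : GenTensor VE E A} (hS : ∀ u X Y, S u X Y = -S u Y X)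
    (c : VectorChart φ) (a d b : Fin (Module.finrank ℝ VE)) (u : DualSpace VE E) :
    tensorV Γ S c a d b u = -tensorV Γ S c d a b u := by
  rw [tensorV, hS, ← VectorChart.deltapLin_apply, map_neg]
  rfl

namespace PseudoMetric

variable (G : PseudoMetric Γ) (c : VectorChart φ)

/-- The matrix of the horizontal part of the metric. -/
def lowMat (u : DualSpace VE E) :
    Matrix (Fin (Module.finrank ℝ VE)) (Fin (Module.finrank ℝ VE)) ℝ :=
  of fun a b ↦ G.low c a b u

/-- The matrix of the vertical part of the metric. -/
def upMat (u : DualSpace VE E) :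
    Matrix (Fin (Module.finrank ℝ VE)) (Fin (Module.finrank ℝ VE)) ℝ :=
  of fun a b ↦ G.up c a b u

theorem low_symm (a b : Fin (Module.finrank ℝ VE)) : G.low c a b = G.low c b a :=
  funext fun _ ↦ G.symm _ _ _

theorem up_symm (a b : Fin (Module.finrank ℝ VE)) : G.up c a b = G.up c b a :=
  funext fun _ ↦ G.symm _ _ _

/-- The metric in the adapted base of a vector chart. -/
theorem form_eq {u : DualSpace VE E} (hu : u.proj ∈ c.U) (X Z : GenTangent VE E A u) :
    G.form u X Z = c.dzVec u X ⬝ᵥ G.lowMat c u *ᵥ c.dzVec u Z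
      + c.dpVec Γ u X ⬝ᵥ G.upMat c u *ᵥ c.dpVec Γ u Z := by
  have h1 : ∀ a b, G.form u (c.vert a u) (c.delta Γ b u) = 0 := fun a b ↦
    G.mixed u _ _ rfl (c.proj_delta u b)
  have h2 : ∀ a b, G.form u (c.delta Γ a u) (c.vert b u) = 0 := fun a b ↦
    (G.symm u _ _).trans (h1 b a)
  have key : ∀ f g f' g', G.form u (c.comb Γ u f g) (c.comb Γ u f' g')
      = f ⬝ᵥ G.lowMat c u *ᵥ f' + g ⬝ᵥ G.upMat c u *ᵥ g' :=
    bilin_sum_add_sum (G.form u) _ _ h2 h1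
  exact (congrArg₂ (fun Y Y' ↦ G.form u Y Y') (c.eq_comb (Γ := Γ) hu X)
    (c.eq_comb (Γ := Γ) hu Z)).trans (key _ _ _ _)

theorem lowMat_mul_upMat (hG : G.DeterminedByVertical φ) {u : DualSpace VE E}
    (hu : u.proj ∈ c.U) : G.lowMat c u * G.upMat c u = 1 := by
  ext a b
  simp [Matrix.mul_apply, lowMat, upMat, hG c u hu, Matrix.one_apply]

end PseudoMetric

section Smoothness

variable [FiniteDimensional ℝ EN] [T2Space N] [IsManifold 𝓘(ℝ, EN) ∞ N]
  [ContMDiffVectorBundle ∞ VF F 𝓘(ℝ, EN)] (G : PseudoMetric Γ) (c : VectorChart φ)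

theorem smoothSectionOn_delta (a : Fin (Module.finrank ℝ VE)) :
    SmoothSectionOn A (c.delta Γ a) univ :=
  smoothSectionOn_of_forall fun u _ ↦ c.smoothSectionAt_delta a u

theorem smoothSectionOn_vert (a : Fin (Module.finrank ℝ VE)) :
    SmoothSectionOn A (c.vert a) univ :=
  smoothSectionOn_of_forall fun u _ ↦ c.smoothSectionAt_vert a u

theorem contMDiffAt_low (a b : Fin (Module.finrank ℝ VE)) (u : DualSpace VE E) :
    ContMDiffAt (modelD EM VE) 𝓘(ℝ, ℝ) ∞ (G.low c a b) u :=
  (G.smooth _ _ univ isOpen_univ (smoothSectionOn_delta c a)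
    (smoothSectionOn_delta c b)).contMDiffAt Filter.univ_mem

theorem contMDiffAt_up (a b : Fin (Module.finrank ℝ VE)) (u : DualSpace VE E) :
    ContMDiffAt (modelD EM VE) 𝓘(ℝ, ℝ) ∞ (G.up c a b) u :=
  (G.smooth _ _ univ isOpen_univ (smoothSectionOn_vert c a)
    (smoothSectionOn_vert c b)).contMDiffAt Filter.univ_mem

variable [FiniteDimensional ℝ VE]

theorem contMDiffAt_tensorH {T : GenTensor VE E A} (hT : IsHTensor Γ T) {u : DualSpace VE E}
    (hu : u.proj ∈ c.U) (a b d : Fin (Module.finrank ℝ VE)) :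
    ContMDiffAt (modelD EM VE) 𝓘(ℝ, ℝ) ∞ (tensorH Γ T c a b d) u :=
  c.contMDiffAt_dz hu ((hT.smooth _ _ univ isOpen_univ (smoothSectionOn_delta c b)
    (smoothSectionOn_delta c d)).smoothSectionAt isOpen_univ (mem_univ u)) a

theorem contMDiffAt_tensorV {S : GenTensor VE E A} (hS : IsVTensor Γ S) {u : DualSpace VE E}
    (hu : u.proj ∈ c.U) (a d b : Fin (Module.finrank ℝ VE)) :
    ContMDiffAt (modelD EM VE) 𝓘(ℝ, ℝ) ∞ (tensorV Γ S c a d b) u :=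
  c.contMDiffAt_deltap hu ((hS.smooth _ _ univ isOpen_univ (smoothSectionOn_vert c a)
    (smoothSectionOn_vert c d)).smoothSectionAt isOpen_univ (mem_univ u)) b

theorem contMDiffAt_modifiedH {T : GenTensor VE E A} (hT : IsHTensor Γ T) {u : DualSpace VE E}
    (hu : u.proj ∈ c.U) (a b d : Fin (Module.finrank ℝ VE)) :
    ContMDiffAt (modelD EM VE) 𝓘(ℝ, ℝ) ∞ (modifiedH G T c a b d) u := by
  have hl := fun a b ↦ contMDiffAt_low G c a b u
  have hk := fun a b ↦ contMDiffAt_up G c a b u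
  have ht := contMDiffAt_tensorH c hT hu
  have hL := c.contMDiffAt_strFun hu
  have hd := fun e a b ↦ (c.smoothSectionAt_delta (Γ := Γ) e u).lieD (hl a b)
  unfold modifiedH leviCivitaH
  refine (contMDiffAt_const.mul (ContMDiffAt.sum fun e _ ↦ (hk a e).mul
    ((((((hd b e d).add (hd d b e)).sub (hd e b d)).sub (ContMDiffAt.sum fun j _ ↦
      (hl d j).mul (hL j b e))).add (ContMDiffAt.sum fun j _ ↦
      (hl b j).mul (hL j e d))).sub (ContMDiffAt.sum fun j _ ↦
      (hl e j).mul (hL j b d))))).add (contMDiffAt_const.mul (ContMDiffAt.sum fun e _ ↦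
      (hk a e).mul (((ContMDiffAt.sum fun j _ ↦ (hl e j).mul (ht j b d)).sub
        (ContMDiffAt.sum fun j _ ↦ (hl b j).mul (ht j e d))).add
        (ContMDiffAt.sum fun j _ ↦ (hl d j).mul (ht j b e)))))

theorem contMDiffAt_modifiedV {S : GenTensor VE E A} (hS : IsVTensor Γ S) {u : DualSpace VE E}
    (hu : u.proj ∈ c.U) (a d b : Fin (Module.finrank ℝ VE)) :
    ContMDiffAt (modelD EM VE) 𝓘(ℝ, ℝ) ∞ (modifiedV G S c a d b) u := by
  have hl := fun a b ↦ contMDiffAt_low G c a b u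
  have hk := fun a b ↦ contMDiffAt_up G c a b u
  have ht := contMDiffAt_tensorV c hS hu
  have hd := fun e a b ↦ (c.smoothSectionAt_vert e u).lieD (hk a b)
  unfold modifiedV leviCivitaV
  refine (contMDiffAt_const.mul (ContMDiffAt.sum fun e _ ↦ (hl b e).mul
    (((hd d e a).add (hd a e d)).sub (hd e a d)))).add
    (contMDiffAt_const.mul (ContMDiffAt.sum fun e _ ↦
      (hl b e).mul (((ContMDiffAt.sum fun j _ ↦ (hk e j).mul (ht a d j)).sub
        (ContMDiffAt.sum fun j _ ↦ (hk a j).mul (ht e d j))).add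
        (ContMDiffAt.sum fun j _ ↦ (hk d j).mul (ht a e j)))))

end Smoothness

section Components

variable (G : PseudoMetric Γ) (T S : GenTensor VE E A) (c : VectorChart φ)

/-- The horizontal components solve the Koszul system for the matrix `g_{ab}` and the torsion
`T^a_{bd} - L^a_{bd}`. -/
theorem modifiedH_eq_koszul (a b d : Fin (Module.finrank ℝ VE)) (u : DualSpace VE E) :
    modifiedH G T c a b d u = koszul (fun i j ↦ G.low c i j u) (fun i j ↦ G.up c i j u)
      (fun i j e ↦ lieD u (c.delta Γ e u) (G.low c i j))
      (fun i j e ↦ tensorH Γ T c i j e u - c.strFun i j e u.proj) a b d := by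
  rw [modifiedH, leviCivitaH, koszul, ← mul_add, ← Finset.sum_add_distrib]
  refine congrArg _ (Finset.sum_congr rfl fun e _ ↦ ?_)
  simp only [← mul_add, mul_sub (G.low c _ _ u), Finset.sum_sub_distrib]
  ring

/-- The vertical components solve the Koszul system for the matrix `g^{ab}`; the index `b` takes the
place of the upper index of `koszul`. -/
theorem modifiedV_eq_koszul (a d b : Fin (Module.finrank ℝ VE)) (u : DualSpace VE E) :
    modifiedV G S c a d b u = koszul (fun i j ↦ G.up c i j u) (fun i j ↦ G.low c i j u)
      (fun i j e ↦ lieD u (c.vert e u) (G.up c i j))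
      (fun i j e ↦ tensorV Γ S c j e i u) b a d := by
  rw [modifiedV, leviCivitaV, koszul, ← mul_add, ← Finset.sum_add_distrib]
  refine congrArg _ (Finset.sum_congr rfl fun e _ ↦ ?_)
  rw [G.up_symm c e a]
  ring

/-- The connection form `Ω^a_b = H^a_{bd} dz^d - V^{ad}_b δp_d` of the connection with the
components `modifiedH` and `modifiedV`. -/
def connForm (u : DualSpace VE E) (a b : Fin (Module.finrank ℝ VE)) :
    GenTangent VE E A u →ₗ[ℝ] ℝ :=
  ∑ d, modifiedH G T c a b d u • c.dzLin d u - ∑ d, modifiedV G S c a d b u • c.deltapLin Γ d u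

theorem connForm_apply (u : DualSpace VE E) (a b : Fin (Module.finrank ℝ VE))
    (X : GenTangent VE E A u) :
    connForm G T S c u a b X = ∑ d, modifiedH G T c a b d u * c.dz d u X
      - ∑ d, modifiedV G S c a d b u * c.deltap Γ d u X := by
  simp [connForm, VectorChart.dzLin_apply, VectorChart.deltapLin_apply]

theorem connForm_delta {u : DualSpace VE E} (hu : u.proj ∈ c.U)
    (a b d : Fin (Module.finrank ℝ VE)) :
    connForm G T S c u a b (c.delta Γ d u) = modifiedH G T c a b d u := by
  simp [connForm_apply, c.dz_delta hu, c.deltap_delta]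

theorem connForm_vert {u : DualSpace VE E} (hu : u.proj ∈ c.U)
    (a b d : Fin (Module.finrank ℝ VE)) :
    connForm G T S c u a b (c.vert d u) = -modifiedV G S c a d b u := by
  simp [connForm_apply, c.dz_vert, c.deltap_vert hu]

/-- The value of the connection form as a matrix. -/
def connMat (u : DualSpace VE E) (X : GenTangent VE E A u) :
    Matrix (Fin (Module.finrank ℝ VE)) (Fin (Module.finrank ℝ VE)) ℝ :=
  of fun a b ↦ connForm G T S c u a b X

variable {G T S}
variable [FiniteDimensional ℝ EN] [T2Space N] [IsManifold 𝓘(ℝ, EN) ∞ N]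
  [ContMDiffVectorBundle ∞ VF F 𝓘(ℝ, EN)] (hG : G.DeterminedByVertical φ)
include hG

/-- The derivative of the relation `g_{ae} g^{eb} = δ_a^b`. -/
theorem lieD_lowMat_mul_upMat {u : DualSpace VE E} (hu : u.proj ∈ c.U) (X : GenTangent VE E A u) :
    (of fun a b ↦ lieD u X (G.low c a b)) * G.upMat c u
      + G.lowMat c u * (of fun a b ↦ lieD u X (G.up c a b)) = 0 := by
  ext a b
  have hl := fun a b ↦ (contMDiffAt_low G c a b u).mdifferentiableAt (n := ∞) (by simp)
  have hk := fun a b ↦ (contMDiffAt_up G c a b u).mdifferentiableAt (n := ∞) (by simp)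
  have h1 : (fun w ↦ ∑ e, G.low c a e w * G.up c e b w) =ᶠ[𝓝 u]
      fun _ ↦ if a = b then 1 else 0 := by
    filter_upwards [(contMDiff_dualProj (EM := EM) (VE := VE) (E := E)).continuous.continuousAt
      (c.isOpen.mem_nhds hu)] with w hw
    exact hG c w hw a b
  have h2 := (lieD_sum Finset.univ u X fun e ↦ (hl a e).mul (hk e b)).2
  have h3 := h2.symm.trans ((lieD_congr u X h1).trans (lieD_const u X _))
  rw [Matrix.add_apply, mul_apply, mul_apply, ← Finset.sum_add_distrib]
  refine Eq.trans (Finset.sum_congr rfl fun e _ ↦ ?_) h3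
  refine Eq.trans ?_ (lieD_mul u X (hl a e) (hk e b)).symm
  simp only [of_apply, PseudoMetric.upMat, PseudoMetric.lowMat]
  ring

variable (hT : ∀ u X Y, T u X Y = -T u Y X) (hS : ∀ u X Y, S u X Y = -S u Y X)
include hT hS

/-- The connection form preserves the horizontal part of the metric. -/
theorem lieD_lowMat {u : DualSpace VE E} (hu : u.proj ∈ c.U) (X : GenTangent VE E A u) :
    (of fun a b ↦ lieD u X (G.low c a b))
      = (connMat G T S c u X)ᵀ * G.lowMat c u + G.lowMat c u * connMat G T S c u X := by
  have key : ∀ a b, lieLin A u (G.low c a b) = ∑ e, G.low c e b u • connForm G T S c u e a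
      + ∑ e, G.low c a e u • connForm G T S c u e b := by
    intro a b
    -- Along `δ_d` this is the Koszul formula for `g_{ab}`. Along `∂^d` the Koszul formula is that
    -- of `g^{ab}`, and the statement passes to the inverse matrix.
    refine c.linearMap_ext (Γ := Γ) hu (fun d ↦ ?_) fun d ↦ ?_
    · have h := koszul_metric (hG c u hu) (fun a b ↦ congrFun (G.low_symm c a b) u)
        (dg := fun i j e ↦ lieD u (c.delta Γ e u) (G.low c i j))
        (W := fun i j e ↦ tensorH Γ T c i j e u - c.strFun i j e u.proj)
        (fun a b d ↦ by rw [G.low_symm c a b]) (fun a b d ↦ by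
          rw [tensorH_skew hT, c.strFun_skew]; ring) a b d
      simp only [← modifiedH_eq_koszul] at h
      simpa [lieLin_apply, connForm_delta G T S c hu] using! h
    · have h : (of fun a b ↦ lieD u (c.vert d u) (G.up c a b))
          = -(G.upMat c u * (connMat G T S c u (c.vert d u))ᵀ
            + connMat G T S c u (c.vert d u) * G.upMat c u) := by
        ext a b
        have h := koszul_metric (sum_mul_eq_comm (hG c u hu))
          (fun a b ↦ congrFun (G.up_symm c a b) u)
          (dg := fun i j e ↦ lieD u (c.vert e u) (G.up c i j))
          (W := fun i j e ↦ tensorV Γ S c j e i u)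
          (fun a b d ↦ by rw [G.up_symm c a b]) (fun a b d ↦ tensorV_skew hS c b d a u) a b d
        simp only [← modifiedV_eq_koszul] at h
        rw [of_apply, Matrix.neg_apply, Matrix.add_apply, mul_apply, mul_apply]
        simp only [connMat, of_apply, transpose_apply, connForm_vert G T S c hu, PseudoMetric.upMat]
        refine h.trans ?_
        simp [mul_comm, add_comm]
      have h' := (metric_inverse_iff (G.lowMat_mul_upMat c hG hu)
        (lieD_lowMat_mul_upMat c hG hu (c.vert d u))).2 h
      have h'' := congrFun (congrFun h' a) b
      rw [of_apply, Matrix.add_apply, mul_apply, mul_apply] at h''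
      refine h''.trans ?_
      simp [connMat, PseudoMetric.lowMat, mul_comm]
  ext a b
  refine (LinearMap.congr_fun (key a b) X).trans ?_
  rw [Matrix.add_apply, mul_apply, mul_apply]
  simp [connMat, PseudoMetric.lowMat, mul_comm]

/-- The negative transpose of the connection form preserves the vertical part of the metric. -/
theorem lieD_upMat {u : DualSpace VE E} (hu : u.proj ∈ c.U) (X : GenTangent VE E A u) :
    (of fun a b ↦ lieD u X (G.up c a b))
      = -(G.upMat c u * (connMat G T S c u X)ᵀ + connMat G T S c u X * G.upMat c u) :=
  (metric_inverse_iff (G.lowMat_mul_upMat c hG hu) (lieD_lowMat_mul_upMat c hG hu X)).1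
    (lieD_lowMat c hG hT hS hu X)

end Components

end ConnectionForm

/-! ### Derivations of the generalized tangent bundle -/

section Derivations

open Matrix

variable {EM : Type*} [NormedAddCommGroup EM] [NormedSpace ℝ EM]
  {M : Type*} [TopologicalSpace M] [ChartedSpace EM M] [IsManifold 𝓘(ℝ, EM) ∞ M]
  {EN : Type*} [NormedAddCommGroup EN] [NormedSpace ℝ EN]
  {N : Type*} [TopologicalSpace N] [ChartedSpace EN N]
  {VF : Type*} [NormedAddCommGroup VF] [NormedSpace ℝ VF]
  {F : N → Type*} [∀ y, AddCommGroup (F y)] [∀ y, Module ℝ (F y)]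
  [∀ y, TopologicalSpace (F y)] [TopologicalSpace (TotalSpace VF F)]
  [FiberBundle VF F] [VectorBundle ℝ VF F]
  {VE : Type*} [NormedAddCommGroup VE] [NormedSpace ℝ VE]
  {E : M → Type*} [∀ x, AddCommGroup (E x)] [∀ x, Module ℝ (E x)]
  [∀ x, TopologicalSpace (E x)] [TopologicalSpace (TotalSpace VE E)]
  [FiberBundle VE E] [VectorBundle ℝ VE E] [ContMDiffVectorBundle ∞ VE E 𝓘(ℝ, EM)]
  {A : GenLieAlgebroid EM M EN VF F} {φ : BundleIdent VE E A} {Γ : NonlinConnection VE E A}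

theorem mdifferentiableAt_along_add_smul {EP : Type*} [NormedAddCommGroup EP] [NormedSpace ℝ EP]
    {HP : Type*} [TopologicalSpace HP] {IP : ModelWithCorners ℝ EP HP}
    {P : Type*} [TopologicalSpace P] [ChartedSpace HP P]
    {EB : Type*} [NormedAddCommGroup EB] [NormedSpace ℝ EB] {HB : Type*} [TopologicalSpace HB]
    {IB : ModelWithCorners ℝ EB HB} {B : Type*} [TopologicalSpace B] [ChartedSpace HB B]
    {W : Type*} [NormedAddCommGroup W] [NormedSpace ℝ W]
    {V : B → Type*} [∀ y, AddCommGroup (V y)] [∀ y, Module ℝ (V y)]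
    [∀ y, TopologicalSpace (V y)] [TopologicalSpace (TotalSpace W V)]
    [FiberBundle W V] [VectorBundle ℝ W V]
    {b : P → B} {z w : ∀ p, V (b p)} {f : P → ℝ} {p₀ : P}
    (hz : MDifferentiableAt IP (IB.prod 𝓘(ℝ, W)) (fun p ↦ (⟨b p, z p⟩ : TotalSpace W V)) p₀)
    (hw : MDifferentiableAt IP (IB.prod 𝓘(ℝ, W)) (fun p ↦ (⟨b p, w p⟩ : TotalSpace W V)) p₀)
    (hf : MDifferentiableAt IP 𝓘(ℝ, ℝ) f p₀) :
    MDifferentiableAt IP (IB.prod 𝓘(ℝ, W))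
      (fun p ↦ (⟨b p, z p + f p • w p⟩ : TotalSpace W V)) p₀ := by
  rw [mdifferentiableAt_totalSpace] at hz hw ⊢
  refine ⟨hz.1, ?_⟩
  refine (hz.2.add (hf.smul hw.2)).congr_of_eventuallyEq ?_
  have hb : ∀ᶠ p in 𝓝 p₀, b p ∈ (trivializationAt W V (b p₀)).baseSet :=
    hz.1.continuousAt ((trivializationAt W V (b p₀)).open_baseSet.mem_nhds
      (mem_baseSet_trivializationAt W V (b p₀)))
  filter_upwards [hb] with p hp
  have hl := (trivializationAt W V (b p₀)).linear ℝ hp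
  change (trivializationAt W V (b p₀) ⟨b p, z p + f p • w p⟩).2 =
    (trivializationAt W V (b p₀) ⟨b p, z p⟩).2 + f p • (trivializationAt W V (b p₀) ⟨b p, w p⟩).2
  rw [hl.map_add, hl.map_smul]

theorem DiffSectionAt.add_smul {X Y : GenSection VE E A} {f : DualSpace VE E → ℝ}
    {u : DualSpace VE E} (hX : DiffSectionAt A X u) (hY : DiffSectionAt A Y u)
    (hf : MDifferentiableAt (modelD EM VE) 𝓘(ℝ, ℝ) f u) :
    DiffSectionAt A (fun w ↦ X w + f w • Y w) u :=
  ⟨mdifferentiableAt_along_add_smul hX.1 hY.1 hf,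
    mdifferentiableAt_along_add_smul (V := TangentSpace (modelD EM VE)) (b := fun w ↦ w)
      hX.2 hY.2 hf⟩

/-- Covariant derivatives of sections at the point `u`. The rules are required for differentiable
sections only; locality is a separate condition, for arbitrary sections. -/
structure IsDerivationAt (u : DualSpace VE E)
    (D : GenSection VE E A → GenTangent VE E A u →ₗ[ℝ] GenTangent VE E A u) : Prop where
  congr : ∀ Y Y' : GenSection VE E A, (∀ᶠ w in 𝓝 u, Y w = Y' w) → D Y = D Y'
  add : ∀ Y Y' : GenSection VE E A, DiffSectionAt A Y u → DiffSectionAt A Y' u →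
    D (fun w ↦ Y w + Y' w) = D Y + D Y'
  leibniz : ∀ (f : DualSpace VE E → ℝ) (Y : GenSection VE E A),
    MDifferentiableAt (modelD EM VE) 𝓘(ℝ, ℝ) f u → DiffSectionAt A Y u →
    ∀ x, D (fun w ↦ f w • Y w) x = f u • D Y x + lieD u x f • Y u

section Frame

variable [FiniteDimensional ℝ EN] [T2Space N] [IsManifold 𝓘(ℝ, EN) ∞ N]
  [ContMDiffVectorBundle ∞ VF F 𝓘(ℝ, EN)]

theorem DiffSectionAt.smul {Y : GenSection VE E A} {f : DualSpace VE E → ℝ}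
    {u : DualSpace VE E} (hY : DiffSectionAt A Y u)
    (hf : MDifferentiableAt (modelD EM VE) 𝓘(ℝ, ℝ) f u) :
    DiffSectionAt A (fun w ↦ f w • Y w) u := by
  have h := (smoothSectionAt_zero (A := A) u).diffSectionAt.add_smul hY hf
  simp only [zero_add] at h
  exact h

/-- Two covariant derivatives which agree on a frame agree on its combinations. -/
theorem IsDerivationAt.eq_on_sum {u : DualSpace VE E}
    {D₁ D₂ : GenSection VE E A → GenTangent VE E A u →ₗ[ℝ] GenTangent VE E A u}
    (h₁ : IsDerivationAt u D₁) (h₂ : IsDerivationAt u D₂) {ι : Type*} (s : Finset ι)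
    {f : ι → DualSpace VE E → ℝ} {Y : ι → GenSection VE E A}
    (hf : ∀ i, MDifferentiableAt (modelD EM VE) 𝓘(ℝ, ℝ) (f i) u)
    (hY : ∀ i, DiffSectionAt A (Y i) u) (h : ∀ i, D₁ (Y i) = D₂ (Y i)) :
    DiffSectionAt A (fun w ↦ ∑ i ∈ s, f i w • Y i w) u ∧
      D₁ (fun w ↦ ∑ i ∈ s, f i w • Y i w) = D₂ (fun w ↦ ∑ i ∈ s, f i w • Y i w) := by
  classical
  induction s using Finset.induction_on with
  | empty =>
    have h0 := (smoothSectionAt_zero (A := A) u).diffSectionAt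
    have key : ∀ {D : GenSection VE E A → GenTangent VE E A u →ₗ[ℝ] GenTangent VE E A u},
        IsDerivationAt u D → D (fun _ ↦ 0) = 0 := fun {D} hD ↦ by
      have h2 := hD.add _ _ h0 h0
      simp only [add_zero] at h2
      ext1 x
      exact left_eq_add.1 (LinearMap.congr_fun h2 x)
    simp only [Finset.sum_empty]
    exact ⟨h0, (key h₁).trans (key h₂).symm⟩
  | insert i s hi ih =>
    simp only [Finset.sum_insert hi]
    have hd := (hY i).smul (hf i)
    refine ⟨?_, ?_⟩
    · have h3 := ih.1.add_smul (hY i) (hf i)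
      simp only [add_comm _ (f i _ • Y i _)] at h3
      exact h3
    · rw [h₁.add _ _ hd ih.1, h₂.add _ _ hd ih.1, ih.2]
      congr 1
      ext1 x
      rw [h₁.leibniz _ _ (hf i) (hY i), h₂.leibniz _ _ (hf i) (hY i), h]

/-- A covariant derivative is determined by its values on the adapted base of a vector chart. -/
theorem IsDerivationAt.ext_adapted [FiniteDimensional ℝ VE] (c : VectorChart φ)
    {u : DualSpace VE E} (hu : u.proj ∈ c.U)
    {D₁ D₂ : GenSection VE E A → GenTangent VE E A u →ₗ[ℝ] GenTangent VE E A u}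
    (h₁ : IsDerivationAt u D₁) (h₂ : IsDerivationAt u D₂)
    (h : ∀ a, D₁ (c.delta Γ a) = D₂ (c.delta Γ a)) (h' : ∀ a, D₁ (c.vert a) = D₂ (c.vert a))
    {Y : GenSection VE E A} (hY : DiffSectionAt A Y u) : D₁ Y = D₂ Y := by
  have hd := h₁.eq_on_sum h₂ Finset.univ (fun a ↦ c.mdifferentiableAt_dz hu hY a)
    (fun a ↦ (c.smoothSectionAt_delta (Γ := Γ) a u).diffSectionAt) h
  have hv := h₁.eq_on_sum h₂ Finset.univ (fun a ↦ c.mdifferentiableAt_deltap (Γ := Γ) hu hY a)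
    (fun a ↦ (c.smoothSectionAt_vert a u).diffSectionAt) h'
  have he : ∀ᶠ w in 𝓝 u, Y w = ∑ a, c.dz a w (Y w) • c.delta Γ a w
      + ∑ a, c.deltap Γ a w (Y w) • c.vert a w := by
    filter_upwards [(contMDiff_dualProj (EM := EM) (VE := VE) (E := E)).continuous.continuousAt
      (c.isOpen.mem_nhds hu)] with w hw
    exact c.eq_comb (Γ := Γ) hw (Y w)
  rw [h₁.congr _ _ he, h₂.congr _ _ he, h₁.add _ _ hd.1 hv.1, h₂.add _ _ hd.1 hv.1, hd.2, hv.2]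

end Frame

end Derivations

/-! ### The connection of a vector chart -/

section LocalConnection

open Matrix

variable {EM : Type*} [NormedAddCommGroup EM] [NormedSpace ℝ EM]
  {M : Type*} [TopologicalSpace M] [ChartedSpace EM M] [IsManifold 𝓘(ℝ, EM) ∞ M]
  {EN : Type*} [NormedAddCommGroup EN] [NormedSpace ℝ EN]
  {N : Type*} [TopologicalSpace N] [ChartedSpace EN N]
  {VF : Type*} [NormedAddCommGroup VF] [NormedSpace ℝ VF]
  {F : N → Type*} [∀ y, AddCommGroup (F y)] [∀ y, Module ℝ (F y)]
  [∀ y, TopologicalSpace (F y)] [TopologicalSpace (TotalSpace VF F)]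
  [FiberBundle VF F] [VectorBundle ℝ VF F]
  {VE : Type*} [NormedAddCommGroup VE] [NormedSpace ℝ VE]
  {E : M → Type*} [∀ x, AddCommGroup (E x)] [∀ x, Module ℝ (E x)]
  [∀ x, TopologicalSpace (E x)] [TopologicalSpace (TotalSpace VE E)]
  [FiberBundle VE E] [VectorBundle ℝ VE E] [ContMDiffVectorBundle ∞ VE E 𝓘(ℝ, EM)]
  {A : GenLieAlgebroid EM M EN VF F} {φ : BundleIdent VE E A} {Γ : NonlinConnection VE E A}
variable (G : PseudoMetric Γ) (T S : GenTensor VE E A) (c : VectorChart φ)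

/-- The covariant derivative whose components in the chart `c` are `modifiedH` and `modifiedV`, with
`D δ_b = Ω^a_b δ_a` and `D ∂^a = - Ω^a_b ∂^b`. It is defined over all points, but meaningful over
those of the domain of `c` only. -/
def localConn (Y : GenSection VE E A) (u : DualSpace VE E) :
    GenTangent VE E A u →ₗ[ℝ] GenTangent VE E A u :=
  ∑ a, (lieLin A u (fun w ↦ c.dz a w (Y w))
      + ∑ b, c.dz b u (Y u) • connForm G T S c u a b).smulRight (c.delta Γ a u)
    + ∑ b, (lieLin A u (fun w ↦ c.deltap Γ b w (Y w))
      - ∑ a, c.deltap Γ a u (Y u) • connForm G T S c u a b).smulRight (c.vert b u)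

theorem VectorChart.dz_add (a : Fin (Module.finrank ℝ VE)) (u : DualSpace VE E)
    (X Y : GenTangent VE E A u) : c.dz a u (X + Y) = c.dz a u X + c.dz a u Y :=
  (c.dzLin a u).map_add X Y

theorem VectorChart.dz_smul (a : Fin (Module.finrank ℝ VE)) (u : DualSpace VE E) (r : ℝ)
    (X : GenTangent VE E A u) : c.dz a u (r • X) = r * c.dz a u X :=
  (c.dzLin a u).map_smul r X

theorem VectorChart.deltap_add (a : Fin (Module.finrank ℝ VE)) (u : DualSpace VE E)
    (X Y : GenTangent VE E A u) : c.deltap Γ a u (X + Y) = c.deltap Γ a u X + c.deltap Γ a u Y :=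
  (c.deltapLin Γ a u).map_add X Y

theorem VectorChart.deltap_smul (a : Fin (Module.finrank ℝ VE)) (u : DualSpace VE E) (r : ℝ)
    (X : GenTangent VE E A u) : c.deltap Γ a u (r • X) = r * c.deltap Γ a u X :=
  (c.deltapLin Γ a u).map_smul r X

theorem VectorChart.dz_sub (a : Fin (Module.finrank ℝ VE)) (u : DualSpace VE E)
    (X Y : GenTangent VE E A u) : c.dz a u (X - Y) = c.dz a u X - c.dz a u Y :=
  (c.dzLin a u).map_sub X Y

theorem VectorChart.deltap_sub (a : Fin (Module.finrank ℝ VE)) (u : DualSpace VE E)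
    (X Y : GenTangent VE E A u) : c.deltap Γ a u (X - Y) = c.deltap Γ a u X - c.deltap Γ a u Y :=
  (c.deltapLin Γ a u).map_sub X Y

theorem VectorChart.dz_sum {ι : Type*} (s : Finset ι) (a : Fin (Module.finrank ℝ VE))
    (u : DualSpace VE E) (X : ι → GenTangent VE E A u) :
    c.dz a u (∑ i ∈ s, X i) = ∑ i ∈ s, c.dz a u (X i) := map_sum (c.dzLin a u) X s

theorem VectorChart.deltap_sum {ι : Type*} (s : Finset ι) (a : Fin (Module.finrank ℝ VE))
    (u : DualSpace VE E) (X : ι → GenTangent VE E A u) :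
    c.deltap Γ a u (∑ i ∈ s, X i) = ∑ i ∈ s, c.deltap Γ a u (X i) :=
  map_sum (c.deltapLin Γ a u) X s

theorem localConn_apply (Y : GenSection VE E A) (u : DualSpace VE E) (x : GenTangent VE E A u) :
    localConn G T S c Y u x = c.comb Γ u
      (fun a ↦ lieD u x (fun w ↦ c.dz a w (Y w))
        + ∑ b, c.dz b u (Y u) * connForm G T S c u a b x)
      (fun b ↦ lieD u x (fun w ↦ c.deltap Γ b w (Y w))
        - ∑ a, c.deltap Γ a u (Y u) * connForm G T S c u a b x) := by
  simp [localConn, VectorChart.comb, lieLin_apply]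

theorem dz_localConn {u : DualSpace VE E} (hu : u.proj ∈ c.U) (Y : GenSection VE E A)
    (x : GenTangent VE E A u) (a : Fin (Module.finrank ℝ VE)) :
    c.dz a u (localConn G T S c Y u x) = lieD u x (fun w ↦ c.dz a w (Y w))
      + ∑ b, c.dz b u (Y u) * connForm G T S c u a b x := by
  rw [localConn_apply, c.dz_comb hu]

theorem deltap_localConn {u : DualSpace VE E} (hu : u.proj ∈ c.U) (Y : GenSection VE E A)
    (x : GenTangent VE E A u) (b : Fin (Module.finrank ℝ VE)) :
    c.deltap Γ b u (localConn G T S c Y u x) = lieD u x (fun w ↦ c.deltap Γ b w (Y w))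
      - ∑ a, c.deltap Γ a u (Y u) * connForm G T S c u a b x := by
  rw [localConn_apply, c.deltap_comb hu]

theorem eventually_proj_mem {u : DualSpace VE E} (hu : u.proj ∈ c.U) :
    ∀ᶠ w : DualSpace VE E in 𝓝 u, w.proj ∈ c.U :=
  (contMDiff_dualProj (EM := EM) (VE := VE) (E := E)).continuous.continuousAt
    (c.isOpen.mem_nhds hu)

theorem localConn_horizontal {u : DualSpace VE E} (hu : u.proj ∈ c.U) {Y : GenSection VE E A}
    (hY : ∀ᶠ w in 𝓝 u, Γ.proj w (Y w) = 0) (x : GenTangent VE E A u) :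
    Γ.proj u (localConn G T S c Y u x) = 0 := by
  refine (c.proj_eq_zero_iff hu _).2 fun b ↦ ?_
  have h : (fun w ↦ c.deltap Γ b w (Y w)) =ᶠ[𝓝 u] fun _ ↦ 0 := by
    filter_upwards [hY] with w hw using c.deltap_eq_zero hw b
  rw [deltap_localConn G T S c hu, lieD_congr u x h, lieD_const]
  simp [c.deltap_eq_zero hY.self_of_nhds]

theorem localConn_vertical {u : DualSpace VE E} (hu : u.proj ∈ c.U) {Y : GenSection VE E A}
    (hY : ∀ᶠ w in 𝓝 u, (Y w).1.1 = 0) (x : GenTangent VE E A u) :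
    (localConn G T S c Y u x).1.1 = 0 := by
  refine (c.fst_eq_zero_iff hu _).2 fun a ↦ ?_
  have h : (fun w ↦ c.dz a w (Y w)) =ᶠ[𝓝 u] fun _ ↦ 0 := by
    filter_upwards [hY] with w hw using c.dz_eq_zero hw a
  rw [dz_localConn G T S c hu, lieD_congr u x h, lieD_const]
  simp [c.dz_eq_zero hY.self_of_nhds]

theorem localConn_delta {u : DualSpace VE E} (hu : u.proj ∈ c.U)
    (a b : Fin (Module.finrank ℝ VE)) (x : GenTangent VE E A u) :
    c.dz a u (localConn G T S c (c.delta Γ b) u x) = connForm G T S c u a b x := by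
  have h : (fun w ↦ c.dz a w (c.delta Γ b w)) =ᶠ[𝓝 u] fun _ ↦ if a = b then 1 else 0 := by
    filter_upwards [eventually_proj_mem c hu] with w hw using c.dz_delta hw a b
  rw [dz_localConn G T S c hu, lieD_congr u x h, lieD_const]
  simp [c.dz_delta hu]

theorem localConn_vert {u : DualSpace VE E} (hu : u.proj ∈ c.U)
    (a b : Fin (Module.finrank ℝ VE)) (x : GenTangent VE E A u) :
    c.deltap Γ b u (localConn G T S c (c.vert a) u x) = -connForm G T S c u a b x := by
  have h : (fun w ↦ c.deltap Γ b w (c.vert a w)) =ᶠ[𝓝 u] fun _ ↦ if b = a then 1 else 0 := by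
    filter_upwards [eventually_proj_mem c hu] with w hw using c.deltap_vert hw b a
  rw [deltap_localConn G T S c hu, lieD_congr u x h, lieD_const]
  simp [c.deltap_vert hu]

variable [FiniteDimensional ℝ EN] [T2Space N] [IsManifold 𝓘(ℝ, EN) ∞ N]
  [ContMDiffVectorBundle ∞ VF F 𝓘(ℝ, EN)] [FiniteDimensional ℝ VE]

/-- The connection of a chart is a covariant derivative over the domain of the chart. -/
theorem isDerivationAt_localConn {u : DualSpace VE E} (hu : u.proj ∈ c.U) :
    IsDerivationAt u (fun Y ↦ localConn G T S c Y u) where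
  congr Y Y' h := by
    ext1 x
    refine c.ext_coord (Γ := Γ) hu (fun a ↦ ?_) fun b ↦ ?_
    · rw [dz_localConn G T S c hu, dz_localConn G T S c hu, h.self_of_nhds,
        lieD_congr u x (h.mono fun w hw ↦ congrArg (c.dz a w) hw)]
    · rw [deltap_localConn G T S c hu, deltap_localConn G T S c hu, h.self_of_nhds,
        lieD_congr u x (h.mono fun w hw ↦ congrArg (c.deltap Γ b w) hw)]
  add Y Y' hY hY' := by
    ext1 x
    refine c.ext_coord (Γ := Γ) hu (fun a ↦ ?_) fun b ↦ ?_
    · refine Eq.trans ?_ (c.dz_add a u _ _).symm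
      simp only [dz_localConn G T S c hu, c.dz_add, add_mul, Finset.sum_add_distrib]
      rw [lieD_add u x (c.mdifferentiableAt_dz hu hY a) (c.mdifferentiableAt_dz hu hY' a)]
      ring
    · refine Eq.trans ?_ (c.deltap_add b u _ _).symm
      simp only [deltap_localConn G T S c hu, c.deltap_add, add_mul, Finset.sum_add_distrib]
      rw [lieD_add u x (c.mdifferentiableAt_deltap hu hY b) (c.mdifferentiableAt_deltap hu hY' b)]
      ring
  leibniz f Y hf hY x := by
    refine c.ext_coord (Γ := Γ) hu (fun a ↦ ?_) fun b ↦ ?_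
    · refine Eq.trans ?_ (c.dz_add a u _ _).symm
      simp only [dz_localConn G T S c hu, c.dz_smul, mul_assoc, ← Finset.mul_sum]
      rw [lieD_mul u x hf (c.mdifferentiableAt_dz hu hY a)]
      ring
    · refine Eq.trans ?_ (c.deltap_add b u _ _).symm
      simp only [deltap_localConn G T S c hu, c.deltap_smul, mul_assoc, ← Finset.mul_sum]
      rw [lieD_mul u x hf (c.mdifferentiableAt_deltap hu hY b)]
      ring

theorem smoothSectionAt_localConn (hT : IsHTensor Γ T) (hS : IsVTensor Γ S) {u : DualSpace VE E}
    (hu : u.proj ∈ c.U) {X Y : GenSection VE E A} (hX : SmoothSectionAt A X u)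
    (hY : SmoothSectionAt A Y u) :
    SmoothSectionAt A (fun w ↦ localConn G T S c Y w (X w)) u := by
  have hΩ : ∀ a b, ContMDiffAt (modelD EM VE) 𝓘(ℝ, ℝ) ∞
      (fun w ↦ connForm G T S c w a b (X w)) u := fun a b ↦ by
    simp only [connForm_apply]
    exact (ContMDiffAt.sum fun d _ ↦ (contMDiffAt_modifiedH G c hT hu a b d).mul
      (c.contMDiffAt_dz hu hX d)).sub (ContMDiffAt.sum fun d _ ↦
      (contMDiffAt_modifiedV G c hS hu a d b).mul (c.contMDiffAt_deltap hu hX d))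
  simp only [localConn_apply]
  exact c.smoothSectionAt_comb
    (fun a ↦ (hX.lieD (c.contMDiffAt_dz hu hY a)).add (ContMDiffAt.sum fun b _ ↦
      (c.contMDiffAt_dz hu hY b).mul (hΩ a b)))
    (fun b ↦ (hX.lieD (c.contMDiffAt_deltap hu hY b)).sub (ContMDiffAt.sum fun a _ ↦
      (c.contMDiffAt_deltap hu hY a).mul (hΩ a b)))

/-- The derivative of the pairing of the horizontal part with the vertical part. -/
theorem lieD_pairing {u : DualSpace VE E} (hu : u.proj ∈ c.U) {Y Z : GenSection VE E A}
    (hY : DiffSectionAt A Y u) (hZ : DiffSectionAt A Z u) (x : GenTangent VE E A u) :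
    lieD u x (fun w ↦ c.dzVec w (Y w) ⬝ᵥ c.dpVec Γ w (Z w))
      = c.dzVec u (localConn G T S c Y u x) ⬝ᵥ c.dpVec Γ u (Z u)
        + c.dzVec u (Y u) ⬝ᵥ c.dpVec Γ u (localConn G T S c Z u x) := by
  have h1 := (lieD_sum Finset.univ u x fun a ↦ (c.mdifferentiableAt_dz hu hY a).mul
    (c.mdifferentiableAt_deltap (Γ := Γ) hu hZ a)).2
  have h2 := fun a ↦ lieD_mul u x (c.mdifferentiableAt_dz hu hY a)
    (c.mdifferentiableAt_deltap (Γ := Γ) hu hZ a)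
  refine h1.trans ((Finset.sum_congr rfl fun a _ ↦ h2 a).trans ?_)
  simp only [VectorChart.dzVec, VectorChart.dpVec, dotProduct, dz_localConn G T S c hu,
    deltap_localConn G T S c hu, add_mul, mul_sub, Finset.sum_add_distrib, Finset.sum_sub_distrib,
    Finset.mul_sum, Finset.sum_mul]
  rw [Finset.sum_comm (f := fun a b ↦ c.dz b u (Y u) * connForm G T S c u a b x
    * c.deltap Γ a u (Z u))]
  simp only [mul_comm, mul_left_comm]
  ring

end LocalConnection

/-! ### Metricity -/

section Metricity

open Matrix

variable {EM : Type*} [NormedAddCommGroup EM] [NormedSpace ℝ EM]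
  {M : Type*} [TopologicalSpace M] [ChartedSpace EM M] [IsManifold 𝓘(ℝ, EM) ∞ M]
  {EN : Type*} [NormedAddCommGroup EN] [NormedSpace ℝ EN]
  {N : Type*} [TopologicalSpace N] [ChartedSpace EN N]
  {VF : Type*} [NormedAddCommGroup VF] [NormedSpace ℝ VF]
  {F : N → Type*} [∀ y, AddCommGroup (F y)] [∀ y, Module ℝ (F y)]
  [∀ y, TopologicalSpace (F y)] [TopologicalSpace (TotalSpace VF F)]
  [FiberBundle VF F] [VectorBundle ℝ VF F]
  {VE : Type*} [NormedAddCommGroup VE] [NormedSpace ℝ VE]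
  {E : M → Type*} [∀ x, AddCommGroup (E x)] [∀ x, Module ℝ (E x)]
  [∀ x, TopologicalSpace (E x)] [TopologicalSpace (TotalSpace VE E)]
  [FiberBundle VE E] [VectorBundle ℝ VE E] [ContMDiffVectorBundle ∞ VE E 𝓘(ℝ, EM)]
  {A : GenLieAlgebroid EM M EN VF F} {φ : BundleIdent VE E A} {Γ : NonlinConnection VE E A}

theorem dotProduct_mulVec_eq_sum {ι : Type*} [Fintype ι] (g : Matrix ι ι ℝ) (y z : ι → ℝ) :
    y ⬝ᵥ g *ᵥ z = ∑ a, ∑ b, y a * (g a b * z b) := by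
  simp [dotProduct, mulVec, Finset.mul_sum]

/-- The product rule for a bilinear form with variable coefficients. -/
theorem lieD_dotProduct_mulVec {ι : Type*} [Fintype ι] {u : DualSpace VE E}
    (x : GenTangent VE E A u) {g : ι → ι → DualSpace VE E → ℝ} {y z : ι → DualSpace VE E → ℝ}
    (hg : ∀ a b, MDifferentiableAt (modelD EM VE) 𝓘(ℝ, ℝ) (g a b) u)
    (hy : ∀ a, MDifferentiableAt (modelD EM VE) 𝓘(ℝ, ℝ) (y a) u)
    (hz : ∀ a, MDifferentiableAt (modelD EM VE) 𝓘(ℝ, ℝ) (z a) u) :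
    MDifferentiableAt (modelD EM VE) 𝓘(ℝ, ℝ)
      (fun w ↦ (fun a ↦ y a w) ⬝ᵥ (of fun a b ↦ g a b w) *ᵥ fun a ↦ z a w) u ∧
    lieD u x (fun w ↦ (fun a ↦ y a w) ⬝ᵥ (of fun a b ↦ g a b w) *ᵥ fun a ↦ z a w)
      = (fun a ↦ y a u) ⬝ᵥ (of fun a b ↦ lieD u x (g a b)) *ᵥ (fun a ↦ z a u)
        + (fun a ↦ lieD u x (y a)) ⬝ᵥ (of fun a b ↦ g a b u) *ᵥ (fun a ↦ z a u)
        + (fun a ↦ y a u) ⬝ᵥ (of fun a b ↦ g a b u) *ᵥ fun a ↦ lieD u x (z a) := by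
  have h1 := fun a b ↦ (hg a b).mul (hz b)
  have h2 := fun a b ↦ (hy a).mul (h1 a b)
  have h3 := fun a ↦ lieD_sum Finset.univ u x (h2 a)
  have h4 := lieD_sum Finset.univ u x fun a ↦ (h3 a).1
  simp only [dotProduct_mulVec_eq_sum, of_apply]
  refine ⟨h4.1, h4.2.trans ?_⟩
  rw [← Finset.sum_add_distrib, ← Finset.sum_add_distrib]
  refine Finset.sum_congr rfl fun a _ ↦ (h3 a).2.trans ?_
  rw [← Finset.sum_add_distrib, ← Finset.sum_add_distrib]
  refine Finset.sum_congr rfl fun b _ ↦ (lieD_mul u x (hy a) (h1 a b)).trans ?_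
  have h5 : lieD u x (g a b * z b) = _ := lieD_mul u x (hg a b) (hz b)
  rw [h5, Pi.mul_apply]
  ring

variable {G : PseudoMetric Γ} {T S : GenTensor VE E A} (c : VectorChart φ)

theorem dzVec_localConn {u : DualSpace VE E} (hu : u.proj ∈ c.U) (Y : GenSection VE E A)
    (x : GenTangent VE E A u) :
    c.dzVec u (localConn G T S c Y u x) = (fun a ↦ lieD u x (fun w ↦ c.dz a w (Y w)))
      + connMat G T S c u x *ᵥ c.dzVec u (Y u) := by
  funext a
  refine (dz_localConn G T S c hu Y x a).trans ?_
  simp [mulVec, dotProduct, connMat, VectorChart.dzVec, mul_comm]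

theorem dpVec_localConn {u : DualSpace VE E} (hu : u.proj ∈ c.U) (Y : GenSection VE E A)
    (x : GenTangent VE E A u) :
    c.dpVec Γ u (localConn G T S c Y u x) = (fun a ↦ lieD u x (fun w ↦ c.deltap Γ a w (Y w)))
      + (-(connMat G T S c u x)ᵀ) *ᵥ c.dpVec Γ u (Y u) := by
  funext a
  refine (deltap_localConn G T S c hu Y x a).trans ?_
  simp [mulVec, dotProduct, connMat, VectorChart.dpVec, mul_comm, sub_eq_add_neg]

variable [FiniteDimensional ℝ EN] [T2Space N] [IsManifold 𝓘(ℝ, EN) ∞ N]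
  [ContMDiffVectorBundle ∞ VF F 𝓘(ℝ, EN)] [FiniteDimensional ℝ VE]

/-- The connection of a chart is metric: the horizontal part of the metric is preserved by `Ω`, the
vertical part by `-Ωᵀ`. -/
theorem localConn_metric (hG : G.DeterminedByVertical φ) (hT : ∀ u X Y, T u X Y = -T u Y X)
    (hS : ∀ u X Y, S u X Y = -S u Y X) {u : DualSpace VE E} (hu : u.proj ∈ c.U)
    {Y Z : GenSection VE E A} (hY : DiffSectionAt A Y u) (hZ : DiffSectionAt A Z u)
    (x : GenTangent VE E A u) :
    lieD u x (fun w ↦ G.form w (Y w) (Z w))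
      = G.form u (localConn G T S c Y u x) (Z u) + G.form u (Y u) (localConn G T S c Z u x) := by
  have hl := lieD_dotProduct_mulVec x
    (fun a b ↦ (contMDiffAt_low G c a b u).mdifferentiableAt (n := ∞) (by simp))
    (fun a ↦ c.mdifferentiableAt_dz hu hY a) (fun a ↦ c.mdifferentiableAt_dz hu hZ a)
  have hk := lieD_dotProduct_mulVec x
    (fun a b ↦ (contMDiffAt_up G c a b u).mdifferentiableAt (n := ∞) (by simp))
    (fun a ↦ c.mdifferentiableAt_deltap (Γ := Γ) hu hY a)
    (fun a ↦ c.mdifferentiableAt_deltap (Γ := Γ) hu hZ a)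
  have h1 := lieD_congr u x ((eventually_proj_mem c hu).mono fun w hw ↦ G.form_eq c hw (Y w) (Z w))
  refine h1.trans ((lieD_add u x hl.1 hk.1).trans ?_)
  rw [hl.2, hk.2, lieD_lowMat c hG hT hS hu x, lieD_upMat c hG hT hS hu x, G.form_eq c hu,
    G.form_eq c hu, dzVec_localConn c hu, dpVec_localConn c hu, dzVec_localConn c hu,
    dpVec_localConn c hu]
  have e1 := metric_product_rule (g := G.lowMat c u) (Ω := connMat G T S c u x)
    (c.dzVec u (Y u)) (fun a ↦ lieD u x (fun w ↦ c.dz a w (Y w)))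
    (c.dzVec u (Z u)) (fun a ↦ lieD u x (fun w ↦ c.dz a w (Z w)))
  have e2 := metric_product_rule (g := G.upMat c u) (Ω := -(connMat G T S c u x)ᵀ)
    (c.dpVec Γ u (Y u)) (fun a ↦ lieD u x (fun w ↦ c.deltap Γ a w (Y w)))
    (c.dpVec Γ u (Z u)) (fun a ↦ lieD u x (fun w ↦ c.deltap Γ a w (Z w)))
  have e3 : (-(connMat G T S c u x)ᵀ)ᵀ * G.upMat c u + G.upMat c u * -(connMat G T S c u x)ᵀ
      = -(G.upMat c u * (connMat G T S c u x)ᵀ + connMat G T S c u x * G.upMat c u) := by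
    rw [transpose_neg, transpose_transpose, neg_mul, mul_neg, neg_add, add_comm]
  rw [e3] at e2
  refine (congrArg₂ (· + ·) e1 e2).trans ?_
  abel

end Metricity

/-! ### Change of the vector chart -/

section ChartChange

open Matrix

variable {EM : Type*} [NormedAddCommGroup EM] [NormedSpace ℝ EM]
  {M : Type*} [TopologicalSpace M] [ChartedSpace EM M] [IsManifold 𝓘(ℝ, EM) ∞ M]
  {EN : Type*} [NormedAddCommGroup EN] [NormedSpace ℝ EN]
  {N : Type*} [TopologicalSpace N] [ChartedSpace EN N]
  {VF : Type*} [NormedAddCommGroup VF] [NormedSpace ℝ VF]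
  {F : N → Type*} [∀ y, AddCommGroup (F y)] [∀ y, Module ℝ (F y)]
  [∀ y, TopologicalSpace (F y)] [TopologicalSpace (TotalSpace VF F)]
  [FiberBundle VF F] [VectorBundle ℝ VF F]
  {VE : Type*} [NormedAddCommGroup VE] [NormedSpace ℝ VE]
  {E : M → Type*} [∀ x, AddCommGroup (E x)] [∀ x, Module ℝ (E x)]
  [∀ x, TopologicalSpace (E x)] [TopologicalSpace (TotalSpace VE E)]
  [FiberBundle VE E] [VectorBundle ℝ VE E] [ContMDiffVectorBundle ∞ VE E 𝓘(ℝ, EM)]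
  {A : GenLieAlgebroid EM M EN VF F} {φ : BundleIdent VE E A} {Γ : NonlinConnection VE E A}

namespace VectorChart

variable (c c' : VectorChart φ)

/-- The pairing of the horizontal with the vertical part, which comes from the pairing of `E` with
its dual bundle, does not depend on the vector chart. -/
theorem pairing_eq {u : DualSpace VE E} (hu : u.proj ∈ c.U) (hu' : u.proj ∈ c'.U)
    (X Z : GenTangent VE E A u) :
    c.dzVec u X ⬝ᵥ c.dpVec Γ u Z = c'.dzVec u X ⬝ᵥ c'.dpVec Γ u Z := by
  obtain ⟨q, hq⟩ := exists_vlift (Γ.proj_vertical u Z)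
  have key : ∀ c : VectorChart φ, u.proj ∈ c.U →
      c.dzVec u X ⬝ᵥ c.dpVec Γ u Z = q ((φ.equiv u.proj).symm X.1.1) := by
    intro c hu
    have h1 : ∀ a, c.deltap Γ a u Z = q (c.s a u.proj) := fun a ↦ by
      rw [← c.deltap_of_vlift (Γ := Γ) (Γ.proj_vertical u Z) hq, deltap, deltap,
        Γ.proj_of_vertical u _ (Γ.proj_vertical u Z)]
    conv_rhs => rw [c.expand_E hu ((φ.equiv u.proj).symm X.1.1)]
    rw [map_sum]
    exact Finset.sum_congr rfl fun a _ ↦ by rw [dpVec, h1, map_smul, smul_eq_mul]; rfl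
  rw [key c hu, key c' hu']

/-- The matrix of the frame of `c'` with respect to the frame of `c`. -/
def transition (a b : Fin (Module.finrank ℝ VE)) (x : M) : ℝ := c.coframe a x (c'.s b x)

theorem contMDiff_transition (a b : Fin (Module.finrank ℝ VE)) :
    ContMDiff 𝓘(ℝ, EM) 𝓘(ℝ, ℝ) ∞ (c.transition c' a b) :=
  (contMDiff_dual_apply (c'.s b)).comp (c.coframe a).contMDiff

theorem dz_delta_eq_transition {u : DualSpace VE E} (hu' : u.proj ∈ c'.U)
    (a b : Fin (Module.finrank ℝ VE)) :
    c.dz a u (c'.delta Γ b u) = c.transition c' a b u.proj := by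
  rw [dz, delta, Γ.hlift_fst, c'.corr _ hu', LinearEquiv.symm_apply_apply, transition]

theorem deltap_vert_eq_transition (u : DualSpace VE E) (a b : Fin (Module.finrank ℝ VE)) :
    c.deltap Γ a u (c'.vert b u) = c'.transition c b a u.proj :=
  c.deltap_of_vlift (X := c'.vert b u) rfl rfl a

variable [FiniteDimensional ℝ EN] [T2Space N] [IsManifold 𝓘(ℝ, EN) ∞ N]
  [ContMDiffVectorBundle ∞ VF F 𝓘(ℝ, EN)] [FiniteDimensional ℝ VE]

/-- The transformation rule of the structure functions. -/
theorem strFun_change {x : M} (hx : x ∈ c.U) (hx' : x ∈ c'.U)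
    (a b d : Fin (Module.finrank ℝ VE)) :
    ∑ e, c'.strFun e d b x * c.transition c' a e x
      = ∑ f, ∑ e, c.transition c' f d x * c.transition c' e b x * c.strFun a f e x
        + differential 𝓘(ℝ, EM) (c.transition c' a b) x (A.anchorAt x (c'.t d (A.h x)))
        - differential 𝓘(ℝ, EM) (c.transition c' a d) x (A.anchorAt x (c'.t b (A.h x))) := by
  have hf : ∀ a b, ContMDiff 𝓘(ℝ, EN) 𝓘(ℝ, ℝ) ∞ (c.transition c' a b ∘ A.h.symm) := fun a b ↦
    (c.contMDiff_transition c' a b).comp A.h.symm.contMDiff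
  have ht : ∀ b, ∀ᶠ y in 𝓝 (A.h x),
      c'.t b y = ∑ a, (c.transition c' a b ∘ A.h.symm) y • c.t a y := by
    intro b
    have h1 : ∀ᶠ y in 𝓝 (A.h x), A.h.symm y ∈ c.U ∩ c'.U :=
      A.h.symm.continuous.continuousAt ((c.isOpen.inter c'.isOpen).mem_nhds (by
        simpa using ⟨hx, hx'⟩))
    filter_upwards [h1] with y hy
    obtain ⟨x', rfl⟩ : ∃ x', A.h x' = y := ⟨A.h.symm y, A.h.apply_symm_apply y⟩
    rw [A.h.symm_apply_apply] at hy
    refine (c.expand_F hy.1 _).trans (Finset.sum_congr rfl fun a _ ↦ ?_)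
    rw [c'.corr x' hy.2, LinearEquiv.symm_apply_apply, Function.comp_apply, A.h.symm_apply_apply]
    rfl
  have hc : ∀ a b, (c.transition c' a b ∘ A.h.symm) ∘ A.h = c.transition c' a b := fun a b ↦
    funext fun x ↦ congrArg _ (A.h.symm_apply_apply x)
  have h2 := A.bracket_sum_smul c.t (fun a ↦ hf a d) (fun a ↦ hf a b) (ht d) (ht b)
  simp only [hc, Function.comp_apply, A.h.symm_apply_apply] at h2
  have h3 := (c'.expand_F hx' (A.bracket (c'.t d) (c'.t b) (A.h x))).symm.trans h2
  have h4 : ∀ e, c.coframe a x ((φ.equiv x).symm (c'.t e (A.h x))) = c.transition c' a e x :=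
    fun e ↦ by rw [c'.corr x hx', LinearEquiv.symm_apply_apply, transition]
  have h5 := congrArg (fun z ↦ c.coframe a x ((φ.equiv x).symm z)) h3
  simp only [map_sum, map_add, map_sub, map_smul, h4, c.coframe_t hx, smul_eq_mul, mul_ite,
    mul_one, mul_zero, Finset.sum_ite_eq, Finset.mem_univ, if_true] at h5
  exact h5

end VectorChart

end ChartChange

/-! ### The torsion of the connection of a vector chart -/

section Torsion

open Matrix

variable {EM : Type*} [NormedAddCommGroup EM] [NormedSpace ℝ EM]
  {M : Type*} [TopologicalSpace M] [ChartedSpace EM M] [IsManifold 𝓘(ℝ, EM) ∞ M]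
  {EN : Type*} [NormedAddCommGroup EN] [NormedSpace ℝ EN]
  {N : Type*} [TopologicalSpace N] [ChartedSpace EN N]
  {VF : Type*} [NormedAddCommGroup VF] [NormedSpace ℝ VF]
  {F : N → Type*} [∀ y, AddCommGroup (F y)] [∀ y, Module ℝ (F y)]
  [∀ y, TopologicalSpace (F y)] [TopologicalSpace (TotalSpace VF F)]
  [FiberBundle VF F] [VectorBundle ℝ VF F]
  {VE : Type*} [NormedAddCommGroup VE] [NormedSpace ℝ VE]
  {E : M → Type*} [∀ x, AddCommGroup (E x)] [∀ x, Module ℝ (E x)]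
  [∀ x, TopologicalSpace (E x)] [TopologicalSpace (TotalSpace VE E)]
  [FiberBundle VE E] [VectorBundle ℝ VE E] [ContMDiffVectorBundle ∞ VE E 𝓘(ℝ, EM)]
  {A : GenLieAlgebroid EM M EN VF F} {φ : BundleIdent VE E A} {Γ : NonlinConnection VE E A}
variable {G : PseudoMetric Γ} {T S : GenTensor VE E A} (c c' : VectorChart φ)

/-- A bilinear form for which the family `e'` lies in the kernel on both sides. -/
theorem bilin_comb {ι V : Type*} [Fintype ι] [AddCommGroup V] [Module ℝ V]
    (B : V →ₗ[ℝ] V →ₗ[ℝ] ℝ) (e e' : ι → V) (h : ∀ a Y, B (e' a) Y = 0)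
    (h' : ∀ X b, B X (e' b) = 0) (f g f' g' : ι → ℝ) :
    B (∑ a, f a • e a + ∑ a, g a • e' a) (∑ a, f' a • e a + ∑ a, g' a • e' a)
      = ∑ a, ∑ b, f a * f' b * B (e a) (e b) := by
  simp [h, h', Finset.mul_sum, mul_assoc]

/-- The components of a horizontal tensor field determine it. -/
theorem dz_tensorH (hT : IsHTensor Γ T) {u : DualSpace VE E} (hu : u.proj ∈ c.U)
    (X Y : GenTangent VE E A u) (a : Fin (Module.finrank ℝ VE)) :
    c.dz a u (T u X Y) = ∑ e, ∑ f, c.dz e u X * c.dz f u Y * tensorH Γ T c a e f u := by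
  have key := bilin_comb ((T u).compr₂ (c.dzLin a u)) (fun a ↦ c.delta Γ a u) (fun a ↦ c.vert a u)
    (fun b Y ↦ (congrArg (c.dzLin a u) (hT.left u (c.vert b u) Y rfl)).trans (map_zero _))
    (fun X b ↦ (congrArg (c.dzLin a u) (hT.right u X (c.vert b u) rfl)).trans (map_zero _))
    (fun a ↦ c.dz a u X) (fun a ↦ c.deltap Γ a u X) (fun a ↦ c.dz a u Y) (fun a ↦ c.deltap Γ a u Y)
  exact (congrArg₂ (fun Z Z' ↦ c.dz a u (T u Z Z')) (c.eq_comb (Γ := Γ) hu X)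
    (c.eq_comb (Γ := Γ) hu Y)).trans key

/-- The components of a vertical tensor field determine it. -/
theorem deltap_tensorV (hS : IsVTensor Γ S) {u : DualSpace VE E} (hu : u.proj ∈ c.U)
    (X Y : GenTangent VE E A u) (b : Fin (Module.finrank ℝ VE)) :
    c.deltap Γ b u (S u X Y)
      = ∑ e, ∑ f, c.deltap Γ e u X * c.deltap Γ f u Y * tensorV Γ S c e f b u := by
  have key := bilin_comb ((S u).compr₂ (c.deltapLin Γ b u)) (fun a ↦ c.vert a u)
    (fun a ↦ c.delta Γ a u)
    (fun a Y ↦ (congrArg (c.deltapLin Γ b u) (hS.left u (c.delta Γ a u) Y (c.proj_delta u a))).trans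
      (map_zero _))
    (fun X a ↦ (congrArg (c.deltapLin Γ b u) (hS.right u X (c.delta Γ a u)
      (c.proj_delta u a))).trans (map_zero _))
    (fun a ↦ c.deltap Γ a u X) (fun a ↦ c.dz a u X) (fun a ↦ c.deltap Γ a u Y) (fun a ↦ c.dz a u Y)
  have hc : ∀ X : GenTangent VE E A u, X = ∑ a, c.deltap Γ a u X • c.vert a u
      + ∑ a, c.dz a u X • c.delta Γ a u := fun X ↦
    (c.eq_comb (Γ := Γ) hu X).trans (add_comm _ _)
  exact (congrArg₂ (fun Z Z' ↦ c.deltap Γ b u (S u Z Z')) (hc X) (hc Y)).trans key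

section Components

variable (hG : G.DeterminedByVertical φ)
include hG

theorem modifiedH_sub (hT : ∀ u X Y, T u X Y = -T u Y X) {u : DualSpace VE E} (hu : u.proj ∈ c.U)
    (a b d : Fin (Module.finrank ℝ VE)) :
    modifiedH G T c a b d u - modifiedH G T c a d b u
      = tensorH Γ T c a b d u - c.strFun a b d u.proj := by
  rw [modifiedH_eq_koszul, modifiedH_eq_koszul]
  exact koszul_sub (hG c u hu) (fun a b d ↦ by rw [G.low_symm c a b])
    (fun a b d ↦ by rw [tensorH_skew hT, c.strFun_skew]; ring) a b d

theorem modifiedV_sub (hS : ∀ u X Y, S u X Y = -S u Y X) {u : DualSpace VE E} (hu : u.proj ∈ c.U)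
    (a d b : Fin (Module.finrank ℝ VE)) :
    modifiedV G S c a d b u - modifiedV G S c d a b u = tensorV Γ S c a d b u := by
  rw [modifiedV_eq_koszul, modifiedV_eq_koszul]
  exact koszul_sub (sum_mul_eq_comm (hG c u hu)) (fun a b d ↦ by rw [G.up_symm c a b])
    (fun a b d ↦ tensorV_skew hS c b d a u) b a d

end Components

variable [FiniteDimensional ℝ EN] [T2Space N] [IsManifold 𝓘(ℝ, EN) ∞ N]
  [ContMDiffVectorBundle ∞ VF F 𝓘(ℝ, EN)] [FiniteDimensional ℝ VE]

/-- The horizontal components of the connection of `c` over another chart `c'`: the derivative of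
the transition matrix adds to the transformed components. -/
theorem dz_localConn_delta {u : DualSpace VE E} (hu : u.proj ∈ c.U) (hu' : u.proj ∈ c'.U)
    (a b d : Fin (Module.finrank ℝ VE)) :
    c.dz a u (localConn G T S c (c'.delta Γ b) u (c'.delta Γ d u))
      = differential 𝓘(ℝ, EM) (c.transition c' a b) u.proj
          (A.anchorAt u.proj (c'.t d (A.h u.proj)))
        + ∑ e, ∑ f, c.transition c' e b u.proj * c.transition c' f d u.proj
          * modifiedH G T c a e f u := by
  have h1 : (fun w ↦ c.dz a w (c'.delta Γ b w)) =ᶠ[𝓝 u] fun w ↦ c.transition c' a b w.proj := by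
    filter_upwards [eventually_proj_mem c' hu'] with w hw
      using c.dz_delta_eq_transition c' hw a b
  have h2 := lieD_comp_proj u (c'.delta Γ d u)
    ((c.contMDiff_transition c' a b).mdifferentiableAt (x := u.proj) (by simp))
  have h3 : (c'.delta Γ d u).1.1 = c'.t d (A.h u.proj) := Γ.hlift_fst u _
  rw [h3] at h2
  rw [dz_localConn G T S c hu, lieD_congr u _ h1, h2]
  simp only [connForm_apply, c.dz_delta_eq_transition c' hu', c.deltap_eq_zero (c'.proj_delta u _),
    mul_zero, Finset.sum_const_zero, sub_zero, Finset.mul_sum]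
  refine congrArg _ (Finset.sum_congr rfl fun e _ ↦ Finset.sum_congr rfl fun f _ ↦ by ring)

/-- On the vertical part the components transform like a tensor, as the transition matrices are
constant along the fibres. -/
theorem deltap_localConn_vert {u : DualSpace VE E} (hu : u.proj ∈ c.U)
    (a b d : Fin (Module.finrank ℝ VE)) :
    c.deltap Γ b u (localConn G T S c (c'.vert a) u (c'.vert d u))
      = ∑ e, ∑ f, c.deltap Γ e u (c'.vert a u) * c.deltap Γ f u (c'.vert d u)
          * modifiedV G S c e f b u := by
  have h1 : (fun w ↦ c.deltap Γ b w (c'.vert a w)) = fun w ↦ c'.transition c a b w.proj :=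
    funext fun w ↦ c.deltap_vert_eq_transition c' w b a
  have h2 := lieD_comp_proj u (c'.vert d u)
    ((c'.contMDiff_transition c a b).mdifferentiableAt (x := u.proj) (by simp))
  have h3 : (c'.vert d u).1.1 = 0 := rfl
  rw [h3, map_zero, map_zero] at h2
  rw [deltap_localConn G T S c hu, h1, h2]
  simp only [connForm_apply, c.dz_eq_zero h3, mul_zero, Finset.sum_const_zero,
    zero_sub, mul_neg, Finset.sum_neg_distrib, neg_neg, Finset.mul_sum]
  refine Finset.sum_congr rfl fun e _ ↦ Finset.sum_congr rfl fun f _ ↦ by ring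

variable (hG : G.DeterminedByVertical φ)
include hG

/-- The derivatives of the transition matrix in the transformed components cancel against those in
`VectorChart.strFun_change`. -/
theorem dz_localConn_torsionH (hT : IsHTensor Γ T) (hT_skew : ∀ u X Y, T u X Y = -T u Y X)
    {u : DualSpace VE E} (hu : u.proj ∈ c.U) (hu' : u.proj ∈ c'.U)
    (a b d : Fin (Module.finrank ℝ VE)) :
    c.dz a u (localConn G T S c (c'.delta Γ b) u (c'.delta Γ d u))
        - c.dz a u (localConn G T S c (c'.delta Γ d) u (c'.delta Γ b u))
      = c.dz a u (T u (c'.delta Γ b u) (c'.delta Γ d u))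
        + ∑ e, c'.strFun e d b u.proj * c.transition c' a e u.proj := by
  rw [c.strFun_change c' hu hu', dz_tensorH c hT hu, dz_localConn_delta c c' hu hu',
    dz_localConn_delta c c' hu hu']
  simp only [c.dz_delta_eq_transition c' hu']
  have h1 : ∀ e f, tensorH Γ T c a e f u
      = modifiedH G T c a e f u - modifiedH G T c a f e u - c.strFun a f e u.proj :=
    fun e f ↦ by rw [modifiedH_sub c hG hT_skew hu, c.strFun_skew a f e]; ring
  -- The summation indices are swapped where the factors belong to `d` and `b` in this order.
  simp only [h1, mul_sub, Finset.sum_sub_distrib]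
  rw [Finset.sum_comm (f := fun e f ↦ c.transition c' e d u.proj * c.transition c' f b u.proj
    * modifiedH G T c a e f u), Finset.sum_comm (f := fun e f ↦ c.transition c' e d u.proj
    * c.transition c' f b u.proj * c.strFun a e f u.proj)]
  simp only [mul_comm (c.transition c' _ d u.proj)]
  ring

/-- The horizontal torsion of the connection of the chart `c` over another chart `c'`. -/
theorem localConn_torsionH (hT : IsHTensor Γ T) (hT_skew : ∀ u X Y, T u X Y = -T u Y X)
    {u : DualSpace VE E} (hu : u.proj ∈ c.U) (hu' : u.proj ∈ c'.U)
    (b d : Fin (Module.finrank ℝ VE)) :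
    localConn G T S c (c'.delta Γ b) u (c'.delta Γ d u)
        - localConn G T S c (c'.delta Γ d) u (c'.delta Γ b u)
      = T u (c'.delta Γ b u) (c'.delta Γ d u)
        + ∑ e, c'.strFun e d b u.proj • c'.delta Γ e u := by
  have hp : ∀ b d, Γ.proj u (localConn G T S c (c'.delta Γ b) u (c'.delta Γ d u)) = 0 := fun b d ↦
    localConn_horizontal G T S c hu (Filter.Eventually.of_forall fun w ↦ c'.proj_delta w b) _
  refine c.ext_coord (Γ := Γ) hu (fun a ↦ ?_) fun a ↦ ?_
  · rw [c.dz_sub, c.dz_add, c.dz_sum]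
    simp only [c.dz_smul, c.dz_delta_eq_transition c' hu']
    exact dz_localConn_torsionH c c' hG hT hT_skew hu hu' a b d
  · rw [c.deltap_sub, c.deltap_add, c.deltap_sum]
    simp only [c.deltap_smul, c.deltap_eq_zero (c'.proj_delta u _),
      c.deltap_eq_zero (hT.horizontal u _ _), c.deltap_eq_zero (hp b d),
      c.deltap_eq_zero (hp d b), mul_zero, Finset.sum_const_zero, add_zero, sub_zero]

/-- The vertical torsion of the connection of the chart `c` over another chart `c'`. -/
theorem localConn_torsionV (hS : IsVTensor Γ S) (hS_skew : ∀ u X Y, S u X Y = -S u Y X)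
    {u : DualSpace VE E} (hu : u.proj ∈ c.U) (a d : Fin (Module.finrank ℝ VE)) :
    localConn G T S c (c'.vert a) u (c'.vert d u) - localConn G T S c (c'.vert d) u (c'.vert a u)
      = S u (c'.vert a u) (c'.vert d u) := by
  have hp : ∀ a d, (localConn G T S c (c'.vert a) u (c'.vert d u)).1.1 = 0 := fun a d ↦
    localConn_vertical G T S c hu (Filter.Eventually.of_forall fun w ↦ rfl) _
  refine c.ext_coord (Γ := Γ) hu (fun b ↦ ?_) fun b ↦ ?_
  · refine (c.dz_eq_zero ?_ b).trans (c.dz_eq_zero (hS.vertical u _ _) b).symm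
    change (localConn G T S c (c'.vert a) u (c'.vert d u)).1.1
      - (localConn G T S c (c'.vert d) u (c'.vert a u)).1.1 = 0
    rw [hp, hp, sub_zero]
  · rw [c.deltap_sub, deltap_tensorV c hS hu, deltap_localConn_vert c c' hu,
      deltap_localConn_vert c c' hu]
    simp only [← modifiedV_sub c hG hS_skew hu, mul_sub, Finset.sum_sub_distrib]
    rw [Finset.sum_comm (f := fun e f ↦ c.deltap Γ e u (c'.vert d u)
      * c.deltap Γ f u (c'.vert a u) * modifiedV G S c e f b u)]
    simp only [mul_comm (c.deltap Γ _ u (c'.vert d u))]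

end Torsion

/-! ### Independence of the vector chart -/

section Independence

open Matrix

variable {EM : Type*} [NormedAddCommGroup EM] [NormedSpace ℝ EM]
  {M : Type*} [TopologicalSpace M] [ChartedSpace EM M] [IsManifold 𝓘(ℝ, EM) ∞ M]
  {EN : Type*} [NormedAddCommGroup EN] [NormedSpace ℝ EN]
  {N : Type*} [TopologicalSpace N] [ChartedSpace EN N]
  {VF : Type*} [NormedAddCommGroup VF] [NormedSpace ℝ VF]
  {F : N → Type*} [∀ y, AddCommGroup (F y)] [∀ y, Module ℝ (F y)]
  [∀ y, TopologicalSpace (F y)] [TopologicalSpace (TotalSpace VF F)]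
  [FiberBundle VF F] [VectorBundle ℝ VF F]
  {VE : Type*} [NormedAddCommGroup VE] [NormedSpace ℝ VE]
  {E : M → Type*} [∀ x, AddCommGroup (E x)] [∀ x, Module ℝ (E x)]
  [∀ x, TopologicalSpace (E x)] [TopologicalSpace (TotalSpace VE E)]
  [FiberBundle VE E] [VectorBundle ℝ VE E] [ContMDiffVectorBundle ∞ VE E 𝓘(ℝ, EM)]
  {A : GenLieAlgebroid EM M EN VF F} {φ : BundleIdent VE E A} {Γ : NonlinConnection VE E A}
variable {G : PseudoMetric Γ} {T S : GenTensor VE E A} (c c' : VectorChart φ)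

theorem PseudoMetric.form_delta {u : DualSpace VE E} (hu : u.proj ∈ c.U) (X : GenTangent VE E A u)
    (b : Fin (Module.finrank ℝ VE)) :
    G.form u X (c.delta Γ b u) = ∑ e, c.dz e u X * G.low c e b u := by
  have h1 : c.dzVec u (c.delta Γ b u) = Pi.single b 1 := funext fun a ↦ by
    rw [VectorChart.dzVec, c.dz_delta hu, Pi.single_apply]
  have h2 : c.dpVec Γ u (c.delta Γ b u) = 0 := funext fun a ↦ c.deltap_delta u a b
  rw [G.form_eq c hu, h1, h2, mulVec_zero, dotProduct_zero, add_zero, mulVec_single_one]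
  rfl

theorem PseudoMetric.form_vert {u : DualSpace VE E} (hu : u.proj ∈ c.U) (X : GenTangent VE E A u)
    (b : Fin (Module.finrank ℝ VE)) :
    G.form u X (c.vert b u) = ∑ e, c.deltap Γ e u X * G.up c e b u := by
  have h1 : c.dpVec Γ u (c.vert b u) = Pi.single b 1 := funext fun a ↦ by
    rw [VectorChart.dpVec, c.deltap_vert hu, Pi.single_apply]
  have h2 : c.dzVec u (c.vert b u) = 0 := funext fun a ↦ c.dz_vert u a b
  rw [G.form_eq c hu, h1, h2, mulVec_zero, dotProduct_zero, zero_add, mulVec_single_one]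
  rfl

variable [FiniteDimensional ℝ EN] [T2Space N] [IsManifold 𝓘(ℝ, EN) ∞ N]
  [ContMDiffVectorBundle ∞ VF F 𝓘(ℝ, EN)] [FiniteDimensional ℝ VE]

/-- The connection of the chart `c` is dual on the horizontal and on the vertical part of the
adapted base of any other chart. -/
theorem deltap_localConn_vert_eq_neg {u : DualSpace VE E} (hu : u.proj ∈ c.U) (hu' : u.proj ∈ c'.U)
    (a b : Fin (Module.finrank ℝ VE)) (x : GenTangent VE E A u) :
    c'.deltap Γ b u (localConn G T S c (c'.vert a) u x)
      = -c'.dz a u (localConn G T S c (c'.delta Γ b) u x) := by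
  have h1 := lieD_pairing G T S c hu (c'.smoothSectionAt_delta (Γ := Γ) b u).diffSectionAt
    (c'.smoothSectionAt_vert a u).diffSectionAt x
  have h2 : (fun w ↦ c.dzVec w (c'.delta Γ b w) ⬝ᵥ c.dpVec Γ w (c'.vert a w)) =ᶠ[𝓝 u]
      fun _ ↦ if a = b then 1 else 0 := by
    filter_upwards [eventually_proj_mem c hu, eventually_proj_mem c' hu'] with w hw hw'
    rw [c.pairing_eq c' hw hw']
    simp [dotProduct, VectorChart.dzVec, VectorChart.dpVec, c'.dz_delta hw', c'.deltap_vert hw']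
  rw [lieD_congr u x h2, lieD_const, c.pairing_eq c' hu hu', c.pairing_eq c' hu hu'] at h1
  simp only [dotProduct, VectorChart.dzVec, VectorChart.dpVec, c'.dz_delta hu', c'.deltap_vert hu',
    mul_ite, ite_mul, mul_one, one_mul, mul_zero, zero_mul, Finset.sum_ite_eq',
    Finset.mem_univ, if_true] at h1
  linarith

variable (hG : G.DeterminedByVertical φ) (hT : IsHTensor Γ T) (hS : IsVTensor Γ S)
  (hT_skew : ∀ u X Y, T u X Y = -T u Y X) (hS_skew : ∀ u X Y, S u X Y = -S u Y X)
include hG hT hS hT_skew hS_skew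

/-- The connection of `c` is metric and has the prescribed torsion over `c'`, so by uniqueness its
horizontal components over `c'` are those of the Koszul formula of `c'`. -/
theorem dz_localConn_eq_modifiedH {u : DualSpace VE E} (hu : u.proj ∈ c.U) (hu' : u.proj ∈ c'.U)
    (a b d : Fin (Module.finrank ℝ VE)) :
    c'.dz a u (localConn G T S c (c'.delta Γ b) u (c'.delta Γ d u)) = modifiedH G T c' a b d u := by
  rw [modifiedH_eq_koszul]
  refine eq_koszul
    (H := fun a b d ↦ c'.dz a u (localConn G T S c (c'.delta Γ b) u (c'.delta Γ d u)))
    (hG c' u hu') (fun a b ↦ congrFun (G.low_symm c' a b) u) (fun a b d ↦ ?_) (fun a b d ↦ ?_) a b d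
  · have h := congrArg (c'.dz a u) (localConn_torsionH c c' hG hT hT_skew (S := S) hu hu' b d)
    rw [c'.dz_sub, c'.dz_add, c'.dz_sum] at h
    simp only [c'.dz_smul, c'.dz_delta hu', mul_ite, mul_one, mul_zero,
      Finset.sum_ite_eq, Finset.mem_univ, if_true] at h
    rw [h, c'.strFun_skew a d b, tensorH]
    ring
  · have h := localConn_metric c hG hT_skew hS_skew hu
      (c'.smoothSectionAt_delta (Γ := Γ) a u).diffSectionAt
      (c'.smoothSectionAt_delta (Γ := Γ) b u).diffSectionAt (c'.delta Γ d u)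
    rw [G.form_delta c' hu', G.symm u (c'.delta Γ a u), G.form_delta c' hu'] at h
    refine h.trans ?_
    simp only [mul_comm, G.low_symm c' a]

/-- The analogue of `dz_localConn_eq_modifiedH` for the vertical components. -/
theorem deltap_localConn_eq_modifiedV {u : DualSpace VE E} (hu : u.proj ∈ c.U)
    (hu' : u.proj ∈ c'.U) (a b d : Fin (Module.finrank ℝ VE)) :
    c'.deltap Γ b u (localConn G T S c (c'.vert a) u (c'.vert d u)) = modifiedV G S c' a d b u := by
  rw [modifiedV_eq_koszul]
  refine eq_koszul
    (H := fun b a d ↦ c'.deltap Γ b u (localConn G T S c (c'.vert a) u (c'.vert d u)))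
    (sum_mul_eq_comm (hG c' u hu')) (fun a b ↦ congrFun (G.up_symm c' a b) u) (fun b a d ↦ ?_)
    (fun a b d ↦ ?_) b a d
  · have h := congrArg (c'.deltap Γ b u) (localConn_torsionV c c' hG hS hS_skew (T := T) hu a d)
    rw [c'.deltap_sub] at h
    exact h
  · have h := localConn_metric c hG hT_skew hS_skew hu
      (c'.smoothSectionAt_vert a u).diffSectionAt
      (c'.smoothSectionAt_vert b u).diffSectionAt (c'.vert d u)
    rw [G.form_vert c' hu', G.symm u (c'.vert a u), G.form_vert c' hu'] at h
    refine h.trans ?_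
    simp only [mul_comm, G.up_symm c' a]

/-- The connection of the chart `c` has the connection form of the chart `c'` over `c'`. -/
theorem dz_localConn_eq_connForm {u : DualSpace VE E} (hu : u.proj ∈ c.U) (hu' : u.proj ∈ c'.U)
    (a b : Fin (Module.finrank ℝ VE)) (x : GenTangent VE E A u) :
    c'.dz a u (localConn G T S c (c'.delta Γ b) u x) = connForm G T S c' u a b x := by
  have h : c'.dzLin a u ∘ₗ localConn G T S c (c'.delta Γ b) u = connForm G T S c' u a b := by
    refine c'.linearMap_ext (Γ := Γ) hu' (fun d ↦ ?_) fun d ↦ ?_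
    · rw [connForm_delta G T S c' hu']
      exact dz_localConn_eq_modifiedH c c' hG hT hS hT_skew hS_skew hu hu' a b d
    · rw [connForm_vert G T S c' hu', ← deltap_localConn_eq_modifiedV c c' hG hT hS hT_skew hS_skew
        hu hu', deltap_localConn_vert_eq_neg c c' hu hu', neg_neg]
      rfl
  exact LinearMap.congr_fun h x

/-- The connections of two vector charts agree over the intersection of their domains. -/
theorem localConn_eq {u : DualSpace VE E} (hu : u.proj ∈ c.U) (hu' : u.proj ∈ c'.U)
    {Y : GenSection VE E A} (hY : DiffSectionAt A Y u) :
    localConn G T S c Y u = localConn G T S c' Y u := by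
  have hδ := fun b w ↦ c'.proj_delta (Γ := Γ) w b
  refine IsDerivationAt.ext_adapted (Γ := Γ) c' hu' (isDerivationAt_localConn G T S c hu)
    (isDerivationAt_localConn G T S c' hu') (fun b ↦ ?_) (fun a ↦ ?_) hY <;>
    ext1 x <;> refine c'.ext_coord (Γ := Γ) hu' (fun e ↦ ?_) fun e ↦ ?_
  · rw [dz_localConn_eq_connForm c c' hG hT hS hT_skew hS_skew hu hu',
      localConn_delta G T S c' hu']
  · exact (c'.deltap_eq_zero (localConn_horizontal G T S c hu (.of_forall (hδ b)) x) e).trans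
      (c'.deltap_eq_zero (localConn_horizontal G T S c' hu' (.of_forall (hδ b)) x) e).symm
  · exact (c'.dz_eq_zero (localConn_vertical G T S c hu (.of_forall fun w ↦ rfl) x) e).trans
      (c'.dz_eq_zero (localConn_vertical G T S c' hu' (.of_forall fun w ↦ rfl) x) e).symm
  · rw [deltap_localConn_vert_eq_neg c c' hu hu',
      dz_localConn_eq_connForm c c' hG hT hS hT_skew hS_skew hu hu', localConn_vert G T S c' hu']

end Independence

/-! ### The connection -/

section Connection

open Matrix

variable {EM : Type*} [NormedAddCommGroup EM] [NormedSpace ℝ EM]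
  {M : Type*} [TopologicalSpace M] [ChartedSpace EM M] [IsManifold 𝓘(ℝ, EM) ∞ M]
  {EN : Type*} [NormedAddCommGroup EN] [NormedSpace ℝ EN]
  {N : Type*} [TopologicalSpace N] [ChartedSpace EN N]
  {VF : Type*} [NormedAddCommGroup VF] [NormedSpace ℝ VF]
  {F : N → Type*} [∀ y, AddCommGroup (F y)] [∀ y, Module ℝ (F y)]
  [∀ y, TopologicalSpace (F y)] [TopologicalSpace (TotalSpace VF F)]
  [FiberBundle VF F] [VectorBundle ℝ VF F]
  {VE : Type*} [NormedAddCommGroup VE] [NormedSpace ℝ VE]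
  {E : M → Type*} [∀ x, AddCommGroup (E x)] [∀ x, Module ℝ (E x)]
  [∀ x, TopologicalSpace (E x)] [TopologicalSpace (TotalSpace VE E)]
  [FiberBundle VE E] [VectorBundle ℝ VE E] [ContMDiffVectorBundle ∞ VE E 𝓘(ℝ, EM)]
  {A : GenLieAlgebroid EM M EN VF F} {φ : BundleIdent VE E A} {Γ : NonlinConnection VE E A}
variable [FiniteDimensional ℝ EM] [T2Space M]
variable [FiniteDimensional ℝ EN] [T2Space N] [IsManifold 𝓘(ℝ, EN) ∞ N]
  [ContMDiffVectorBundle ∞ VF F 𝓘(ℝ, EN)] [FiniteDimensional ℝ VE]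
variable {G : PseudoMetric Γ} {T S : GenTensor VE E A}

/-- The distinguished connection which is obtained by gluing the connections of the vector charts.
At each point it is the connection of some chart, and by `localConn_eq` the choice does not matter.
-/
def gluedConn (hG : G.DeterminedByVertical φ) (hT : IsHTensor Γ T) (hS : IsVTensor Γ S)
    (hT_skew : ∀ u X Y, T u X Y = -T u Y X) (hS_skew : ∀ u X Y, S u X Y = -S u Y X) :
    DistConnection Γ where
  D Y u := localConn G T S (VectorChart.exists_mem φ u.proj).choose Y u
  add Y Y' u hY hY' := (isDerivationAt_localConn G T S _
    (VectorChart.exists_mem φ u.proj).choose_spec).add Y Y' hY hY'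
  leibniz f Y u hf hY x := (isDerivationAt_localConn G T S _
    (VectorChart.exists_mem φ u.proj).choose_spec).leibniz f Y hf hY x
  smooth X Y O hO hX hY := smoothSectionOn_of_forall fun u hu ↦ by
    obtain ⟨c, hc⟩ := VectorChart.exists_mem φ u.proj
    refine (smoothSectionAt_localConn G T S c hT hS hc (hX.smoothSectionAt hO hu)
      (hY.smoothSectionAt hO hu)).congr ?_
    filter_upwards [eventually_proj_mem c hc, hO.mem_nhds hu] with w hw hwO
    exact LinearMap.congr_fun (localConn_eq _ c hG hT hS hT_skew hS_skew
      (VectorChart.exists_mem φ w.proj).choose_spec hw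
      (hY.smoothSectionAt hO hwO).diffSectionAt) (X w)
  horizontal Y u _ h x := localConn_horizontal G T S _
    (VectorChart.exists_mem φ u.proj).choose_spec h x
  vertical Y u _ h x := localConn_vertical G T S _
    (VectorChart.exists_mem φ u.proj).choose_spec h x

/-- Over each chart the glued connection is the connection of this chart. -/
theorem gluedConn_D (hG : G.DeterminedByVertical φ) (hT : IsHTensor Γ T) (hS : IsVTensor Γ S)
    (hT_skew : ∀ u X Y, T u X Y = -T u Y X) (hS_skew : ∀ u X Y, S u X Y = -S u Y X)
    (c : VectorChart φ) {u : DualSpace VE E} (hu : u.proj ∈ c.U) {Y : GenSection VE E A}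
    (hY : DiffSectionAt A Y u) :
    (gluedConn hG hT hS hT_skew hS_skew).D Y u = localConn G T S c Y u :=
  localConn_eq _ c hG hT hS hT_skew hS_skew (VectorChart.exists_mem φ u.proj).choose_spec hu hY

variable (c : VectorChart φ)

theorem sum_smul_delta_fst (r : Fin (Module.finrank ℝ VE) → ℝ) (u : DualSpace VE E) :
    (∑ e, r e • c.delta Γ e u).1.1 = ∑ e, r e • c.t e (A.h u.proj) := by
  let L : GenTangent VE E A u →ₗ[ℝ] F (A.h u.proj) :=
    LinearMap.fst ℝ _ _ ∘ₗ (GenTangent VE E A u).subtype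
  refine (map_sum L _ _).trans (Finset.sum_congr rfl fun e _ ↦ (L.map_smul _ _).trans ?_)
  exact congrArg (r e • ·) (Γ.hlift_fst u (c.t e (A.h u.proj)))

theorem genBracket_delta_fst {u : DualSpace VE E} (hu : u.proj ∈ c.U)
    (b d : Fin (Module.finrank ℝ VE)) :
    (genBracket c (c.delta Γ d) (c.delta Γ b) u).1
      = ∑ e, c.strFun e d b u.proj • c.t e (A.h u.proj) := by
  have h : ∀ (x : GenTangent VE E A u) k b, lieD u x (fun w ↦ c.dz k w (c.delta Γ b w)) = 0 :=
    fun x k b ↦ (lieD_congr u x ((eventually_proj_mem c hu).mono fun w hw ↦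
      c.dz_delta hw k b)).trans (lieD_const u x _)
  simp [genBracket, h, c.dz_delta hu]

/-- The vertical part of the adapted base commutes. -/
theorem genBracket_vert (u : DualSpace VE E) (a d : Fin (Module.finrank ℝ VE)) :
    genBracket c (c.vert d) (c.vert a) u = 0 := by
  refine Prod.ext ?_ (mlieBracket_vlift (c.coframe d) (c.coframe a) u)
  simp [genBracket, c.dz_vert, lieD_const]

end Connection

end GenHamilton

end

open GenHamilton in
theorem theorem6p2
    {EM : Type*} [NormedAddCommGroup EM] [NormedSpace ℝ EM] [FiniteDimensional ℝ EM]
    {M : Type*} [TopologicalSpace M] [T2Space M] [ChartedSpace EM M] [IsManifold 𝓘(ℝ, EM) ∞ M]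
    {EN : Type*} [NormedAddCommGroup EN] [NormedSpace ℝ EN] [FiniteDimensional ℝ EN]
    {N : Type*} [TopologicalSpace N] [T2Space N] [ChartedSpace EN N] [IsManifold 𝓘(ℝ, EN) ∞ N]
    {VF : Type*} [NormedAddCommGroup VF] [NormedSpace ℝ VF] [FiniteDimensional ℝ VF]
    {F : N → Type*} [∀ y, AddCommGroup (F y)] [∀ y, Module ℝ (F y)]
    [∀ y, TopologicalSpace (F y)] [TopologicalSpace (TotalSpace VF F)]
    [FiberBundle VF F] [VectorBundle ℝ VF F] [ContMDiffVectorBundle ∞ VF F 𝓘(ℝ, EN)]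
    {VE : Type*} [NormedAddCommGroup VE] [NormedSpace ℝ VE] [FiniteDimensional ℝ VE]
    {E : M → Type*} [∀ x, AddCommGroup (E x)] [∀ x, Module ℝ (E x)]
    [∀ x, TopologicalSpace (E x)] [TopologicalSpace (TotalSpace VE E)]
    [FiberBundle VE E] [VectorBundle ℝ VE E] [ContMDiffVectorBundle ∞ VE E 𝓘(ℝ, EM)]
    (A : GenHamilton.GenLieAlgebroid EM M EN VF F)
    (φ : GenHamilton.BundleIdent VE E A)
    (Γ : GenHamilton.NonlinConnection VE E A)
    (G : GenHamilton.PseudoMetric Γ) (hG : G.DeterminedByVertical φ)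
    (T S : GenHamilton.GenTensor VE E A)
    (hT : GenHamilton.IsHTensor Γ T) (hS : GenHamilton.IsVTensor Γ S)
    (hT_skew : ∀ u X Y, T u X Y = -T u Y X) (hS_skew : ∀ u X Y, S u X Y = -S u Y X) :
    ∃ D : GenHamilton.DistConnection Γ,
      D.IsNormal φ ∧ D.IsMetric G ∧
      ∀ (c : GenHamilton.VectorChart φ) (u : GenHamilton.DualSpace VE E), u.proj ∈ c.U →
        ∀ a b d : Fin (Module.finrank ℝ VE),
          D.compHH c a b d u = GenHamilton.modifiedH G T c a b d u ∧
          D.compVV c a d b u = GenHamilton.modifiedV G S c a d b u ∧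
          (D.torsion c (c.delta Γ d) (c.delta Γ b) u).1
            = (T u (c.delta Γ b u) (c.delta Γ d u)).1.1 ∧
          D.torsion c (c.vert d) (c.vert a) u = (S u (c.vert a u) (c.vert d u)).1 ∧
          GenHamilton.tensorH Γ T c a b d u
            = D.compHH c a b d u - D.compHH c a d b u - c.strFun a d b u.proj ∧
          GenHamilton.tensorV Γ S c a d b u
            = D.compVV c a d b u - D.compVV c d a b u := by

  let D := gluedConn hG hT hS hT_skew hS_skew
  have hδ : ∀ (c : VectorChart φ) b u, DiffSectionAt A (c.delta Γ b) u := fun c b u ↦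
    (c.smoothSectionAt_delta b u).diffSectionAt
  have hv : ∀ (c : VectorChart φ) b u, DiffSectionAt A (c.vert b) u := fun c b u ↦
    (c.smoothSectionAt_vert b u).diffSectionAt
  have hD : ∀ (c : VectorChart φ) {u : DualSpace VE E} (_ : u.proj ∈ c.U) {Y : GenSection VE E A}
      (_ : DiffSectionAt A Y u), D.D Y u = localConn G T S c Y u := fun c u hu Y hY ↦
    gluedConn_D hG hT hS hT_skew hS_skew c hu hY
  have hHH : ∀ (c : VectorChart φ) {u : DualSpace VE E} (_ : u.proj ∈ c.U) a b d,
      D.compHH c a b d u = modifiedH G T c a b d u := fun c u hu a b d ↦ by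
    rw [DistConnection.compHH, hD c hu (hδ c b u), localConn_delta G T S c hu,
      connForm_delta G T S c hu]
  have hVV : ∀ (c : VectorChart φ) {u : DualSpace VE E} (_ : u.proj ∈ c.U) a d b,
      D.compVV c a d b u = modifiedV G S c a d b u := fun c u hu a d b ↦ by
    rw [DistConnection.compVV, hD c hu (hv c a u), localConn_vert G T S c hu,
      connForm_vert G T S c hu, neg_neg]
  refine ⟨D, fun c u hu a b d ↦ ⟨?_, ?_⟩, fun Y Z u hY hZ x ↦ ?_, fun c u hu a b d ↦
    ⟨hHH c hu a b d, hVV c hu a d b, ?_, ?_, ?_, ?_⟩⟩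
  · rw [hHH c hu, DistConnection.compHV, hD c hu (hv c a u), localConn_vert G T S c hu, neg_neg,
      connForm_delta G T S c hu]
  · rw [hVV c hu, DistConnection.compVH, hD c hu (hδ c b u), localConn_delta G T S c hu,
      connForm_vert G T S c hu, neg_neg]
  · obtain ⟨c, hc⟩ := VectorChart.exists_mem φ u.proj
    rw [hD c hc hY, hD c hc hZ]
    exact localConn_metric c hG hT_skew hS_skew hc hY hZ x
  -- In the base `δ_a` only the structure functions contribute to the first component of the
  -- bracket.
  · have h1 := congrArg (fun X ↦ X.1.1) (localConn_torsionH c c hG hT hT_skew (S := S) hu hu b d)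
    rw [DistConnection.torsion, hD c hu (hδ c b u), hD c hu (hδ c d u)]
    have h2 := (sum_smul_delta_fst (Γ := Γ) c (fun e ↦ c.strFun e d b u.proj) u).trans
      (genBracket_delta_fst (Γ := Γ) c hu b d).symm
    exact sub_eq_of_eq_add (h1.trans (congrArg (_ + ·) h2))
  -- The vertical lifts `∂^a` commute, so the bracket drops out.
  · have h1 := congrArg Subtype.val (localConn_torsionV c c hG hS hS_skew (T := T) hu a d)
    rw [DistConnection.torsion, hD c hu (hv c a u), hD c hu (hv c d u), genBracket_vert, sub_zero]
    exact h1
  · rw [hHH c hu, hHH c hu, modifiedH_sub c hG hT_skew hu, c.strFun_skew a d b]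
    ring
  · rw [hVV c hu, hVV c hu, modifiedV_sub c hG hS_skew hu]
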